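/- Let $G$ be a noncompact connected real Lie group with simple Lie algebra $\mathfrak g$ and finite center $Z_G$. Let $\theta$ be a Cartan involution of $G$, $K=G^\theta$ the corresponding maximal compact subgroup, with Lie algebra $\mathfrak k$, and $\mathfrak g=\mathfrak k\oplus\mathfrak p$ the Cartan decomposition. Let $\mathfrak a\subset\mathfrak p$ be maximal abelian, fix a system of positive restricted roots of $(\mathfrak g,\mathfrak a)$, let $\mathfrak n$ be the sum of the positive root spaces, $A=\exp\mathfrak a$, $N=\exp\mathfrak n$, and let $M$ be the centralizer of $A$ in $K$. Assume that $G$ has real rank one, $\dim\mathfrak a=1$, and that $\operatorname{Rank}G=\operatorname{Rank}K$. The proper parabolic subgroups of $G$ are then the conjugates $P=gMANg^{-1}$ $(g\in G)$, with unipotent radical $N_P=gNg^{-1}$. Let $\Gamma\subset G$ be a discrete subgroup such that $\Gamma\backslash G$ has finite volume. A proper parabolic subgroup $P$ is called $\Gamma$-cuspidal if $\Gamma\cap N_P$ is a uniform lattice in $N_P$. Let $\alpha$ be an element of the commensurator of $\Gamma$ in $G$, i.e. $\Gamma\cap\alpha\Gamma\alpha^{-1}$ has finite index in both $\Gamma$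 and $\alpha\Gamma\alpha^{-1}$, and let $\Xi=\Gamma\alpha\Gamma$. Let $\Xi_P$ be the set of those $\xi\in\Xi$ some $\Gamma$-conjugate of which lies in a $\Gamma$-cuspidal parabolic subgroup, and let $\Xi_P(r)$ be the set of those $\xi\in\Xi_P$ for which there is a $\Gamma$-cuspidal parabolic subgroup $P$ with $\xi\in P$ such that the centralizer of $\xi$ in $N_P$ is trivial. An element $\xi\in G$ is called semisimple if $\operatorname{Ad}(\xi)$ is a semisimple endomorphism of $\mathfrak g$; elliptic if it is not central but conjugate to an element of $K$; and hyperbolic if it is semisimple and neither central nor elliptic. Let $\Xi_H$ be the set of hyperbolic elements of $\Xi$. Then $$\Xi_P(r)\subseteq\Xi_H,$$ that is, every element of $\Xi_P(r)$ is hyperbolic. Consequently $\Xi_H$ is the disjoint union $\Xi_H=\Xi_P(r)\sqcup\Xi_H^s$, where $\Xi_H^s=\Xi_H\setminus\Xi_P(r)$. -/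

import Mathlib

open scoped Manifold ContDiff

noncomputable section

namespace RankOne

/-- Smooth real Lie groups are regular enough for Mathlib's Lie algebra structure on
`GroupLieAlgebra`. -/
instance instLEInftyMinSmoothness : ENat.LEInfty (minSmoothness ℝ 3) :=
  ⟨by rw [minSmoothness_of_isRCLikeNormedField]; exact ENat.LEInfty.out⟩

section LieGroups

variable (E : Type*) [NormedAddCommGroup E] [NormedSpace ℝ E]
  (G : Type*) [TopologicalSpace G] [ChartedSpace E G] [Group G]

/-- The Lie algebra `𝔤 = T₁G` of the real Lie group `G` (modelled on `E`). -/
abbrev LieAlg : Type _ := GroupLieAlgebra 𝓘(ℝ, E) G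

variable {G}

/-- The adjoint representation: `Ad g` is the differential at `1` of `x ↦ g x g⁻¹`. -/
def Ad (g : G) : LieAlg E G →ₗ[ℝ] LieAlg E G :=
  (mfderiv 𝓘(ℝ, E) 𝓘(ℝ, E) (fun x : G ↦ g * x * g⁻¹) 1 : E →L[ℝ] E).toLinearMap

/-- The differential at `1` of an automorphism of `G`. -/
def differential (φ : G ≃* G) : LieAlg E G →ₗ[ℝ] LieAlg E G :=
  (mfderiv 𝓘(ℝ, E) 𝓘(ℝ, E) (fun x : G ↦ φ x) 1 : E →L[ℝ] E).toLinearMap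

/-- `γ` is the one-parameter subgroup `t ↦ exp (t X)` of `G`, i.e. the smooth homomorphism
`ℝ → G` with velocity `X ∈ 𝔤` at time `0`. -/
structure IsOneParam (X : LieAlg E G) (γ : ℝ → G) : Prop where
  smooth : ContMDiff 𝓘(ℝ, ℝ) 𝓘(ℝ, E) ∞ γ
  map_add : ∀ s t, γ (s + t) = γ s * γ t
  velocity : (mfderiv 𝓘(ℝ, ℝ) 𝓘(ℝ, E) γ 0 : ℝ →L[ℝ] E) 1 = X

/-- The subgroup of `G` generated by `exp V`; for a Lie subalgebra `V` of `𝔤` this is the connected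
(analytic) subgroup of `G` with Lie algebra `V`. -/
def analyticSubgroup (V : Submodule ℝ (LieAlg E G)) : Subgroup G :=
  Subgroup.closure {g | ∃ X ∈ V, ∃ γ : ℝ → G, IsOneParam E X γ ∧ γ 1 = g}

/-- An element of `G` is semisimple if `Ad` of it is a semisimple endomorphism of `𝔤` (that is,
diagonalizable over `ℂ`). -/
def IsSemisimpleElt (ξ : G) : Prop := Module.End.IsSemisimple (Ad E ξ)

end LieGroups

section CartanInvolution

variable (E : Type*) [NormedAddCommGroup E] [NormedSpace ℝ E] [CompleteSpace E]
  {G : Type*} [TopologicalSpace G] [ChartedSpace E G] [Group G] [LieGroup 𝓘(ℝ, E) ∞ G]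

/-- `θ` is a Cartan involution of `G`: a smooth involutive automorphism such that
`(X, Y) ↦ -B(X, dθ Y)` is positive definite on `𝔤`, where `B` is the Killing form. -/
structure IsCartanInvolution (θ : G ≃* G) : Prop where
  smooth : ContMDiff 𝓘(ℝ, E) 𝓘(ℝ, E) ∞ (fun x : G ↦ θ x)
  involutive : ∀ x, θ (θ x) = x
  posDef : ∀ X : LieAlg E G, X ≠ 0 → 0 < -killingForm ℝ (LieAlg E G) X (differential E θ X)

/-- The differential of a Cartan involution respects the Lie bracket. -/
theorem differential_lie {θ : G ≃* G} (h : IsCartanInvolution E θ) (X Y : LieAlg E G) :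
    differential E θ ⁅X, Y⁆ = ⁅differential E θ X, differential E θ Y⁆ := by
  have hs (x : G) : MDifferentiableAt 𝓘(ℝ, E) 𝓘(ℝ, E) (fun x : G ↦ θ x) x :=
    h.smooth.mdifferentiable (by simp) x
  have hl (g x : G) : MDifferentiableAt 𝓘(ℝ, E) 𝓘(ℝ, E) (fun y : G ↦ g * y) x :=
    (contMDiff_mul_left (I := 𝓘(ℝ, E)) (n := ∞)).mdifferentiable (by simp) x
  let D : G → E →L[ℝ] E := fun x ↦ mfderiv 𝓘(ℝ, E) 𝓘(ℝ, E) (fun x : G ↦ θ x) x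
  have hD (x : G) : (D (θ x)).comp (D x) = ContinuousLinearMap.id ℝ E := by
    have hθ : (fun x : G ↦ θ x) ∘ (fun x : G ↦ θ x) = id := funext h.involutive
    have e1 := mfderiv_comp x (hs (θ x)) (hs x)
    rw [hθ, mfderiv_id] at e1
    exact e1.symm
  have hinv (x : G) : (mfderiv 𝓘(ℝ, E) 𝓘(ℝ, E) (fun x : G ↦ θ x) x).IsInvertible := by
    have e2 := hD (θ x)
    rw [h.involutive] at e2
    exact ContinuousLinearMap.IsInvertible.of_inverse (f := D x) (g := D (θ x)) e2 (hD x)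
  have key (Z : LieAlg E G) : VectorField.mpullback 𝓘(ℝ, E) 𝓘(ℝ, E) (fun x : G ↦ θ x)
      (mulInvariantVectorField (differential E θ Z)) = mulInvariantVectorField Z := by
    ext g
    rw [VectorField.mpullback_apply]
    have e : (fun x : G ↦ θ x) ∘ (fun x : G ↦ g * x) =
        (fun x : G ↦ θ g * x) ∘ (fun x : G ↦ θ x) := by ext x; simp
    have e3 := congrArg (fun f ↦ (mfderiv 𝓘(ℝ, E) 𝓘(ℝ, E) f (1 : G) : E →L[ℝ] E) Z) e
    have e4 : (mfderiv 𝓘(ℝ, E) 𝓘(ℝ, E) (fun x : G ↦ θ x) (g * 1) : E →L[ℝ] E)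
        ((mfderiv 𝓘(ℝ, E) 𝓘(ℝ, E) (fun x : G ↦ g * x) 1 : E →L[ℝ] E) Z) =
        (mfderiv 𝓘(ℝ, E) 𝓘(ℝ, E) (fun x : G ↦ θ g * x) (θ 1) : E →L[ℝ] E)
        ((mfderiv 𝓘(ℝ, E) 𝓘(ℝ, E) (fun x : G ↦ θ x) 1 : E →L[ℝ] E) Z) := by
      rw [mfderiv_comp (1 : G) (hs _) (hl g 1), mfderiv_comp (1 : G) (hl _ _) (hs 1)] at e3
      exact e3
    rw [mul_one, map_one] at e4
    have e5 : mulInvariantVectorField (differential E θ Z) (θ g) =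
        (mfderiv 𝓘(ℝ, E) 𝓘(ℝ, E) (fun x : G ↦ θ x) g) (mulInvariantVectorField Z g) := e4.symm
    exact (hinv g).inverse_apply_eq.2 e5
  have main := VectorField.mpullback_mlieBracket (I := 𝓘(ℝ, E)) (I' := 𝓘(ℝ, E)) (n := ∞)
    (f := fun x : G ↦ θ x) (x₀ := (1 : G))
    (mdifferentiableAt_mulInvariantVectorField (differential E θ X))
    (mdifferentiableAt_mulInvariantVectorField (differential E θ Y)) h.smooth.contMDiffAt
    (by rw [minSmoothness_of_isRCLikeNormedField]; exact ENat.LEInfty.out)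
  rw [key, key, VectorField.mpullback_apply] at main
  have e6 := (hinv 1).inverse_apply_eq.1 main
  have e7 : (fun g : G ↦ (VectorField.mlieBracket 𝓘(ℝ, E)
      (mulInvariantVectorField (differential E θ X))
      (mulInvariantVectorField (differential E θ Y)) g : E)) (θ 1) =
      differential E θ ⁅X, Y⁆ := e6
  rw [map_one] at e7
  exact e7.symm

/-- `𝔨`, the `+1`-eigenspace of `dθ`, i.e. the Lie algebra of `K = G^θ`. -/
def kSubalgebra {θ : G ≃* G} (h : IsCartanInvolution E θ) : LieSubalgebra ℝ (LieAlg E G) where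
  carrier := {X | differential E θ X = X}
  add_mem' {X Y} hX hY := by
    change differential E θ (X + Y) = X + Y
    rw [map_add, show differential E θ X = X from hX, show differential E θ Y = Y from hY]
  zero_mem' := map_zero _
  smul_mem' c X hX := by
    change differential E θ (c • X) = c • X
    rw [map_smul, show differential E θ X = X from hX]
  lie_mem' {X Y} hX hY := by
    change differential E θ ⁅X, Y⁆ = ⁅X, Y⁆
    rw [differential_lie E h, show differential E θ X = X from hX,
      show differential E θ Y = Y from hY]

/-- `𝔭`, the `-1`-eigenspace of `dθ`. -/
def pSubspace (θ : G ≃* G) : Submodule ℝ (LieAlg E G) :=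
  Module.End.eigenspace (differential E θ) (-1)

/-- The restricted root space
`𝔤_lam = {X | [H, X] = lam(H) X for all H ∈ 𝔞}` of a linear form `lam` on `𝔞`. -/
def rootSpace (𝔞 : Submodule ℝ (LieAlg E G)) (lam : Module.Dual ℝ 𝔞) :
    Submodule ℝ (LieAlg E G) :=
  ⨅ H : 𝔞, Module.End.eigenspace (LieAlgebra.ad ℝ (LieAlg E G) (H : LieAlg E G)) (lam H)

variable (G) in
/-- The choices that enter an Iwasawa decomposition of `G`: a Cartan involution `θ`, a maximal
abelian subspace `𝔞` of `𝔭`, and a regular element `H₀ ∈ 𝔞`, which singles out the system of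
positive restricted roots (those that are positive at `H₀`). -/
structure IwasawaData where
  θ : G ≃* G
  isCartan : IsCartanInvolution E θ
  𝔞 : Submodule ℝ (LieAlg E G)
  maximal : Maximal (fun 𝔟 : Submodule ℝ (LieAlg E G) ↦
    𝔟 ≤ pSubspace E θ ∧ ∀ X ∈ 𝔟, ∀ Y ∈ 𝔟, ⁅X, Y⁆ = 0) 𝔞
  H₀ : 𝔞
  regular : ∀ lam : Module.Dual ℝ 𝔞, lam ≠ 0 → rootSpace E 𝔞 lam ≠ ⊥ → lam H₀ ≠ 0

namespace IwasawaData

variable {E} (D : IwasawaData E G)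

/-- The real rank `dim 𝔞` of `G`. -/
def realRank : ℕ := Module.finrank ℝ D.𝔞

/-- The Lie algebra `𝔨` of `K`. -/
def 𝔨 : LieSubalgebra ℝ (LieAlg E G) := kSubalgebra E D.isCartan

/-- The sum `𝔫` of the positive restricted root spaces. -/
def 𝔫 : Submodule ℝ (LieAlg E G) :=
  ⨆ lam : Module.Dual ℝ D.𝔞, ⨆ _ : 0 < lam D.H₀, rootSpace E D.𝔞 lam

/-- The maximal compact subgroup `K = G^θ`. -/
def K : Subgroup G where
  carrier := {x | D.θ x = x}
  mul_mem' {x y} hx hy := by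
    change D.θ (x * y) = x * y
    rw [map_mul, show D.θ x = x from hx, show D.θ y = y from hy]
  one_mem' := map_one _
  inv_mem' {x} hx := by
    change D.θ x⁻¹ = x⁻¹
    rw [map_inv, show D.θ x = x from hx]

/-- `A = exp 𝔞`. -/
def A : Subgroup G := analyticSubgroup E D.𝔞

/-- `N = exp 𝔫`. -/
def N : Subgroup G := analyticSubgroup E D.𝔫

/-- `M`, the centralizer of `A` in `K`. -/
def M : Subgroup G := D.K ⊓ Subgroup.centralizer (D.A : Set G)

/-- `P` is a (proper, hence minimal, since this is used in real rank one) parabolic subgroup of `G`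
with unipotent radical `U`: the pair is a conjugate of `(M A N, N)`. -/
def IsParabolic (P U : Subgroup G) : Prop :=
  ∃ g : G, (∀ x, x ∈ P ↔ ∃ m ∈ D.M, ∃ a ∈ D.A, ∃ n ∈ D.N, x = g * (m * a * n) * g⁻¹) ∧
    (∀ x, x ∈ U ↔ ∃ n ∈ D.N, x = g * n * g⁻¹)

/-- `P` is a `Γ`-cuspidal parabolic subgroup, with unipotent radical `U`: `Γ ∩ U` is a (uniform)
lattice in `U`. -/
def IsCuspidal (Γ P U : Subgroup G) : Prop :=
  D.IsParabolic P U ∧ CompactSpace (U ⧸ Γ.subgroupOf U)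

/-- `ξ` is elliptic: not central, but conjugate to an element of `K`. -/
def IsElliptic (ξ : G) : Prop :=
  ξ ∉ Subgroup.center G ∧ ∃ g : G, g * ξ * g⁻¹ ∈ D.K

/-- `ξ` is hyperbolic: semisimple, but neither central nor elliptic. -/
def IsHyperbolic (ξ : G) : Prop :=
  IsSemisimpleElt E ξ ∧ ξ ∉ Subgroup.center G ∧ ¬ D.IsElliptic ξ

/-- The double coset `Ξ = Γ α Γ`. -/
def Xi (_D : IwasawaData E G) (Γ : Subgroup G) (α : G) : Set G :=
  DoubleCoset.doubleCoset α (Γ : Set G) (Γ : Set G)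

/-- `Ξ_S`: the elements of `Ξ` whose `Γ`-conjugacy class meets no `Γ`-cuspidal parabolic
subgroup. -/
def XiS (Γ : Subgroup G) (α : G) : Set G :=
  {ξ ∈ D.Xi Γ α | ∀ P U, D.IsCuspidal Γ P U → ∀ γ ∈ Γ, γ * ξ * γ⁻¹ ∉ P}

/-- `Ξ_P = Ξ - Ξ_S`. -/
def XiP (Γ : Subgroup G) (α : G) : Set G := D.Xi Γ α \ D.XiS Γ α

/-- `Ξ_P(r)`: the elements `ξ` of `Ξ_P` that lie in a `Γ`-cuspidal parabolic subgroup `P` in whose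
unipotent radical `ξ` has trivial centralizer. -/
def XiPr (Γ : Subgroup G) (α : G) : Set G :=
  {ξ ∈ D.XiP Γ α | ∃ P U, D.IsCuspidal Γ P U ∧ ξ ∈ P ∧ U ⊓ Subgroup.centralizer {ξ} = ⊥}

/-- `Ξ_H`: the hyperbolic elements of `Ξ`. -/
def XiH (Γ : Subgroup G) (α : G) : Set G := {ξ ∈ D.Xi Γ α | D.IsHyperbolic ξ}

/-- `Ξ_H^s = Ξ_H - Ξ_P(r)`. -/
def XiHs (Γ : Subgroup G) (α : G) : Set G := D.XiH Γ α \ D.XiPr Γ α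

/-- `Rank G = Rank K`. -/
def EqualRank [FiniteDimensional ℝ E] : Prop :=
  haveI : FiniteDimensional ℝ (LieAlg E G) := inferInstanceAs (FiniteDimensional ℝ E)
  LieAlgebra.rank ℝ (LieAlg E G) = LieAlgebra.rank ℝ D.𝔨

end IwasawaData

end CartanInvolution

/-- `Γ` is a lattice in `G`: a discrete subgroup such that `Γ \ G` has finite volume, i.e. such that
some set of finite Haar measure meets every coset `Γ g`. -/
def IsLattice {G : Type*} [TopologicalSpace G] [Group G] [MeasurableSpace G]
    (Γ : Subgroup G) : Prop :=
  DiscreteTopology Γ ∧ ∃ μ : MeasureTheory.Measure G, μ.IsHaarMeasure ∧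
    ∃ F : Set G, MeasurableSet F ∧ μ F < ⊤ ∧ ∀ g, ∃ γ ∈ Γ, γ * g ∈ F

end RankOne

end

noncomputable section

namespace RankOne

open Set Filter Topology

set_option linter.unusedSectionVars false

/-! Write `ξ = g (m a n) g⁻¹` and let `H` be the regular element of the line `𝔞`, so that `𝔫` is the
sum of the positive eigenspaces of `ad H`. For some real `s`, `Ad a` multiplies each `c`-eigenspace
of `ad H` by `exp (s c)`. `Ad m` commutes with `ad H` and is an isometry for `⟨X, Y⟩ = -B(X, θ Y)`,
and `Ad n - 1` strictly raises eigenvalues. So `Ad (m a n)` is block triangular with diagonal part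
`S = Ad m * Ad a`, and everything depends on whether `s` vanishes.

If `s ≠ 0`, distinct diagonal blocks scale norms at distinct rates, so nothing intertwines them. The
nilpotent Jordan part of `Ad (m a n)` is strictly triangular and commutes with `Ad (m a n)`, hence
is zero, and `ξ` is semisimple (`IsTriangular.isSemisimple`). On the top eigenspace the `n`-th power
scales norms by `exp (s d) ^ n` with `d > 0`, which no conjugate of an isometry does; so `ξ` is
neither central nor elliptic (`IsTriangular.not_conj_isometry`).

If `s = 0`, equal rank forces a nontrivial centralizer in `N_P`, contrary to hypothesis. It is
enough that `T = Ad m` fixes a nonzero vector in a positive eigenspace of `ad H`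
(`exists_fixed_vector`): triangularity corrects it to a fixed vector of `Ad (m a n)` in `𝔫`
(`IsTriangular.exists_fixed`), whose one-parameter group commutes with `m a n`.

For that vector, connectedness of `G` and polar decomposition join `T` to `1` by an analytic path of
automorphisms commuting with `θ` (`isGood_of_connected`). Near `1` these are `exp (ad Y)` with `Y ∈
𝔨`, which fix a subspace of `𝔨` of dimension at least `rank 𝔨 = rank 𝔤`; the vanishing of low
characteristic coefficients propagates along the path. So `T`, and likewise `T exp (ad Y)` for `Y ∈
𝔨`, fixes that many dimensions of `𝔨`. Perturbing by a small generic element of a maximal abelian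
`𝔰` in the fixed space `𝔨^T` puts the fixed space inside `𝔰`, whence `dim 𝔰 ≥ rank 𝔤`. Without a
fixed vector in a positive eigenspace, all of `𝔰` would commute with `H`, and `𝔰 ⊕ ℝ H` would be
toral of dimension above the rank (`finrank_le_rank_of_toral`).

The Lie group input is `Ad (exp X) = exp (ad X)` together with existence and uniqueness of
one-parameter subgroups, obtained from the group law in a chart at `1`. -/

/-- The chain rule, with the differentials regarded as maps of the model spaces. -/
theorem mfderiv_comp_model {E₁ E₂ E₃ M₁ M₂ M₃ : Type*}
    [NormedAddCommGroup E₁] [NormedSpace ℝ E₁] [NormedAddCommGroup E₂] [NormedSpace ℝ E₂]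
    [NormedAddCommGroup E₃] [NormedSpace ℝ E₃]
    [TopologicalSpace M₁] [ChartedSpace E₁ M₁] [TopologicalSpace M₂] [ChartedSpace E₂ M₂]
    [TopologicalSpace M₃] [ChartedSpace E₃ M₃] {g : M₂ → M₃} {f : M₁ → M₂} {x : M₁} {y : M₂}
    (hg : MDifferentiableAt 𝓘(ℝ, E₂) 𝓘(ℝ, E₃) g y) (hf : MDifferentiableAt 𝓘(ℝ, E₁) 𝓘(ℝ, E₂) f x)
    (hy : f x = y) :
    -- Each `id` retypes a differential from tangent spaces, which depend on the base point, to the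
    -- fixed model spaces.
    (id (mfderiv 𝓘(ℝ, E₁) 𝓘(ℝ, E₃) (g ∘ f) x) : E₁ →L[ℝ] E₃) =
      (id (mfderiv 𝓘(ℝ, E₂) 𝓘(ℝ, E₃) g y) : E₂ →L[ℝ] E₃).comp
        (id (mfderiv 𝓘(ℝ, E₁) 𝓘(ℝ, E₂) f x) : E₁ →L[ℝ] E₂) := by
  subst hy
  exact mfderiv_comp x hg hf

/-! ### The group law in a chart at the identity, and the differential of `Ad` -/

section Chart
variable {E : Type*} [NormedAddCommGroup E] [NormedSpace ℝ E]
  {G : Type*} [TopologicalSpace G] [ChartedSpace E G] [Group G]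

variable (E G) in
/-- The group law read in the preferred chart at `1`. -/
def chartMul (p : E × E) : E :=
  extChartAt 𝓘(ℝ, E) (1 : G)
    ((extChartAt 𝓘(ℝ, E) (1 : G)).symm p.1 * (extChartAt 𝓘(ℝ, E) (1 : G)).symm p.2)

variable (E G) in
/-- The coordinate of `1` in the preferred chart at `1`. -/
def chartOne : E := extChartAt 𝓘(ℝ, E) (1 : G) 1

theorem extChartAt_symm_chartOne :
    (extChartAt 𝓘(ℝ, E) (1 : G)).symm (chartOne E G) = 1 := extChartAt_to_inv _

theorem chartOne_mem_target : chartOne E G ∈ (extChartAt 𝓘(ℝ, E) (1 : G)).target :=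
  mem_extChartAt_target _

theorem chart_target_mem_nhds :
    (extChartAt 𝓘(ℝ, E) (1 : G)).target ∈ 𝓝 (chartOne E G) :=
  extChartAt_target_mem_nhds _

/-- The differential at `1` of left translation. -/
def dLeft (g : G) : E →L[ℝ] E := mfderiv 𝓘(ℝ, E) 𝓘(ℝ, E) (fun x : G ↦ g * x) 1

/-- The differential at `1` of right translation. -/
def dRight (g : G) : E →L[ℝ] E := mfderiv 𝓘(ℝ, E) 𝓘(ℝ, E) (fun x : G ↦ x * g) 1

/-- The differential at `1` of a self-map of `G`. -/
def diffOne (f : G → G) : E →L[ℝ] E := mfderiv 𝓘(ℝ, E) 𝓘(ℝ, E) f 1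

/-- The differential of the preferred chart at `1`. -/
def dChart (g : G) : E →L[ℝ] E := mfderiv 𝓘(ℝ, E) 𝓘(ℝ, E) (extChartAt 𝓘(ℝ, E) (1 : G)) g

variable (E) in
/-- `Ad` as a continuous linear map. -/
def adCLM (g : G) : E →L[ℝ] E := mfderiv 𝓘(ℝ, E) 𝓘(ℝ, E) (fun x : G ↦ g * x * g⁻¹) 1

variable (E G) in
/-- The partial differential `∂₂ m (x, 1)` of the group law in the chart. -/
def chartLeft (x : E) : E →L[ℝ] E :=
  (fderiv ℝ (chartMul E G) (x, chartOne E G)).comp (ContinuousLinearMap.inr ℝ E E)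

variable (E G) in
/-- The partial differential `∂₁ m (1, x)` of the group law in the chart. -/
def chartRight (x : E) : E →L[ℝ] E :=
  (fderiv ℝ (chartMul E G) (chartOne E G, x)).comp (ContinuousLinearMap.inl ℝ E E)

theorem dLeft_one : dLeft (1 : G) = ContinuousLinearMap.id ℝ E := by
  have : (fun x : G ↦ 1 * x) = id := by ext; simp
  rw [dLeft, this, mfderiv_id]; rfl

theorem dRight_one : dRight (1 : G) = ContinuousLinearMap.id ℝ E := by
  have : (fun x : G ↦ x * 1) = id := by ext; simp
  rw [dRight, this, mfderiv_id]; rfl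

variable [LieGroup 𝓘(ℝ, E) ∞ G]

theorem contDiffAt_chartMul {p : E × E}
    (h1 : p.1 ∈ (extChartAt 𝓘(ℝ, E) (1 : G)).target)
    (h2 : p.2 ∈ (extChartAt 𝓘(ℝ, E) (1 : G)).target)
    (h3 : (extChartAt 𝓘(ℝ, E) (1 : G)).symm p.1 * (extChartAt 𝓘(ℝ, E) (1 : G)).symm p.2 ∈
      (chartAt E (1 : G)).source) : ContDiffAt ℝ ∞ (chartMul E G) p := by
  rw [← contMDiffAt_iff_contDiffAt]
  have hsymm {x : E} (h : x ∈ (extChartAt 𝓘(ℝ, E) (1 : G)).target) :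
      ContMDiffAt 𝓘(ℝ, E) 𝓘(ℝ, E) ∞ (extChartAt 𝓘(ℝ, E) (1 : G)).symm x :=
    (contMDiffOn_extChartAt_symm (1 : G)).contMDiffAt
      ((isOpen_extChartAt_target (I := 𝓘(ℝ, E)) (1 : G)).mem_nhds h)
  have s1 : ContMDiffAt 𝓘(ℝ, E × E) 𝓘(ℝ, E) ∞
      (fun q : E × E ↦ (extChartAt 𝓘(ℝ, E) (1 : G)).symm q.1) p :=
    (hsymm h1).comp p (contDiff_fst.contMDiff p)
  have s2 : ContMDiffAt 𝓘(ℝ, E × E) 𝓘(ℝ, E) ∞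
      (fun q : E × E ↦ (extChartAt 𝓘(ℝ, E) (1 : G)).symm q.2) p :=
    (hsymm h2).comp p (contDiff_snd.contMDiff p)
  exact (contMDiffAt_extChartAt' h3).comp p (s1.mul s2)

theorem contDiffAt_chartMul_left {x : E} (hx : x ∈ (extChartAt 𝓘(ℝ, E) (1 : G)).target) :
    ContDiffAt ℝ ∞ (chartMul E G) (x, chartOne E G) := by
  apply contDiffAt_chartMul hx chartOne_mem_target
  simp only [extChartAt_symm_chartOne, mul_one]
  have := (extChartAt 𝓘(ℝ, E) (1 : G)).map_target hx
  rwa [extChartAt_source] at this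

theorem contDiffAt_chartMul_right {x : E} (hx : x ∈ (extChartAt 𝓘(ℝ, E) (1 : G)).target) :
    ContDiffAt ℝ ∞ (chartMul E G) (chartOne E G, x) := by
  apply contDiffAt_chartMul chartOne_mem_target hx
  simp only [extChartAt_symm_chartOne, one_mul]
  have := (extChartAt 𝓘(ℝ, E) (1 : G)).map_target hx
  rwa [extChartAt_source] at this

theorem dChart_one : dChart (1 : G) = ContinuousLinearMap.id ℝ E := mfderiv_extChartAt_self

theorem mdifferentiableAt_chart {g : G} (hg : g ∈ (extChartAt 𝓘(ℝ, E) (1 : G)).source) :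
    MDifferentiableAt 𝓘(ℝ, E) 𝓘(ℝ, E) (extChartAt 𝓘(ℝ, E) (1 : G)) g :=
  mdifferentiableAt_extChartAt (by rwa [extChartAt_source] at hg)

theorem mdifferentiableAt_chart_symm {x : E} (h : x ∈ (extChartAt 𝓘(ℝ, E) (1 : G)).target) :
      MDifferentiableAt 𝓘(ℝ, E) 𝓘(ℝ, E) (extChartAt 𝓘(ℝ, E) (1 : G)).symm x :=
    ((contMDiffOn_extChartAt_symm (n := ∞) (1 : G)).contMDiffAt
      ((isOpen_extChartAt_target (I := 𝓘(ℝ, E)) (1 : G)).mem_nhds h)).mdifferentiableAt (by simp)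

theorem mdiff_left (g x : G) :
    MDifferentiableAt 𝓘(ℝ, E) 𝓘(ℝ, E) (fun y : G ↦ g * y) x :=
  (contMDiff_mul_left (I := 𝓘(ℝ, E)) (n := ∞)).mdifferentiable (by simp) x

theorem mdiff_right (g x : G) :
    MDifferentiableAt 𝓘(ℝ, E) 𝓘(ℝ, E) (fun y : G ↦ y * g) x :=
  (contMDiff_mul_right (I := 𝓘(ℝ, E)) (n := ∞)).mdifferentiable (by simp) x

/-- The differential at the identity coordinate of a map read in the chart. -/
theorem fderiv_chart_conj {f : G → G} (hf : MDifferentiableAt 𝓘(ℝ, E) 𝓘(ℝ, E) f 1)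
    (h1 : f 1 ∈ (extChartAt 𝓘(ℝ, E) (1 : G)).source) :
    fderiv ℝ (fun y : E ↦ extChartAt 𝓘(ℝ, E) (1 : G)
      (f ((extChartAt 𝓘(ℝ, E) (1 : G)).symm y))) (chartOne E G) =
    (dChart (f 1)).comp (diffOne f) := by
  have a1 := mdifferentiableAt_chart_symm (E := E) (G := G) chartOne_mem_target
  have e1 : mfderiv 𝓘(ℝ, E) 𝓘(ℝ, E) (extChartAt 𝓘(ℝ, E) (1 : G)).symm (chartOne E G) =
      ContinuousLinearMap.id ℝ E := by
    have := mfderivWithin_range_extChartAt_symm (I := 𝓘(ℝ, E)) (x := (1 : G))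
    simp only [modelWithCornersSelf_coe, range_id, mfderivWithin_univ] at this
    exact this
  rw [← mfderiv_eq_fderiv]
  have c1 := mfderiv_comp_model (x := chartOne E G) (y := (1 : G)) hf a1 extChartAt_symm_chartOne
  have hf1 : (f ∘ (extChartAt 𝓘(ℝ, E) (1 : G)).symm) (chartOne E G) = f 1 := by
    rw [Function.comp_apply, extChartAt_symm_chartOne]
  have c2 := mfderiv_comp_model (x := chartOne E G) (y := f 1) (mdifferentiableAt_chart h1)
    (MDifferentiableAt.comp_of_eq _ hf a1 extChartAt_symm_chartOne) hf1
  rw [c1, e1] at c2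
  exact c2

/-- With its first variable frozen the group law is a left translation. Its source point is `1`,
where the chart has differential `id`, so only the chart at the target point contributes a factor.
-/
theorem chartLeft_eq {x : E} (hx : x ∈ (extChartAt 𝓘(ℝ, E) (1 : G)).target) :
    chartLeft E G x = (dChart ((extChartAt 𝓘(ℝ, E) (1 : G)).symm x)).comp
      (dLeft ((extChartAt 𝓘(ℝ, E) (1 : G)).symm x)) := by
  have h := fderiv_chart_conj (mdiff_left ((extChartAt 𝓘(ℝ, E) (1 : G)).symm x) 1)
    (by rw [mul_one]; exact (extChartAt 𝓘(ℝ, E) (1 : G)).map_target hx)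
  rw [mul_one] at h
  refine Eq.trans ?_ h
  have hd : DifferentiableAt ℝ (chartMul E G) (x, chartOne E G) :=
    (contDiffAt_chartMul_left hx).differentiableAt (by simp)
  have := (hd.hasFDerivAt.comp (chartOne E G) (hasFDerivAt_prodMk_right x (chartOne E G)))
  exact this.fderiv.symm

theorem chartRight_eq {x : E} (hx : x ∈ (extChartAt 𝓘(ℝ, E) (1 : G)).target) :
    chartRight E G x = (dChart ((extChartAt 𝓘(ℝ, E) (1 : G)).symm x)).comp
      (dRight ((extChartAt 𝓘(ℝ, E) (1 : G)).symm x)) := by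
  have h := fderiv_chart_conj (mdiff_right ((extChartAt 𝓘(ℝ, E) (1 : G)).symm x) 1)
    (by rw [one_mul]; exact (extChartAt 𝓘(ℝ, E) (1 : G)).map_target hx)
  rw [one_mul] at h
  refine Eq.trans ?_ h
  have hd : DifferentiableAt ℝ (chartMul E G) (chartOne E G, x) :=
    (contDiffAt_chartMul_right hx).differentiableAt (by simp)
  have := (hd.hasFDerivAt.comp (f := fun y : E ↦ (y, x)) (chartOne E G)
    (hasFDerivAt_prodMk_left (chartOne E G) x))
  exact this.fderiv.symm

theorem chartLeft_one : chartLeft E G (chartOne E G) = ContinuousLinearMap.id ℝ E := by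
  rw [chartLeft_eq chartOne_mem_target, extChartAt_symm_chartOne, dChart_one, dLeft_one]; rfl

theorem chartRight_one : chartRight E G (chartOne E G) = ContinuousLinearMap.id ℝ E := by
  rw [chartRight_eq chartOne_mem_target, extChartAt_symm_chartOne, dChart_one, dRight_one]; rfl

/-- `g y = (g y g⁻¹) g`, differentiated at `y = 1`. -/
theorem dRight_comp_adCLM (g : G) : (dRight g).comp (adCLM E g) = dLeft g := by
  have h : (fun x : G ↦ g * x) = (fun x ↦ x * g) ∘ (fun x : G ↦ g * x * g⁻¹) := by
    ext x; simp
  have hc : MDifferentiableAt 𝓘(ℝ, E) 𝓘(ℝ, E) (fun x : G ↦ g * x * g⁻¹) 1 :=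
    (mdiff_right g⁻¹ (g * 1)).comp (1 : G) (mdiff_left g 1)
  have := mfderiv_comp_model (x := (1 : G)) (y := (1 : G)) (mdiff_right g _) hc (by simp)
  rw [← h] at this
  exact this.symm

/-- Near `1` the factor `chartRight` is invertible, so this expresses `Ad` as `R⁻¹ L` with `R` and
`L` smooth. -/
theorem chartRight_comp_adCLM {x : E} (hx : x ∈ (extChartAt 𝓘(ℝ, E) (1 : G)).target) :
    (chartRight E G x).comp (adCLM E ((extChartAt 𝓘(ℝ, E) (1 : G)).symm x)) =
      chartLeft E G x := by
  rw [chartRight_eq hx, chartLeft_eq hx, ContinuousLinearMap.comp_assoc, dRight_comp_adCLM]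

theorem contDiffAt_chartLeft {x : E} (hx : x ∈ (extChartAt 𝓘(ℝ, E) (1 : G)).target) :
    ContDiffAt ℝ ∞ (chartLeft E G) x := by
  have h1 : ContDiffAt ℝ ∞ (fun y : E ↦ fderiv ℝ (chartMul E G) (y, chartOne E G)) x :=
    ((contDiffAt_chartMul_left hx).fderiv_right (m := ∞) (by simp)).comp x
      (contDiffAt_id.prodMk contDiffAt_const)
  exact h1.clm_comp contDiffAt_const

theorem contDiffAt_chartRight {x : E} (hx : x ∈ (extChartAt 𝓘(ℝ, E) (1 : G)).target) :
    ContDiffAt ℝ ∞ (chartRight E G) x := by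
  have h1 : ContDiffAt ℝ ∞ (fun y : E ↦ fderiv ℝ (chartMul E G) (chartOne E G, y)) x :=
    ((contDiffAt_chartMul_right hx).fderiv_right (m := ∞) (by simp)).comp x
      (contDiffAt_const.prodMk contDiffAt_id)
  exact h1.clm_comp contDiffAt_const

/-- The symmetry of the second differential of the group law. -/
theorem fderiv_chartRight_apply (X Y : E) :
    fderiv ℝ (chartRight E G) (chartOne E G) X Y = fderiv ℝ (chartLeft E G) (chartOne E G) Y X := by
  have hm := contDiffAt_chartMul_left (G := G) (E := E) chartOne_mem_target
  have hsymm := hm.isSymmSndFDerivAt (by rw [minSmoothness_of_isRCLikeNormedField]; exact ENat.LEInfty.out)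
  have hD : HasFDerivAt (fderiv ℝ (chartMul E G))
      (fderiv ℝ (fderiv ℝ (chartMul E G)) (chartOne E G, chartOne E G))
      (chartOne E G, chartOne E G) :=
    ((hm.fderiv_right (m := ∞) (by simp)).differentiableAt (by simp)).hasFDerivAt
  have h1 : HasFDerivAt (fun y : E ↦ fderiv ℝ (chartMul E G) (y, chartOne E G)) _ (chartOne E G) :=
    hD.comp (f := fun y : E ↦ (y, chartOne E G)) (chartOne E G)
      (hasFDerivAt_prodMk_left (chartOne E G) (chartOne E G))
  have h2 : HasFDerivAt (fun y : E ↦ fderiv ℝ (chartMul E G) (chartOne E G, y)) _ (chartOne E G) :=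
    hD.comp (chartOne E G) (hasFDerivAt_prodMk_right (chartOne E G) (chartOne E G))
  have h1' := h1.clm_comp (hasFDerivAt_const (ContinuousLinearMap.inr ℝ E E) (chartOne E G))
  have h2' := h2.clm_comp (hasFDerivAt_const (ContinuousLinearMap.inl ℝ E E) (chartOne E G))
  have e1 : fderiv ℝ (chartLeft E G) (chartOne E G) = _ := h1'.fderiv
  have e2 : fderiv ℝ (chartRight E G) (chartOne E G) = _ := h2'.fderiv
  rw [e1, e2]
  -- Both sides are mixed second derivatives of `chartMul` at the identity, with the directions `(0,
  -- X)` and `(Y, 0)` in opposite orders.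
  simpa using hsymm.eq (0, X) (Y, 0)

variable [CompleteSpace E]

/-- `Ad`, read in the chart, is differentiable at `1`. -/
theorem hasFDerivAt_adCLM_chart :
    HasFDerivAt (fun x : E ↦ adCLM E ((extChartAt 𝓘(ℝ, E) (1 : G)).symm x))
      (fderiv ℝ (chartLeft E G) (chartOne E G) - fderiv ℝ (chartRight E G) (chartOne E G))
      (chartOne E G) := by
  have hL := ((contDiffAt_chartLeft (G := G) (E := E) chartOne_mem_target).differentiableAt
    (by simp)).hasFDerivAt
  have hR := ((contDiffAt_chartRight (G := G) (E := E) chartOne_mem_target).differentiableAt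
    (by simp)).hasFDerivAt
  -- Since `R = L = id` at the identity, the differential of `R⁻¹ L` there is `dL - dR`.
  have hinv : HasFDerivAt (fun x : E ↦ Ring.inverse (chartRight E G x))
      (-fderiv ℝ (chartRight E G) (chartOne E G)) (chartOne E G) := by
    have h0 := hasFDerivAt_ringInverse (𝕜 := ℝ) (1 : (E →L[ℝ] E)ˣ)
    have h0' : HasFDerivAt Ring.inverse
      (-((ContinuousLinearMap.mulLeftRight ℝ (E →L[ℝ] E)) 1 1)) (chartRight E G (chartOne E G)) := by
      rw [chartRight_one]; simp at h0; exact h0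
    refine (h0'.comp (chartOne E G) hR).congr_fderiv ?_
    ext X Y; simp
  have h := hinv.clm_comp hL
  have hunit : ∀ᶠ x in 𝓝 (chartOne E G), IsUnit (chartRight E G x) :=
    hR.continuousAt.eventually (by
      rw [chartRight_one]
      exact Units.isOpen.mem_nhds (isUnit_one (M := E →L[ℝ] E)))
  refine (h.congr_fderiv ?_).congr_of_eventuallyEq ?_
  · ext X Y
    have e1 : Ring.inverse (ContinuousLinearMap.id ℝ E) = ContinuousLinearMap.id ℝ E :=
      Ring.inverse_one (E →L[ℝ] E)
    simp [chartLeft_one, chartRight_one, e1]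
    abel
  · filter_upwards [hunit, chart_target_mem_nhds (G := G) (E := E)] with x hx hx'
    rw [← chartRight_comp_adCLM hx']
    exact (Ring.inverse_mul_cancel_left _ _ hx).symm

end Chart

/-! ### The Lie bracket in the chart, and `ad` as the derivative of `Ad` -/

section Bracket
variable {E : Type*} [NormedAddCommGroup E] [NormedSpace ℝ E]
  {G : Type*} [TopologicalSpace G] [ChartedSpace E G] [Group G] [LieGroup 𝓘(ℝ, E) ∞ G]

/-- Left-invariant vector fields in the chart. -/
theorem mpullback_mulInvariantVectorField_chart (X : E) {x : E}
    (hx : x ∈ (extChartAt 𝓘(ℝ, E) (1 : G)).target) :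
    VectorField.mpullbackWithin 𝓘(ℝ, E) 𝓘(ℝ, E) (extChartAt 𝓘(ℝ, E) (1 : G)).symm
      (mulInvariantVectorField (I := 𝓘(ℝ, E)) (G := G) X) univ x = chartLeft E G x X := by
  rw [VectorField.mpullbackWithin_apply, mfderivWithin_univ]
  set g := (extChartAt 𝓘(ℝ, E) (1 : G)).symm x with hg
  have hgs : g ∈ (extChartAt 𝓘(ℝ, E) (1 : G)).source :=
    (extChartAt 𝓘(ℝ, E) (1 : G)).map_target hx
  have hxg : extChartAt 𝓘(ℝ, E) (1 : G) g = x := (extChartAt 𝓘(ℝ, E) (1 : G)).right_inv hx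
  let S : E →L[ℝ] E := mfderiv 𝓘(ℝ, E) 𝓘(ℝ, E) (extChartAt 𝓘(ℝ, E) (1 : G)).symm x
  have h1 : (dChart g).comp S = ContinuousLinearMap.id ℝ E := by
    have := mfderiv_comp_model (x := x) (mdifferentiableAt_chart hgs)
      (mdifferentiableAt_chart_symm hx) rfl
    refine Eq.trans this.symm ?_
    have he : (extChartAt 𝓘(ℝ, E) (1 : G)) ∘ (extChartAt 𝓘(ℝ, E) (1 : G)).symm =ᶠ[𝓝 x] id := by
      filter_upwards [(isOpen_extChartAt_target (I := 𝓘(ℝ, E)) (1 : G)).mem_nhds hx] with y hy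
      exact (extChartAt 𝓘(ℝ, E) (1 : G)).right_inv hy
    rw [he.mfderiv_eq, mfderiv_id]; rfl
  have h2 : S.comp (dChart g) = ContinuousLinearMap.id ℝ E := by
    have := mfderiv_comp_model (x := g) (mdifferentiableAt_chart_symm hx)
      (mdifferentiableAt_chart hgs) hxg
    refine Eq.trans this.symm ?_
    have he : (extChartAt 𝓘(ℝ, E) (1 : G)).symm ∘ (extChartAt 𝓘(ℝ, E) (1 : G)) =ᶠ[𝓝 g] id := by
      filter_upwards [(isOpen_extChartAt_source (I := 𝓘(ℝ, E)) (1 : G)).mem_nhds hgs] with y hy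
      exact (extChartAt 𝓘(ℝ, E) (1 : G)).left_inv hy
    rw [he.mfderiv_eq, mfderiv_id]; rfl
  have h3 : S.inverse = dChart g := ContinuousLinearMap.inverse_eq h2 h1
  rw [chartLeft_eq hx]
  exact congrArg (fun f : E →L[ℝ] E ↦ f (dLeft g X)) h3

variable [CompleteSpace E]

variable (G) in
/-- The Lie bracket of `𝔤`, on the model space. -/
def modelBracket (X Y : E) : E := @Bracket.bracket (LieAlg E G) (LieAlg E G) _ X Y

omit [CompleteSpace E] in
-- In the chart the left-invariant field of `Z` is `x ↦ chartLeft x Z`, with value `Z` at the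
-- identity, and the bracket of fields `V`, `W` is `DW(V) - DV(W)`.
theorem modelBracket_eq (X Y : E) :
    modelBracket G X Y = fderiv ℝ (chartLeft E G) (chartOne E G) X Y -
      fderiv ℝ (chartLeft E G) (chartOne E G) Y X := by
  have hV (Z : E) : VectorField.mpullbackWithin 𝓘(ℝ, E) 𝓘(ℝ, E)
      (extChartAt 𝓘(ℝ, E) (1 : G)).symm
      (mulInvariantVectorField (I := 𝓘(ℝ, E)) (G := G) Z) univ =ᶠ[𝓝 (chartOne E G)]
      fun x ↦ chartLeft E G x Z := by
    filter_upwards [chart_target_mem_nhds (G := G) (E := E)] with x hx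
    exact mpullback_mulInvariantVectorField_chart Z hx
  have hd : DifferentiableAt ℝ (chartLeft E G) (chartOne E G) :=
    (contDiffAt_chartLeft chartOne_mem_target).differentiableAt (by simp)
  have hf (Z W : E) : fderiv ℝ (fun x ↦ chartLeft E G x Z) (chartOne E G) W =
      fderiv ℝ (chartLeft E G) (chartOne E G) W Z := by
    rw [fderiv_clm_apply hd (differentiableAt_const Z)]; simp
  have key := (hV X).lieBracket_vectorField_eq (𝕜 := ℝ) (hV Y)
  rw [VectorField.lieBracket_eq] at key
  simp only [hf, chartLeft_one, ContinuousLinearMap.coe_id', id_eq] at key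
  refine Eq.trans ?_ key
  have hs : modelBracket G X Y = ContinuousLinearMap.inverse (M := E) (M₂ := E) (dChart (1 : G))
      (VectorField.lieBracketWithin ℝ
        (VectorField.mpullbackWithin 𝓘(ℝ, E) 𝓘(ℝ, E) (extChartAt 𝓘(ℝ, E) (1 : G)).symm
          (mulInvariantVectorField (I := 𝓘(ℝ, E)) (G := G) X) (range 𝓘(ℝ, E)))
        (VectorField.mpullbackWithin 𝓘(ℝ, E) 𝓘(ℝ, E) (extChartAt 𝓘(ℝ, E) (1 : G)).symm
          (mulInvariantVectorField (I := 𝓘(ℝ, E)) (G := G) Y) (range 𝓘(ℝ, E)))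
        ((extChartAt 𝓘(ℝ, E) (1 : G)).symm ⁻¹' univ ∩ range 𝓘(ℝ, E)) (chartOne E G)) := rfl
  rw [hs, dChart_one, ContinuousLinearMap.inverse_id]
  simp only [modelWithCornersSelf_coe, range_id, preimage_univ, inter_self]
  exact congrFun VectorField.lieBracketWithin_univ (chartOne E G)

theorem hasFDerivAt_adCLM_chart_apply (Y : E) :
    HasFDerivAt (fun x : E ↦ adCLM E ((extChartAt 𝓘(ℝ, E) (1 : G)).symm x) Y)
      ((fderiv ℝ (chartLeft E G) (chartOne E G) -
        fderiv ℝ (chartRight E G) (chartOne E G)).flip Y) (chartOne E G) := by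
  have h := (hasFDerivAt_adCLM_chart (E := E) (G := G)).clm_apply
    (hasFDerivAt_const (Y : E) (chartOne E G))
  refine h.congr_fderiv ?_
  ext; simp only [ContinuousLinearMap.comp_zero, zero_add]

omit [CompleteSpace E] in
theorem adCLM_mul (g h : G) : adCLM E (g * h) = (adCLM E g).comp (adCLM E h) := by
  have hc (g : G) : MDifferentiableAt 𝓘(ℝ, E) 𝓘(ℝ, E) (fun x : G ↦ g * x * g⁻¹) 1 :=
    (mdiff_right g⁻¹ (g * 1)).comp (1 : G) (mdiff_left g 1)
  have := mfderiv_comp_model (x := (1 : G)) (hc g) (hc h) (by simp)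
  refine Eq.trans ?_ this
  have e : (fun x : G ↦ g * h * x * (g * h)⁻¹) =
      (fun x : G ↦ g * x * g⁻¹) ∘ (fun x : G ↦ h * x * h⁻¹) := by
    ext x; simp [mul_assoc]
  rw [adCLM, e]; rfl

omit [CompleteSpace E] [LieGroup 𝓘(ℝ, E) ∞ G] in
theorem adCLM_one : adCLM E (1 : G) = ContinuousLinearMap.id ℝ E := by
  have e : (fun x : G ↦ 1 * x * 1⁻¹) = id := by
    ext x; simp
  rw [adCLM, e, mfderiv_id]; rfl

/-- `Ad` is multiplicative, so continuity at `1`, which follows from differentiability in the chart,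
is enough. -/
theorem continuous_adCLM : Continuous (adCLM E : G → E →L[ℝ] E) := by
  have h1 : ContinuousAt (adCLM E : G → E →L[ℝ] E) 1 := by
    have h := (hasFDerivAt_adCLM_chart (E := E) (G := G)).continuousAt
    have h' : ContinuousAt (fun g : G ↦ adCLM E ((extChartAt 𝓘(ℝ, E) (1 : G)).symm
        (extChartAt 𝓘(ℝ, E) (1 : G) g))) 1 :=
      ContinuousAt.comp (f := extChartAt 𝓘(ℝ, E) (1 : G)) (x := (1 : G))
        (g := fun x : E ↦ adCLM E ((extChartAt 𝓘(ℝ, E) (1 : G)).symm x)) h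
        (continuousAt_extChartAt (I := 𝓘(ℝ, E)) (1 : G))
    refine h'.congr ?_
    filter_upwards [extChartAt_source_mem_nhds (I := 𝓘(ℝ, E)) (1 : G)] with g hg
    rw [(extChartAt 𝓘(ℝ, E) (1 : G)).left_inv hg]
  have : IsTopologicalGroup G := topologicalGroup_of_lieGroup 𝓘(ℝ, E) ∞
  rw [continuous_iff_continuousAt]
  intro g
  have e : (adCLM E : G → E →L[ℝ] E) = fun x ↦ (adCLM E g).comp (adCLM E (g⁻¹ * x)) := by
    ext1 x; rw [← adCLM_mul]; simp
  rw [e]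
  have h2 : ContinuousAt (fun x : G ↦ adCLM E (g⁻¹ * x)) g := by
    refine ContinuousAt.comp (f := fun x : G ↦ g⁻¹ * x) (x := g) (g := (adCLM E : G → E →L[ℝ] E)) ?_
      (continuous_const.mul continuous_id).continuousAt
    simpa using h1
  exact continuousAt_const.clm_comp h2

/-- The differential of `Ad` is `ad`, along a curve through `1`. -/
theorem hasDerivAt_adCLM_zero {X : E} {γ : ℝ → G} (hγ : IsOneParam E X γ)
    (Y : E) : HasDerivAt (fun t ↦ adCLM E (γ t) Y) (modelBracket G X Y) 0 := by
  have h0 : γ 0 = 1 := by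
    have := hγ.map_add 0 0
    simpa using this
  have hmd : MDifferentiableAt 𝓘(ℝ, ℝ) 𝓘(ℝ, E) γ 0 := hγ.smooth.mdifferentiable (by simp) 0
  have hc : HasDerivAt (fun t ↦ extChartAt 𝓘(ℝ, E) (1 : G) (γ t)) (X : E) 0 := by
    have c := mfderiv_comp_model (x := (0 : ℝ)) (mdifferentiableAt_chart
      (mem_extChartAt_source (I := 𝓘(ℝ, E)) (1 : G))) hmd h0
    have hd : MDifferentiableAt 𝓘(ℝ, ℝ) 𝓘(ℝ, E) ((extChartAt 𝓘(ℝ, E) (1 : G)) ∘ γ) 0 :=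
      MDifferentiableAt.comp_of_eq _ (mdifferentiableAt_chart
      (mem_extChartAt_source (I := 𝓘(ℝ, E)) (1 : G))) hmd h0
    have hd' := hd.differentiableAt.hasFDerivAt.hasDerivAt
    refine hd'.congr_deriv ?_
    rw [← mfderiv_eq_fderiv]
    have c1 := congrArg (fun f : ℝ →L[ℝ] E ↦ f 1) c
    have c2 : dChart (1 : G) ((id (mfderiv 𝓘(ℝ, ℝ) 𝓘(ℝ, E) γ 0) : ℝ →L[ℝ] E) 1) = X := by
      rw [dChart_one]; exact hγ.velocity
    exact c1.trans c2
  have h := (hasFDerivAt_adCLM_chart_apply (G := G) Y)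
  have he : chartOne E G = extChartAt 𝓘(ℝ, E) (1 : G) (γ 0) := by rw [h0]; rfl
  rw [he] at h
  have h' := h.comp_hasDerivAt (0 : ℝ) hc
  rw [← he] at h'
  have e2 : modelBracket G X Y = ((fderiv ℝ (chartLeft E G) (chartOne E G) -
        fderiv ℝ (chartRight E G) (chartOne E G)).flip Y) X := by
    rw [modelBracket_eq]
    simp only [ContinuousLinearMap.flip_apply, _root_.sub_apply]
    rw [fderiv_chartRight_apply]
  rw [e2]
  refine h'.congr_of_eventuallyEq ?_
  have hev : ∀ᶠ t in 𝓝 (0 : ℝ), γ t ∈ (extChartAt 𝓘(ℝ, E) (1 : G)).source := by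
    apply hγ.smooth.continuous.continuousAt
    rw [h0]; exact extChartAt_source_mem_nhds (1 : G)
  filter_upwards [hev] with t ht
  simp only [Function.comp_apply]
  rw [(extChartAt 𝓘(ℝ, E) (1 : G)).left_inv ht]

theorem hasDerivAt_adCLM {X : E} {γ : ℝ → G} (hγ : IsOneParam E X γ)
    (Y : E) (t : ℝ) :
    HasDerivAt (fun t ↦ adCLM E (γ t) Y) (adCLM E (γ t) (modelBracket G X Y)) t := by
  have e : (fun s ↦ adCLM E (γ s) Y) = fun s ↦ adCLM E (γ t) (adCLM E (γ (s - t)) Y) := by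
    ext1 s
    rw [← ContinuousLinearMap.comp_apply, ← adCLM_mul, ← hγ.map_add]; simp
  rw [e]
  have h0 := hasDerivAt_adCLM_zero hγ Y
  rw [← sub_self t] at h0
  have h1 := h0.comp_sub_const t t
  exact (adCLM E (γ t)).hasFDerivAt.comp_hasDerivAt t h1

end Bracket

/-! ### One-parameter subgroups as integral curves of left-invariant fields -/

section OneParam
variable {E : Type*} [NormedAddCommGroup E] [NormedSpace ℝ E]
  {G : Type*} [TopologicalSpace G] [ChartedSpace E G] [Group G] [LieGroup 𝓘(ℝ, E) ∞ G]

theorem t2Space_of_lieGroup (E : Type*) [NormedAddCommGroup E] [NormedSpace ℝ E]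
    (G : Type*) [TopologicalSpace G] [ChartedSpace E G] [Group G] [LieGroup 𝓘(ℝ, E) ∞ G] :
    T2Space G := by
  have : IsTopologicalGroup G := topologicalGroup_of_lieGroup 𝓘(ℝ, E) ∞
  have : T1Space G := ChartedSpace.t1Space E G
  infer_instance

theorem contMDiff_invariantField (X : E) : ContMDiff 𝓘(ℝ, E) 𝓘(ℝ, E).tangent 1
    (fun g : G ↦ (⟨g, mulInvariantVectorField (I := 𝓘(ℝ, E)) (G := G) X g⟩ :
      TangentBundle 𝓘(ℝ, E) G)) := by
  have : LieGroup 𝓘(ℝ, E) (minSmoothness ℝ 3) G :=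
    LieGroup.of_le (n := ∞) (by rw [minSmoothness_of_isRCLikeNormedField]; exact ENat.LEInfty.out)
  refine (contMDiff_mulInvariantVectorField (I := 𝓘(ℝ, E)) (G := G) X).of_le ?_
  rw [minSmoothness_of_isRCLikeNormedField]; norm_num

theorem hasMFDerivAt_left (g x : G) : HasMFDerivAt 𝓘(ℝ, E) 𝓘(ℝ, E) (fun y : G ↦ g * y) x
    (mfderiv 𝓘(ℝ, E) 𝓘(ℝ, E) (fun y : G ↦ g * y) x) := (mdiff_left g x).hasMFDerivAt

/-- The differential of left translation maps `X^L` to itself. -/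
theorem mfderiv_left_dLeft (g x : G) (X : E) :
    (id (mfderiv 𝓘(ℝ, E) 𝓘(ℝ, E) (fun y : G ↦ g * y) x) : E →L[ℝ] E) (dLeft x X) =
      dLeft (g * x) X := by
  have h := mfderiv_comp_model (x := (1 : G)) (mdiff_left (E := E) g x) (mdiff_left x 1) (mul_one x)
  have e : (fun y : G ↦ g * x * y) = (fun y : G ↦ g * y) ∘ (fun y ↦ x * y) := by
    ext; simp [mul_assoc]
  have h2 : dLeft (E := E) (g * x) =
    (id (mfderiv 𝓘(ℝ, E) 𝓘(ℝ, E) (fun y : G ↦ g * y) x) : E →L[ℝ] E).comp (dLeft x) := by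
    refine Eq.trans ?_ h
    rw [dLeft, e]; rfl
  rw [h2]; rfl

theorem isMIntegralCurveOn_left {X : E} {γ : ℝ → G} {s : Set ℝ} (g : G)
    (h : IsMIntegralCurveOn γ (mulInvariantVectorField (I := 𝓘(ℝ, E)) (G := G) X) s) :
    IsMIntegralCurveOn (fun t ↦ g * γ t) (mulInvariantVectorField (I := 𝓘(ℝ, E)) (G := G) X) s := by
  intro t ht
  have h1 := (hasMFDerivAt_left (E := E) g (γ t)).comp_hasMFDerivWithinAt t (h t ht)
  refine h1.congr_mfderiv ?_
  refine ContinuousLinearMap.ext_ring ?_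
  have e1 (B : E →L[ℝ] E) (v : E) : B ((1 : ℝ) • v) = (1 : ℝ) • B v := map_smul _ _ _
  refine (e1 _ _).trans ?_
  exact congrArg (fun v : E ↦ (1 : ℝ) • v) (mfderiv_left_dLeft g (γ t) X)

variable [CompleteSpace E]

/-- Existence of one-parameter groups as integral curves of left-invariant fields. -/
theorem exists_integralCurve (X : E) : ∃ γ : ℝ → G, γ 0 = 1 ∧
    IsMIntegralCurve γ (mulInvariantVectorField (I := 𝓘(ℝ, E)) (G := G) X) := by
  have : T2Space G := t2Space_of_lieGroup E G
  have : IsManifold 𝓘(ℝ, E) 1 G := IsManifold.of_le (n := ∞) (by simp)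
  have hv := contMDiff_invariantField (E := E) (G := G) X
  obtain ⟨γ, h0, hγ⟩ := exists_isMIntegralCurveAt_of_contMDiffAt_boundaryless (t₀ := 0)
    (hv.contMDiffAt (x := (1 : G)))
  rw [isMIntegralCurveAt_iff'] at hγ
  obtain ⟨ε, hε, hγ⟩ := hγ
  -- Left translation carries the local solution at `1` to every other point with the same lifetime
  -- `ε`, and a uniform lifetime makes the field complete.
  refine exists_isMIntegralCurve_of_isMIntegralCurveOn hv hε (fun x ↦ ⟨fun t ↦ x * γ t, ?_, ?_⟩) 1
  · simp [h0]
  · have := isMIntegralCurveOn_left x hγ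
    rwa [Real.ball_eq_Ioo, zero_sub, zero_add] at this

omit [CompleteSpace E] in
theorem integralCurve_unique {X : E} {γ γ' : ℝ → G}
    (h : IsMIntegralCurve γ (mulInvariantVectorField (I := 𝓘(ℝ, E)) (G := G) X))
    (h' : IsMIntegralCurve γ' (mulInvariantVectorField (I := 𝓘(ℝ, E)) (G := G) X))
    (h0 : γ 0 = γ' 0) : γ = γ' := by
  have : T2Space G := t2Space_of_lieGroup E G
  have : IsManifold 𝓘(ℝ, E) 1 G := IsManifold.of_le (n := ∞) (by simp)
  exact isMIntegralCurve_Ioo_eq_of_contMDiff_boundaryless (t₀ := 0)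
    (contMDiff_invariantField (E := E) (G := G) X) h h' h0

omit [LieGroup 𝓘(ℝ, E) ∞ G] [CompleteSpace E] in
theorem IsOneParam.map_zero {X : E} {γ : ℝ → G} (h : IsOneParam E X γ) : γ 0 = 1 := by
  simpa using h.map_add 0 0

omit [CompleteSpace E] in
theorem IsOneParam.isMIntegralCurve {X : E} {γ : ℝ → G} (h : IsOneParam E X γ) :
    IsMIntegralCurve γ (mulInvariantVectorField (I := 𝓘(ℝ, E)) (G := G) X) := by
  intro t
  have e : γ = (fun g ↦ γ t * g) ∘ (fun s ↦ γ (s - t)) := by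
    ext s; simp [← h.map_add]
  have hd0 : MDifferentiableAt 𝓘(ℝ, ℝ) 𝓘(ℝ, E) γ t := h.smooth.mdifferentiable (by simp) t
  refine hd0.hasMFDerivAt.congr_mfderiv ?_
  have hs : MDifferentiableAt 𝓘(ℝ, ℝ) 𝓘(ℝ, ℝ) (fun s : ℝ ↦ s - t) t :=
    (differentiableAt_id.sub_const t).mdifferentiableAt
  have hγ0 : MDifferentiableAt 𝓘(ℝ, ℝ) 𝓘(ℝ, E) γ 0 := h.smooth.mdifferentiable (by simp) 0
  have h1 := mfderiv_comp_model (x := t) hγ0 hs (sub_self t)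
  have h2 := mfderiv_comp_model (x := t) (y := (1 : G)) (f := γ ∘ fun s : ℝ ↦ s - t)
    (mdiff_left (E := E) (γ t) 1) (MDifferentiableAt.comp_of_eq _ hγ0 hs (sub_self t))
    (by simp [h.map_zero])
  have e' : (fun g ↦ γ t * g) ∘ γ ∘ (fun s ↦ s - t) = γ := e.symm
  rw [e', h1] at h2
  refine ContinuousLinearMap.ext_ring ?_
  have h3 := congrArg (fun f : ℝ →L[ℝ] E ↦ f 1) h2
  refine Eq.trans h3 ?_
  have e4 : (id (mfderiv 𝓘(ℝ, ℝ) 𝓘(ℝ, ℝ) (fun s : ℝ ↦ s - t) t) : ℝ →L[ℝ] ℝ) 1 = 1 := by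
    rw [mfderiv_eq_fderiv]
    simp
  have e5 : (id (mfderiv 𝓘(ℝ, ℝ) 𝓘(ℝ, E) γ 0) : ℝ →L[ℝ] E) 1 = X := h.velocity
  simp only [ContinuousLinearMap.comp_apply, e4, e5]
  have : (1 : ℝ) • dLeft (γ t) X = dLeft (γ t) X := one_smul _ _
  exact this.symm

omit [CompleteSpace E] in
/-- One-parameter subgroups with the same velocity agree. -/
theorem IsOneParam.unique {X : E} {γ γ' : ℝ → G} (h : IsOneParam E X γ)
    (h' : IsOneParam E X γ') : γ = γ' :=
  integralCurve_unique h.isMIntegralCurve h'.isMIntegralCurve (by rw [h.map_zero, h'.map_zero])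

/-- An integral curve of `X^L` through `1` is smooth near `0`. -/
theorem contMDiffAt_integralCurve_zero {X : E} {γ : ℝ → G} (h0 : γ 0 = 1)
    (h : IsMIntegralCurve γ (mulInvariantVectorField (I := 𝓘(ℝ, E)) (G := G) X)) :
    ContMDiffAt 𝓘(ℝ, ℝ) 𝓘(ℝ, E) ∞ γ 0 := by
  have hcont : Continuous γ := h.continuous
  let φ := extChartAt 𝓘(ℝ, E) (1 : G)
  have hU : IsOpen (γ ⁻¹' φ.source) := (isOpen_extChartAt_source (I := 𝓘(ℝ, E)) (1 : G)).preimage hcont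
  have h0U : (0 : ℝ) ∈ γ ⁻¹' φ.source := by
    rw [mem_preimage, h0]; exact mem_extChartAt_source (I := 𝓘(ℝ, E)) (1 : G)
  obtain ⟨ε, hε, hball⟩ := Metric.isOpen_iff.1 hU 0 h0U
  have hsub : Icc (-(ε / 2)) (ε / 2) ⊆ γ ⁻¹' φ.source := by
    refine Subset.trans ?_ hball
    intro t ht
    rw [Real.ball_eq_Ioo]
    constructor <;> linarith [ht.1, ht.2]
  have hder : ∀ t ∈ Icc (-(ε / 2)) (ε / 2),
      HasDerivWithinAt (φ ∘ γ) (chartLeft E G ((φ ∘ γ) t) X) (Icc (-(ε / 2)) (ε / 2)) t := by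
    intro t ht
    have hs : γ t ∈ φ.source := hsub ht
    have hm := mdifferentiableAt_chart (E := E) hs
    have hγt := (h t).mdifferentiableAt
    have hd : MDifferentiableAt 𝓘(ℝ, ℝ) 𝓘(ℝ, E) (φ ∘ γ) t := MDifferentiableAt.comp t hm hγt
    refine (hd.differentiableAt.hasFDerivAt.hasDerivAt.congr_deriv ?_).hasDerivWithinAt
    have c := mfderiv_comp_model (x := t) hm hγt rfl
    rw [(h t).mfderiv, mfderiv_eq_fderiv] at c
    have c1 := congrArg (fun f : ℝ →L[ℝ] E ↦ f 1) c
    refine Eq.trans c1 ?_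
    have e6 : chartLeft E G (φ (γ t)) = (dChart (γ t)).comp (dLeft (γ t)) := by
      rw [chartLeft_eq (φ.map_source hs),
        show (extChartAt 𝓘(ℝ, E) (1 : G)).symm (φ (γ t)) = γ t from φ.left_inv hs]
    refine Eq.trans ?_ (congrArg (fun f : E →L[ℝ] E ↦ f X) e6.symm)
    have : (1 : ℝ) • dLeft (γ t) X = dLeft (γ t) X := one_smul _ _
    exact congrArg (dChart (γ t)) this
  -- In the chart the curve solves the autonomous equation `x' = chartLeft x X`, whose right side is
  -- smooth, so its solutions are smooth.
  have hsm := ODE.contDiffOn_enat_Icc_of_hasDerivWithinAt (n := ⊤)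
    (f := fun _ x ↦ chartLeft E G x X) (α := φ ∘ γ) (u := φ.target)
    (tmin := -(ε / 2)) (tmax := ε / 2) ?_ hder (fun t ht ↦ φ.map_source (hsub ht))
  · have h2 : ContDiffAt ℝ ∞ (φ ∘ γ) 0 := hsm.contDiffAt (Icc_mem_nhds (by linarith) (by linarith))
    have h3 : ContMDiffAt 𝓘(ℝ, E) 𝓘(ℝ, E) ∞ φ.symm ((φ ∘ γ) 0) :=
      (contMDiffOn_extChartAt_symm (1 : G)).contMDiffAt
        ((isOpen_extChartAt_target (I := 𝓘(ℝ, E)) (1 : G)).mem_nhds (φ.map_source h0U))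
    refine (h3.comp (0 : ℝ) h2.contMDiffAt).congr_of_eventuallyEq ?_
    filter_upwards [hU.mem_nhds h0U] with t ht
    exact (φ.left_inv ht).symm
  · intro p hp
    have h1 : ContDiffAt ℝ ∞ (fun q : ℝ × E ↦ chartLeft E G q.2 X) p :=
      ((contDiffAt_chartLeft hp.2).comp p contDiffAt_snd).clm_apply contDiffAt_const
    exact h1.contDiffWithinAt

variable (G) in
/-- Every `X ∈ 𝔤` is the velocity of a one-parameter subgroup. -/
theorem exists_isOneParam (X : E) : ∃ γ : ℝ → G, IsOneParam E X γ := by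
  obtain ⟨γ, h0, h⟩ := exists_integralCurve (G := G) X
  -- The time shift of `γ` by `s` and its left translate by `γ s` are integral curves of the same
  -- field that agree at time `0`.
  have hadd (s t : ℝ) : γ (s + t) = γ s * γ t := by
    have h1 : IsMIntegralCurve (fun t ↦ γ s * γ t)
        (mulInvariantVectorField (I := 𝓘(ℝ, E)) (G := G) X) := by
      rw [isMIntegralCurve_iff_isMIntegralCurveOn] at h ⊢
      exact isMIntegralCurveOn_left _ h
    have h2 := h.comp_add s
    have := congrFun (integralCurve_unique h2 h1 (by simp [h0])) t
    rw [add_comm]; exact this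
  refine ⟨γ, ⟨?_, hadd, ?_⟩⟩
  · intro t
    have e : γ = (fun g ↦ γ t * g) ∘ (γ ∘ (fun s ↦ s - t)) := by
      ext s; simp [← hadd]
    rw [e]
    refine (contMDiff_mul_left (I := 𝓘(ℝ, E)) (n := ∞)).contMDiffAt.comp t ?_
    refine ContMDiffAt.comp_of_eq (y := (0 : ℝ)) (contMDiffAt_integralCurve_zero h0 h) ?_ (by simp)
    exact (contDiffAt_id.sub contDiffAt_const).contMDiffAt
  · rw [(h 0).mfderiv]
    have e : (1 : ℝ) • dLeft (γ 0) X = X := by rw [one_smul, h0, dLeft_one]; rfl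
    exact e

omit [LieGroup 𝓘(ℝ, E) ∞ G] [CompleteSpace E] in
theorem IsOneParam.smul {X : E} {γ : ℝ → G} (h : IsOneParam E X γ) (c : ℝ) :
    IsOneParam E (c • X) (fun t ↦ γ (c * t)) := by
  have hc : ContDiff ℝ ∞ (fun t : ℝ ↦ c * t) := contDiff_const.mul contDiff_id
  refine ⟨h.smooth.comp hc.contMDiff, fun s t ↦ by rw [mul_add, h.map_add], ?_⟩
  have hγ0 : MDifferentiableAt 𝓘(ℝ, ℝ) 𝓘(ℝ, E) γ 0 := h.smooth.mdifferentiable (by simp) 0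
  have h1 := mfderiv_comp_model (x := (0 : ℝ)) hγ0
    (hc.differentiable (by simp) (0 : ℝ)).mdifferentiableAt (mul_zero c)
  have h2 := congrArg (fun f : ℝ →L[ℝ] E ↦ f 1) h1
  refine Eq.trans h2 ?_
  have e4 : (id (mfderiv 𝓘(ℝ, ℝ) 𝓘(ℝ, ℝ) (fun s : ℝ ↦ c * s) 0) : ℝ →L[ℝ] ℝ) 1 = c := by
    rw [mfderiv_eq_fderiv]
    simp
  have e5 : (id (mfderiv 𝓘(ℝ, ℝ) 𝓘(ℝ, E) γ 0) : ℝ →L[ℝ] E) 1 = X := h.velocity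
  have e6 (B : ℝ →L[ℝ] E) : B c = c • B 1 := by rw [← map_smul, smul_eq_mul, mul_one]
  simp only [ContinuousLinearMap.comp_apply, e4]
  exact (e6 _).trans (congrArg (fun v : E ↦ c • v) e5)

omit [CompleteSpace E] in
theorem IsOneParam.conj {X : E} {γ : ℝ → G} (h : IsOneParam E X γ) (g : G) :
    IsOneParam E (adCLM E g X) (fun t ↦ g * γ t * g⁻¹) := by
  have hc : ContMDiff 𝓘(ℝ, E) 𝓘(ℝ, E) ∞ (fun x : G ↦ g * x * g⁻¹) :=
    (contMDiff_mul_right (I := 𝓘(ℝ, E)) (n := ∞)).comp contMDiff_mul_left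
  refine ⟨hc.comp h.smooth, fun s t ↦ by rw [h.map_add]; group, ?_⟩
  have hγ0 : MDifferentiableAt 𝓘(ℝ, ℝ) 𝓘(ℝ, E) γ 0 := h.smooth.mdifferentiable (by simp) 0
  have h1 := mfderiv_comp_model (x := (0 : ℝ)) (hc.mdifferentiable (by simp) 1) hγ0 h.map_zero
  have h2 := congrArg (fun f : ℝ →L[ℝ] E ↦ f 1) h1
  refine Eq.trans h2 ?_
  have e5 : (id (mfderiv 𝓘(ℝ, ℝ) 𝓘(ℝ, E) γ 0) : ℝ →L[ℝ] E) 1 = X := h.velocity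
  simp only [ContinuousLinearMap.comp_apply, e5]
  rfl

/-- `Ad g` respects the bracket. -/
theorem adCLM_modelBracket (g : G) (X Y : E) :
    adCLM E g (modelBracket G X Y) = modelBracket G (adCLM E g X) (adCLM E g Y) := by
  obtain ⟨γ, hγ⟩ := exists_isOneParam G X
  have h1 := (adCLM E g).hasFDerivAt.comp_hasDerivAt 0 (hasDerivAt_adCLM_zero hγ Y)
  have h2 := hasDerivAt_adCLM_zero (hγ.conj g) (adCLM E g Y)
  -- The two derivatives at `0` are of the same curve, because `Ad g (Ad (γ t) Y) = Ad (g γ t g⁻¹)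
  -- (Ad g Y)`.
  refine h1.unique (h2.congr_of_eventuallyEq (Eventually.of_forall fun t ↦ ?_))
  simp only [Function.comp_apply]
  rw [← ContinuousLinearMap.comp_apply, ← ContinuousLinearMap.comp_apply, ← adCLM_mul, ← adCLM_mul]
  simp

end OneParam

/-! ### Exponentials of operators: derivations and automorphisms -/

section Exp
open NormedSpace

theorem exp_image_ball_mem_nhds {A : Type*} [NormedRing A] [NormedAlgebra ℝ A] [CompleteSpace A]
    {ε : ℝ} (hε : 0 < ε) : exp '' Metric.ball (0 : A) ε ∈ 𝓝 (1 : A) := by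
  have h := (hasStrictFDerivAt_exp_zero (𝕂 := ℝ) (𝔸 := A)).map_nhds_eq_of_surj
    (LinearMap.range_eq_top.2 fun x ↦ ⟨x, rfl⟩)
  rw [exp_zero] at h
  rw [← h]
  exact image_mem_map (Metric.ball_mem_nhds _ hε)

theorem exp_injOn_ball (A : Type*) [NormedRing A] [NormedAlgebra ℝ A] [CompleteSpace A] :
    ∃ ε > 0, InjOn exp (Metric.ball (0 : A) ε) := by
  have h : HasStrictFDerivAt (exp : A → A)
      ((ContinuousLinearEquiv.refl ℝ A : A ≃L[ℝ] A) : A →L[ℝ] A) 0 :=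
    hasStrictFDerivAt_exp_zero (𝕂 := ℝ) (𝔸 := A)
  have hs := (h.toOpenPartialHomeomorph exp).open_source.mem_nhds
    h.mem_toOpenPartialHomeomorph_source
  obtain ⟨ε, hε, hsub⟩ := Metric.mem_nhds_iff.1 hs
  exact ⟨ε, hε, (h.toOpenPartialHomeomorph exp).injOn.mono hsub⟩

variable {V : Type*} [NormedAddCommGroup V] [NormedSpace ℝ V] [CompleteSpace V]

theorem exp_mul_exp_neg (D : V →L[ℝ] V) : exp D * exp (-D) = 1 := by
  let _ : NormedAlgebra ℚ (V →L[ℝ] V) := NormedAlgebra.restrictScalars ℚ ℝ _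
  rw [← exp_add_of_commute (Commute.refl D).neg_right]; simp

theorem exp_neg_mul_exp (D : V →L[ℝ] V) : exp (-D) * exp D = 1 := by
  simpa using exp_mul_exp_neg (-D)

theorem exp_neg_apply_exp (D : V →L[ℝ] V) (x : V) : exp (-D) (exp D x) = x :=
  congrArg (fun T : V →L[ℝ] V ↦ T x) (exp_neg_mul_exp D)

theorem exp_apply_exp_neg (D : V →L[ℝ] V) (x : V) : exp D (exp (-D) x) = x :=
  congrArg (fun T : V →L[ℝ] V ↦ T x) (exp_mul_exp_neg D)

theorem hasDerivAt_exp_smul_apply (D : V →L[ℝ] V) (x : V) (t : ℝ) :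
    HasDerivAt (fun s : ℝ ↦ exp (s • D) x) (exp (t • D) (D x)) t := by
  have := (hasDerivAt_exp_smul_const (𝕂 := ℝ) D t).clm_apply (hasDerivAt_const t x)
  simpa using this

theorem hasDerivAt_exp_smul_apply' (D : V →L[ℝ] V) (x : V) (t : ℝ) :
    HasDerivAt (fun s : ℝ ↦ exp (s • D) x) (D (exp (t • D) x)) t := by
  have := (hasDerivAt_exp_smul_const' (𝕂 := ℝ) D t).clm_apply (hasDerivAt_const t x)
  simpa using this

theorem exp_apply_eq_self {D : V →L[ℝ] V} {x : V} (h : D x = 0) : exp D x = x := by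
  have hd (t : ℝ) : HasDerivAt (fun s : ℝ ↦ exp (s • D) x) 0 t := by
    have := hasDerivAt_exp_smul_apply D x t
    rwa [h, map_zero] at this
  have := is_const_of_deriv_eq_zero (fun t ↦ (hd t).differentiableAt) (fun t ↦ (hd t).deriv) 1 0
  simpa using this

theorem exp_apply_eq_smul {D : V →L[ℝ] V} {x : V} {c : ℝ} (h : D x = c • x) :
    exp D x = Real.exp c • x := by
  have hd (t : ℝ) : HasDerivAt (fun s : ℝ ↦ Real.exp (-(s * c)) • exp (s • D) x) 0 t := by
    have h1 := hasDerivAt_exp_smul_apply D x t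
    have h2 : HasDerivAt (fun s : ℝ ↦ Real.exp (-(s * c))) (Real.exp (-(t * c)) * (-c)) t := by
      have := (((hasDerivAt_id t).mul_const c).neg).exp
      simpa using this
    refine (h2.smul h1).congr_deriv ?_
    rw [h, map_smul, smul_smul, ← add_smul]
    convert zero_smul ℝ _ using 2
    ring
  have := is_const_of_deriv_eq_zero (fun t ↦ (hd t).differentiableAt) (fun t ↦ (hd t).deriv) 1 0
  simp only [one_mul, one_smul, zero_mul, neg_zero, Real.exp_zero, zero_smul, exp_zero] at this
  rw [show (1 : V →L[ℝ] V) x = x from rfl] at this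
  have h2 := congrArg (fun v ↦ Real.exp c • v) this
  simpa [smul_smul, ← Real.exp_add] using h2

theorem exists_exp_near_one (V : Type*) [NormedAddCommGroup V] [NormedSpace ℝ V] [CompleteSpace V]
    {η : ℝ} (hη : 0 < η) : ∃ ε > 0, ∀ D : V →L[ℝ] V, ‖D‖ < ε → ∀ s ∈ Icc (-1 : ℝ) 1,
      ‖exp (s • D) - 1‖ < η := by
  have hc : ContinuousAt (exp : (V →L[ℝ] V) → (V →L[ℝ] V)) 0 :=
    (hasStrictFDerivAt_exp_zero (𝕂 := ℝ) (𝔸 := V →L[ℝ] V)).continuousAt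
  obtain ⟨ε, hε, h⟩ := Metric.continuousAt_iff.1 hc η hη
  refine ⟨ε, hε, fun D hD s hs ↦ ?_⟩
  have : dist (s • D) 0 < ε := by
    rw [dist_zero_right, norm_smul]
    have : ‖s‖ ≤ 1 := abs_le.2 hs
    nlinarith [norm_nonneg D]
  simpa [dist_eq_norm] using h this

/-- A vector fixed by `exp D`, `D` small, is annihilated by `D`. -/
theorem exists_exp_fixed_small (V : Type*) [NormedAddCommGroup V] [NormedSpace ℝ V]
    [CompleteSpace V] :
    ∃ ε > 0, ∀ D : V →L[ℝ] V, ‖D‖ < ε → ∀ x, exp D x = x → D x = 0 := by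
  obtain ⟨ε, hε, h⟩ := exists_exp_near_one V (η := 1 / 2) (by norm_num)
  refine ⟨ε, hε, fun D hD x hx ↦ ?_⟩
  -- When `exp D x = x`, this curve changes by `-D x` over `[0, 1]`, while its derivative has norm
  -- at most half that of `D x`.
  have hd (t : ℝ) : HasDerivAt (fun s : ℝ ↦ exp (s • D) x - s • D x)
      (exp (t • D) (D x) - (1 : ℝ) • D x) t :=
    (hasDerivAt_exp_smul_apply D x t).sub ((hasDerivAt_id t).smul_const (D x))
  have hb := norm_image_sub_le_of_norm_deriv_le_segment_01' (C := 1 / 2 * ‖D x‖)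
    (fun t _ ↦ (hd t).hasDerivWithinAt) (fun t ht ↦ by
      have := h D hD t ⟨by linarith [ht.1], ht.2.le⟩
      have h2 := (exp (t • D) - 1).le_opNorm (D x)
      rw [one_smul]
      exact h2.trans (by gcongr))
  have : ‖D x‖ ≤ 1 / 2 * ‖D x‖ := by
    refine le_trans (le_of_eq ?_) hb
    simp [hx]
  exact norm_le_zero_iff.1 (by linarith)

variable (β : V →L[ℝ] V →L[ℝ] V)

/-- The failure of `D` to be a derivation of `β`. -/
def derivDefect (D : V →L[ℝ] V) : V →L[ℝ] V →L[ℝ] V :=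
  β.comp D + (β.flip.comp D).flip - (ContinuousLinearMap.compL ℝ V V V D).comp β

omit [CompleteSpace V] in
theorem derivDefect_apply (D : V →L[ℝ] V) (x y : V) :
    derivDefect β D x y = β (D x) y + β x (D y) - D (β x y) := by
  simp [derivDefect]

/-- Transporting `β` by `exp (s D)` changes it at a rate given by the transported defect of `D`.
Both passages, from derivations to automorphisms and back, integrate this formula. -/
theorem hasDerivAt_exp_conj (D : V →L[ℝ] V) (x y : V) (t : ℝ) :
    HasDerivAt (fun s : ℝ ↦ exp (-(s • D)) (β (exp (s • D) x) (exp (s • D) y)))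
      (exp (-(t • D)) (derivDefect β D (exp (t • D) x) (exp (t • D) y))) t := by
  have h1 := hasDerivAt_exp_smul_apply' D x t
  have h2 := hasDerivAt_exp_smul_apply' D y t
  have h3 := (β.hasFDerivAt.comp_hasDerivAt t h1).clm_apply h2
  have h4 : HasDerivAt (fun s : ℝ ↦ exp (-(s • D))) (exp (-(t • D)) * (-D)) t := by
    simpa using hasDerivAt_exp_smul_const (𝕂 := ℝ) (-D) t
  refine (h4.clm_apply h3).congr_deriv ?_
  rw [derivDefect_apply]
  simp
  abel

/-- The exponential of a derivation is an automorphism. -/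
theorem exp_map_of_derivation {D : V →L[ℝ] V} (h : ∀ x y, D (β x y) = β (D x) y + β x (D y))
    (x y : V) : exp D (β x y) = β (exp D x) (exp D y) := by
  have hd (t : ℝ) : HasDerivAt (fun s : ℝ ↦ exp (-(s • D)) (β (exp (s • D) x) (exp (s • D) y)))
      0 t := by
    have := hasDerivAt_exp_conj β D x y t
    rwa [derivDefect_apply, h, sub_self, map_zero] at this
  have := is_const_of_deriv_eq_zero (fun t ↦ (hd t).differentiableAt) (fun t ↦ (hd t).deriv) 1 0
  simp only [one_smul, zero_smul, neg_zero, exp_zero] at this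
  have h2 := congrArg (fun v ↦ (exp D : V →L[ℝ] V) v) this
  simp only [exp_apply_exp_neg] at h2
  exact (h2.trans rfl).symm

/-- If `exp D`, with `D` small, is an automorphism, then `D` is a derivation. -/
theorem exists_derivation_small :
    ∃ ε > 0, ∀ D : V →L[ℝ] V, ‖D‖ < ε → (∀ x y, exp D (β x y) = β (exp D x) (exp D y)) →
      ∀ x y, D (β x y) = β (D x) y + β x (D y) := by
  obtain ⟨ε, hε, h⟩ := exists_exp_near_one V (η := 1 / 10) (by norm_num)
  refine ⟨ε, hε, fun D hD haut ↦ ?_⟩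
  set δ := derivDefect β D with hδ
  -- An automorphism `exp D` returns the transported `β` to `β` at time `1`, while its velocity
  -- stays near `δ`. With `exp (± t D)` within `1/10` of `1`, the velocity error is at most `0.121 +
  -- 0.11 + 0.1 < 1/2` times `‖δ‖ ‖x‖ ‖y‖`, and a bound of `δ` by half its own norm forces `δ = 0`.
  have key (x y : V) : ‖δ x y‖ ≤ (1 / 2 * ‖δ‖) * ‖x‖ * ‖y‖ := by
    have hd (t : ℝ) : HasDerivAt
        (fun s : ℝ ↦ exp (-(s • D)) (β (exp (s • D) x) (exp (s • D) y)) - s • δ x y)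
        (exp (-(t • D)) (δ (exp (t • D) x) (exp (t • D) y)) - (1 : ℝ) • δ x y) t :=
      (hasDerivAt_exp_conj β D x y t).sub ((hasDerivAt_id t).smul_const _)
    have hb := norm_image_sub_le_of_norm_deriv_le_segment_01' (C := 1 / 2 * ‖δ‖ * ‖x‖ * ‖y‖)
      (fun t _ ↦ (hd t).hasDerivWithinAt) (fun t ht ↦ ?_)
    · refine le_trans (le_of_eq ?_) hb
      have e : exp (-D) (β (exp D x) (exp D y)) = β x y := by
        rw [← haut, exp_neg_apply_exp]
      simp [e]
    · have p1 := h D hD t ⟨by linarith [ht.1], ht.2.le⟩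
      have p2 := h D hD (-t) ⟨by linarith [ht.2], by linarith [ht.1]⟩
      rw [neg_smul] at p2
      set P := exp (t • D)
      set Q := exp (-(t • D))
      have hx : ‖P x - x‖ ≤ 1 / 10 * ‖x‖ :=
        ((P - 1).le_opNorm x).trans (by gcongr)
      have hy : ‖P y - y‖ ≤ 1 / 10 * ‖y‖ :=
        ((P - 1).le_opNorm y).trans (by gcongr)
      have hx' : ‖P x‖ ≤ 11 / 10 * ‖x‖ := by
        have := norm_le_norm_add_norm_sub' (P x) x
        linarith
      have hQ (z : V) : ‖Q z - z‖ ≤ 1 / 10 * ‖z‖ :=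
        ((Q - 1).le_opNorm z).trans (by gcongr)
      have e1 : Q (δ (P x) (P y)) - (1 : ℝ) • δ x y =
          (Q (δ (P x) (P y)) - δ (P x) (P y)) + (δ (P x) (P y - y) + δ (P x - x) y) := by
        simp
      have hy' : ‖P y‖ ≤ 11 / 10 * ‖y‖ := by
        have := norm_le_norm_add_norm_sub' (P y) y
        linarith
      have b0 : ‖δ (P x) (P y)‖ ≤ ‖δ‖ * (11 / 10 * ‖x‖) * (11 / 10 * ‖y‖) :=
        (δ.le_opNorm₂ _ _).trans (by gcongr)
      have b1 : ‖δ (P x) (P y - y)‖ ≤ ‖δ‖ * (11 / 10 * ‖x‖) * (1 / 10 * ‖y‖) :=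
        (δ.le_opNorm₂ _ _).trans (by gcongr)
      have b2 : ‖δ (P x - x) y‖ ≤ ‖δ‖ * (1 / 10 * ‖x‖) * ‖y‖ :=
        (δ.le_opNorm₂ _ _).trans (by gcongr)
      rw [e1]
      have t1 := norm_add_le (Q (δ (P x) (P y)) - δ (P x) (P y)) (δ (P x) (P y - y) + δ (P x - x) y)
      have t2 := norm_add_le (δ (P x) (P y - y)) (δ (P x - x) y)
      have t3 := hQ (δ (P x) (P y))
      have hp : 0 ≤ ‖δ‖ * ‖x‖ * ‖y‖ := by positivity
      linarith
  have hle : ‖δ‖ ≤ 1 / 2 * ‖δ‖ := δ.opNorm_le_bound₂ (by positivity) key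
  have h0 : δ = 0 := by
    have : ‖δ‖ ≤ 0 := by linarith
    ext x y
    have h1 := δ.le_opNorm₂ x y
    have h2 : ‖δ‖ * ‖x‖ * ‖y‖ ≤ 0 := by
      have := mul_nonneg (norm_nonneg x) (norm_nonneg y)
      rw [mul_assoc]; exact mul_nonpos_of_nonpos_of_nonneg ‹_› this
    simpa using norm_le_zero_iff.1 (h1.trans h2)
  intro x y
  have := derivDefect_apply β D x y
  rw [← hδ, h0] at this
  simp only [_root_.zero_apply] at this
  rw [eq_comm, ← sub_eq_zero]; exact this.symm

end Exp

/-! ### Kernels under analytic continuation and small perturbation -/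

section LinearAlgebra

/-- The hypothesis makes the kernel equal to the generalized `0`-eigenspace. A lower bound on the
kernel thereby becomes the vanishing of low characteristic coefficients, a condition that analytic
continuation can carry. -/
theorem finrank_ker_eq_natTrailingDegree {V : Type*} [AddCommGroup V] [Module ℝ V]
    [FiniteDimensional ℝ V] (f : Module.End ℝ V) (h : ∀ x, f (f x) = 0 → f x = 0) :
    Module.finrank ℝ (LinearMap.ker f) = f.charpoly.natTrailingDegree := by
  rw [← LinearMap.finrank_maxGenEigenspace_zero_eq]
  suffices LinearMap.ker f = f.maxGenEigenspace 0 by rw [this]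
  refine le_antisymm (fun x hx ↦ ?_) (fun x hx ↦ ?_)
  · rw [Module.End.mem_maxGenEigenspace]
    exact ⟨1, by simpa using hx⟩
  · rw [Module.End.mem_maxGenEigenspace] at hx
    obtain ⟨k, hk⟩ := hx
    rw [zero_smul, sub_zero] at hk
    induction k with
    | zero => simp only [pow_zero, Module.End.one_apply] at hk; simp [hk]
    | succ k ih =>
      cases k with
      | zero => simpa using hk
      | succ k =>
        apply ih
        rw [pow_succ', pow_succ', Module.End.mul_apply, Module.End.mul_apply] at hk
        rw [pow_succ', Module.End.mul_apply]
        exact h _ hk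

/-- The multiplicity of the eigenvalue `0` along an analytic curve is bounded below by its
value near one point. -/
theorem le_natTrailingDegree_of_analytic {L M : Type*} [AddCommGroup L] [Module ℝ L]
    [FiniteDimensional ℝ L] [AddCommGroup M] [Module ℝ M] [FiniteDimensional ℝ M]
    (φ : L →ₗ[ℝ] Module.End ℝ M) (c : ℝ → L)
    (hc : ∀ f : L →ₗ[ℝ] ℝ, AnalyticOnNhd ℝ (fun t ↦ f (c t)) univ) (d : ℕ)
    (h : ∀ᶠ t in 𝓝 (0 : ℝ), d ≤ (φ (c t)).charpoly.natTrailingDegree) (t : ℝ) :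
    d ≤ (φ (c t)).charpoly.natTrailingDegree := by
  let b := Module.finBasis ℝ L
  refine Polynomial.le_natTrailingDegree (LinearMap.charpoly_monic _).ne_zero fun j hj ↦ ?_
  have ha : AnalyticOnNhd ℝ (fun t ↦ (φ (c t)).charpoly.coeff j) univ := by
    have := AnalyticOnNhd.aeval_mvPolynomial (𝕜 := ℝ) (s := univ) (f := fun t i ↦ b.repr (c t) i)
      (fun i ↦ hc (b.coord i)) ((φ.polyCharpoly b).coeff j)
    refine this.congr isOpen_univ fun t _ ↦ ?_
    rw [← LinearMap.polyCharpoly_coeff_eval φ b (c t) j]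
    rfl
  have hz := ha.eqOn_zero_of_preconnected_of_eventuallyEq_zero isPreconnected_univ (mem_univ 0)
    (by
      filter_upwards [h] with t ht
      exact Polynomial.coeff_eq_zero_of_lt_natTrailingDegree (hj.trans_le ht))
  exact hz (mem_univ t)

/-- If `ker A ∩ range A = 0`, kernels of operators near `A` commuting with it lie in `ker A`. -/
theorem eventually_ker_le {V ι : Type*} [NormedAddCommGroup V] [NormedSpace ℝ V]
    [FiniteDimensional ℝ V] {A : V →L[ℝ] V} (hA : ∀ x, A (A x) = 0 → A x = 0)
    {C : ι → V →L[ℝ] V} {l : Filter ι} (hC : Tendsto C l (𝓝 A))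
    (hcomm : ∀ s x, C s (A x) = A (C s x)) : ∀ᶠ s in l, ∀ x, C s x = 0 → A x = 0 := by
  let R : Submodule ℝ V := LinearMap.range (A : V →ₗ[ℝ] V)
  let f : R →ₗ[ℝ] V := (A : V →ₗ[ℝ] V).comp R.subtype
  have hf : LinearMap.ker f = ⊥ := by
    rw [LinearMap.ker_eq_bot']
    rintro ⟨y, x, rfl⟩ hy
    exact Subtype.ext (hA x hy)
  obtain ⟨K, hK, hanti⟩ := f.exists_antilipschitzWith hf
  have hb : ∀ᶠ s in l, ‖C s - A‖ < (K : ℝ)⁻¹ := by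
    have := (Metric.tendsto_nhds.1 hC) (K : ℝ)⁻¹ (by positivity)
    simpa [dist_eq_norm] using this
  filter_upwards [hb] with s hs x hx
  by_contra hne
  -- By commutation `C s` also kills `A x`, so `‖A (A x)‖ ≤ ‖C s - A‖ ‖A x‖`. But `A` is bounded
  -- below by `K⁻¹` on its range, and `C s` is closer to `A` than that.
  have h1 : C s (A x) = 0 := by rw [hcomm, hx, map_zero]
  have h2 : ‖A x‖ ≤ K * ‖A (A x)‖ := by
    have := hanti.le_mul_dist (⟨A x, x, rfl⟩ : R) 0
    simpa [dist_eq_norm, f] using this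
  have h3 : ‖A (A x)‖ ≤ ‖C s - A‖ * ‖A x‖ := by
    have := (C s - A).le_opNorm (A x)
    simpa [h1] using this
  have hpos : 0 < ‖A x‖ := norm_pos_iff.2 hne
  have h4 : ‖C s - A‖ * ‖A x‖ < (K : ℝ)⁻¹ * ‖A x‖ := by gcongr
  have hK' : (0 : ℝ) < K := hK
  have : ‖A x‖ < ‖A x‖ := by
    calc ‖A x‖ ≤ K * ‖A (A x)‖ := h2
      _ < K * ((K : ℝ)⁻¹ * ‖A x‖) := by gcongr; exact h3.trans_lt h4
      _ = ‖A x‖ := by field_simp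
  exact lt_irrefl _ this

end LinearAlgebra

/-! ### Square roots of positive definite operators -/

section Sqrt
variable {V : Type*} [NormedAddCommGroup V] [InnerProductSpace ℝ V]

local notation "⟪" x ", " y "⟫" => inner ℝ x y

/-- Symmetric positive definite operators. -/
structure IsPosDefOp (R : V →ₗ[ℝ] V) : Prop where
  symm : R.IsSymmetric
  pos : ∀ x, x ≠ 0 → 0 < ⟪R x, x⟫

theorem IsPosDefOp.nonneg {R : V →ₗ[ℝ] V} (h : IsPosDefOp R) (x : V) : 0 ≤ ⟪R x, x⟫ := by
  by_cases hx : x = 0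
  · simp [hx]
  · exact (h.pos x hx).le

theorem IsPosDefOp.injective {R : V →ₗ[ℝ] V} (h : IsPosDefOp R) : Function.Injective R := by
  rw [← LinearMap.ker_eq_bot, LinearMap.ker_eq_bot']
  intro x hx
  by_contra hne
  have := h.pos x hne
  simp [hx] at this

variable [FiniteDimensional ℝ V]

theorem IsPosDefOp.exists_bound {R : V →ₗ[ℝ] V} (h : IsPosDefOp R) :
    ∃ c > 0, ∀ x, c * ‖x‖ ^ 2 ≤ ⟪R x, x⟫ := by
  by_cases hV : Subsingleton V
  · exact ⟨1, one_pos, fun x ↦ by simp [Subsingleton.elim x 0]⟩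
  rw [not_subsingleton_iff_nontrivial] at hV
  have hc : Continuous (fun x : V ↦ ⟪R x, x⟫) :=
    (LinearMap.continuous_of_finiteDimensional R).inner continuous_id
  obtain ⟨v, hv, hmin⟩ := (isCompact_sphere (0 : V) 1).exists_isMinOn
    (NormedSpace.sphere_nonempty.2 zero_le_one) hc.continuousOn
  have hv1 : ‖v‖ = 1 := by simpa using hv
  have hv0 : v ≠ 0 := fun h0 ↦ by simp [h0] at hv1
  refine ⟨_, h.pos v hv0, fun x ↦ ?_⟩
  by_cases hx : x = 0
  · simp [hx]
  have hxn : 0 < ‖x‖ := norm_pos_iff.2 hx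
  have h1 : ‖x‖⁻¹ • x ∈ Metric.sphere (0 : V) 1 := by
    simp [norm_smul, hxn.ne']
  have h2 := hmin h1
  simp only [mem_ofPred_eq, map_smul, inner_smul_left, inner_smul_right, conj_trivial] at h2
  have : ⟪R x, x⟫ = ‖x‖ ^ 2 * (‖x‖⁻¹ * (‖x‖⁻¹ * ⟪R x, x⟫)) := by field_simp
  rw [this, mul_comm]
  gcongr

/-- The eigenvector basis is orthonormal, so the bound adds up over coordinates. The case `K = 0`
says that a symmetric operator with no nonzero eigenvalue vanishes, which `fixed_commute` uses. -/
theorem norm_apply_le_of_eigenvalues {A : V →ₗ[ℝ] V} (hA : A.IsSymmetric) {K : ℝ} (hK : 0 ≤ K)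
    (h : ∀ (μ : ℝ) (v : V), ‖v‖ = 1 → A v = μ • v → |μ| ≤ K) (x : V) : ‖A x‖ ≤ K * ‖x‖ := by
  let b := hA.eigenvectorBasis rfl
  have hb (i) : A (b i) = hA.eigenvalues rfl i • b i := hA.apply_eigenvectorBasis rfl i
  have h1 : ‖A x‖ ^ 2 ≤ K ^ 2 * ‖x‖ ^ 2 := by
    rw [← b.sum_sq_norm_inner_right (A x), ← b.sum_sq_norm_inner_right x, Finset.mul_sum]
    refine Finset.sum_le_sum fun i _ ↦ ?_
    rw [← hA, hb, inner_smul_left, norm_mul, mul_pow]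
    have := h _ (b i) (b.norm_eq_one i) (hb i)
    simp only [conj_trivial, Real.norm_eq_abs]
    gcongr
  rw [← mul_pow] at h1
  exact (abs_le_of_sq_le_sq' h1 (by positivity)).2

/-- The square root is locally Lipschitz. -/
theorem sqrt_lipschitz {R₁ R₂ : V →ₗ[ℝ] V} (h₁ : IsPosDefOp R₁) (h₂ : IsPosDefOp R₂) {c : ℝ}
    (hc : 0 < c) (hb : ∀ x, c * ‖x‖ ^ 2 ≤ ⟪R₁ x, x⟫) {K : ℝ} (hK : 0 ≤ K)
    (hS : ∀ x, ‖R₂ (R₂ x) - R₁ (R₁ x)‖ ≤ K * ‖x‖) (x : V) :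
    ‖R₂ x - R₁ x‖ ≤ K / c * ‖x‖ := by
  have hA : (R₂ - R₁).IsSymmetric := h₂.symm.sub h₁.symm
  refine norm_apply_le_of_eigenvalues hA (by positivity) (fun μ v hv hμ ↦ ?_) x
  have hμ' : R₂ v - R₁ v = μ • v := hμ
  -- On an eigenvector of `R₂ - R₁` the difference of squares factors through the eigenvalue `μ`,
  -- and the cofactor is at least `c`.
  have e1 : ⟪R₂ (R₂ v) - R₁ (R₁ v), v⟫ = μ * (⟪R₂ v, v⟫ + ⟪R₁ v, v⟫) := by
    have : R₂ (R₂ v) - R₁ (R₁ v) = R₂ (R₂ v - R₁ v) + (R₂ (R₁ v) - R₁ (R₁ v)) := by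
      rw [map_sub]; abel
    have h3 : ⟪R₂ (R₁ v) - R₁ (R₁ v), v⟫ = ⟪R₁ v, R₂ v - R₁ v⟫ := hA (R₁ v) v
    rw [this, inner_add_left, h3, hμ', map_smul, inner_smul_left, inner_smul_right]
    simp; ring
  have e2 : |⟪R₂ (R₂ v) - R₁ (R₁ v), v⟫| ≤ K := by
    have := abs_real_inner_le_norm (R₂ (R₂ v) - R₁ (R₁ v)) v
    rw [hv, mul_one] at this
    refine this.trans ?_
    have := hS v
    rwa [hv, mul_one] at this
  have b1 := hb v
  rw [hv, one_pow, mul_one] at b1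
  have b2 := h₂.nonneg v
  rw [le_div_iff₀ hc]
  calc |μ| * c ≤ |μ| * (⟪R₂ v, v⟫ + ⟪R₁ v, v⟫) := by gcongr; linarith
    _ = |⟪R₂ (R₂ v) - R₁ (R₁ v), v⟫| := by
      rw [e1, abs_mul, abs_of_nonneg (a := ⟪R₂ v, v⟫ + ⟪R₁ v, v⟫) (by linarith)]
    _ ≤ K := e2

theorem sqrt_unique {R₁ R₂ : V →ₗ[ℝ] V} (h₁ : IsPosDefOp R₁) (h₂ : IsPosDefOp R₂)
    (hS : ∀ x, R₂ (R₂ x) = R₁ (R₁ x)) : R₂ = R₁ := by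
  obtain ⟨c, hc, hb⟩ := h₁.exists_bound
  ext x
  have := sqrt_lipschitz h₁ h₂ hc hb (le_refl 0) (fun x ↦ by simp [hS]) x
  rw [zero_div, zero_mul] at this
  exact sub_eq_zero.1 (norm_le_zero_iff.1 this)

theorem exists_sqrt {S : V →ₗ[ℝ] V} (h : IsPosDefOp S) :
    ∃ R : V →ₗ[ℝ] V, IsPosDefOp R ∧ ∀ x, R (R x) = S x := by
  let b := h.symm.eigenvectorBasis rfl
  let μ := h.symm.eigenvalues rfl
  have hb (i) : S (b i) = μ i • b i := h.symm.apply_eigenvectorBasis rfl i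
  have hμ (i) : 0 < μ i := by
    have h0 : b i ≠ 0 := b.orthonormal.ne_zero i
    have := h.pos _ h0
    rw [hb, inner_smul_left, real_inner_self_eq_norm_sq, b.norm_eq_one] at this
    simpa using this
  let R : V →ₗ[ℝ] V := b.toBasis.constr ℝ fun i ↦ Real.sqrt (μ i) • b i
  have hR (i) : R (b i) = Real.sqrt (μ i) • b i := by
    have := b.toBasis.constr_basis ℝ (fun i ↦ Real.sqrt (μ i) • b i) i
    rwa [b.coe_toBasis] at this
  have hRx (x : V) (i) : ⟪b i, R x⟫ = Real.sqrt (μ i) * ⟪b i, x⟫ := by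
    have hx : x = ∑ j, ⟪b j, x⟫ • b j := (b.sum_repr' x).symm
    conv_lhs => rw [hx]
    simp only [map_sum, map_smul, hR, inner_sum, inner_smul_right, b.inner_eq_ite]
    simp [mul_comm]
  have hsym (x y : V) : ⟪R x, y⟫ = ∑ i, Real.sqrt (μ i) * (⟪x, b i⟫ * ⟪b i, y⟫) := by
    rw [← b.sum_inner_mul_inner]
    refine Finset.sum_congr rfl fun i _ ↦ ?_
    rw [real_inner_comm, hRx, real_inner_comm x]; ring
  refine ⟨R, ⟨fun x y ↦ ?_, fun x hx ↦ ?_⟩, fun x ↦ ?_⟩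
  · rw [hsym, real_inner_comm, hsym]
    refine Finset.sum_congr rfl fun i _ ↦ ?_
    rw [real_inner_comm x, real_inner_comm (b i) y]; ring
  · rw [hsym]
    have h2 (i) : Real.sqrt (μ i) * (⟪x, b i⟫ * ⟪b i, x⟫) = Real.sqrt (μ i) * ⟪b i, x⟫ ^ 2 := by
      rw [real_inner_comm x]; ring
    simp only [h2]
    obtain ⟨i, hi⟩ : ∃ i, ⟪b i, x⟫ ≠ 0 := by
      by_contra! hcon
      refine hx ?_
      rw [← b.sum_repr' x]
      simp [hcon]
    refine Finset.sum_pos' (fun i _ ↦ by positivity) ⟨i, Finset.mem_univ i, ?_⟩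
    have := Real.sqrt_pos.2 (hμ i)
    positivity
  · have : R.comp R = S := b.toBasis.ext fun i ↦ by
      simp only [b.coe_toBasis, LinearMap.comp_apply, hR, map_smul, hb, smul_smul,
        Real.mul_self_sqrt (hμ i).le]
    exact congrArg (fun f : V →ₗ[ℝ] V ↦ f x) this

/-- The square root of a positive definite automorphism is an automorphism. -/
theorem sqrt_map_bilin {R S : V →ₗ[ℝ] V} (hR : IsPosDefOp R) (hRS : ∀ x, R (R x) = S x)
    (β : V →ₗ[ℝ] V →ₗ[ℝ] V) (hS : ∀ x y, S (β x y) = β (S x) (S y)) (x y : V) :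
    R (β x y) = β (R x) (R y) := by
  let b := hR.symm.eigenvectorBasis rfl
  let μ := hR.symm.eigenvalues rfl
  have hb (i) : R (b i) = μ i • b i := hR.symm.apply_eigenvectorBasis rfl i
  have hμ (i) : 0 < μ i := by
    have h0 : b i ≠ 0 := b.orthonormal.ne_zero i
    have := hR.pos _ h0
    rw [hb, inner_smul_left, real_inner_self_eq_norm_sq, b.norm_eq_one] at this
    simpa using this
  have key : β.compr₂ R = β.compl₁₂ R R := by
    refine LinearMap.ext_basis b.toBasis b.toBasis fun i j ↦ ?_
    simp only [LinearMap.compr₂_apply, LinearMap.compl₁₂_apply, b.coe_toBasis, hb, map_smul,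
      LinearMap.smul_apply, smul_smul]
    set z := β (b i) (b j)
    have h1 : R (R z) = (μ j * μ i) ^ 2 • z := by
      rw [hRS, hS, ← hRS, ← hRS, hb, hb]
      simp only [map_smul, hb, LinearMap.smul_apply, smul_smul]
      congr 1; ring
    have hp : 0 < μ j * μ i := mul_pos (hμ j) (hμ i)
    by_contra hne
    have hw : R z - (μ j * μ i) • z ≠ 0 := sub_ne_zero.2 hne
    have h2 := hR.pos _ hw
    -- As `R² z = (μ j μ i)² z`, the defect `R z - (μ j μ i) z` would be an eigenvector of `R` with
    -- a negative eigenvalue.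
    have h3 : R (R z - (μ j * μ i) • z) = -(μ j * μ i) • (R z - (μ j * μ i) • z) := by
      rw [map_sub, map_smul, h1]; module
    rw [h3, inner_smul_left, real_inner_self_eq_norm_sq] at h2
    have : 0 < ‖R z - (μ j * μ i) • z‖ ^ 2 := by positivity
    simp only [conj_trivial] at h2
    nlinarith
  exact congrArg (fun B : V →ₗ[ℝ] V →ₗ[ℝ] V ↦ B x y) key

end Sqrt

/-! ### Lie algebras with a Cartan involution, and automorphisms commuting with it -/

/-- A finite-dimensional real Lie algebra with a Cartan involution. -/
class CartanLieAlgebra (L : Type*) [LieRing L] [LieAlgebra ℝ L] where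
  θ : L →ₗ[ℝ] L
  θ_θ : ∀ x, θ (θ x) = x
  θ_lie : ∀ x y, θ ⁅x, y⁆ = ⁅θ x, θ y⁆
  pos : ∀ x, x ≠ 0 → 0 < -killingForm ℝ L x (θ x)

section Cartan
open CartanLieAlgebra

variable {L : Type*} [LieRing L] [LieAlgebra ℝ L] [CartanLieAlgebra L]

theorem killingForm_symm (x y : L) : killingForm ℝ L x y = killingForm ℝ L y x :=
  LieModule.traceForm_comm ℝ L L x y

theorem killingForm_lie (x y z : L) : killingForm ℝ L ⁅x, y⁆ z = killingForm ℝ L x ⁅y, z⁆ :=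
  LieModule.traceForm_apply_lie_apply ℝ L L x y z

theorem killingForm_aut (T : L ≃ₗ[ℝ] L) (hT : ∀ x y, T ⁅x, y⁆ = ⁅T x, T y⁆) (x y : L) :
    killingForm ℝ L (T x) (T y) = killingForm ℝ L x y :=
  LieAlgebra.killingForm_of_equiv_apply (R := ℝ) (L := L) (L' := L)
    { T with map_lie' := fun {x y} ↦ hT x y } x y

variable (L) in
/-- `θ` as a linear automorphism. -/
def thetaEquiv : L ≃ₗ[ℝ] L := LinearEquiv.ofInvolutive θ θ_θ

theorem killingForm_theta (x y : L) : killingForm ℝ L (θ x) (θ y) = killingForm ℝ L x y :=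
  killingForm_aut (thetaEquiv L) θ_lie x y

variable (L) in
/-- The inner product `⟨x, y⟩ = -B(x, θ y)`. -/
@[reducible] def cartanCore : InnerProductSpace.Core ℝ L where
  inner x y := -killingForm ℝ L x (θ y)
  conj_inner_symm x y := by
    have := killingForm_theta x (θ y)
    rw [θ_θ, killingForm_symm] at this
    simp [this]
  re_inner_nonneg x := by
    by_cases hx : x = 0
    · simp [hx]
    · exact (pos x hx).le
  add_left x y z := by simp; ring
  smul_left x y r := by simp
  definite x h := by
    by_contra hx
    exact (pos x hx).ne' h

instance cartanNormedAddCommGroup : NormedAddCommGroup L :=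
  @InnerProductSpace.Core.toNormedAddCommGroup ℝ L _ _ _ (cartanCore L)

instance cartanInnerProductSpace : InnerProductSpace ℝ L :=
  InnerProductSpace.ofCore (cartanCore L).toCore

theorem cartan_inner (x y : L) : inner ℝ x y = -killingForm ℝ L x (θ y) := rfl

theorem inner_theta (x y : L) : inner ℝ (θ x) y = inner ℝ x (θ y) := by
  rw [cartan_inner, cartan_inner, θ_θ, ← killingForm_theta x, ← killingForm_theta]

/-- By invariance of the Killing form, the adjoint of `ad z` is `-ad (θ z)`. Hence `ad` is skew on
`𝔨` and symmetric on `𝔭`, the source of all semisimplicity statements about `ad` below. -/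
theorem inner_lie (z x y : L) : inner ℝ ⁅z, x⁆ y = -inner ℝ x ⁅θ z, y⁆ := by
  rw [cartan_inner, cartan_inner, θ_lie, θ_θ, ← lie_skew, map_neg, LinearMap.neg_apply,
    killingForm_lie]

variable (L) in
-- Definiteness gives nondegeneracy, and with it the fact that every derivation is inner.
theorem isKilling_of_cartan : LieAlgebra.IsKilling ℝ L := by
  constructor
  rw [eq_bot_iff]
  intro x hx
  by_contra hne
  have hne' : x ≠ 0 := fun h ↦ hne (by simp [h])
  rw [LieIdeal.mem_killingCompl] at hx
  have h1 := pos x hne'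
  have h2 := hx (θ x) trivial
  rw [killingForm_symm] at h2
  simp [h2] at h1

variable [FiniteDimensional ℝ L]

instance cartanComplete : CompleteSpace L := FiniteDimensional.complete ℝ L

variable (L) in
/-- The bracket as a continuous bilinear map. -/
def bracketCLM : L →L[ℝ] L →L[ℝ] L :=
  LinearMap.toContinuousLinearMap
    ((LinearMap.toContinuousLinearMap (𝕜 := ℝ) (E := L) (F' := L)).toLinearMap ∘ₗ
      (LieAlgebra.ad ℝ L : L →ₗ[ℝ] Module.End ℝ L))

@[simp] theorem bracketCLM_apply (x y : L) : bracketCLM L x y = ⁅x, y⁆ := rfl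

variable (L) in
/-- `θ` as a continuous linear map. -/
def thetaCLM : L →L[ℝ] L := LinearMap.toContinuousLinearMap θ

/-- Automorphisms of the Lie algebra that commute with `θ`. -/
structure IsKAut (T : L →L[ℝ] L) : Prop where
  isUnit : IsUnit T
  map_lie : ∀ x y, T ⁅x, y⁆ = ⁅T x, T y⁆
  comm : ∀ x, T (θ x) = θ (T x)

theorem bijective_of_isUnit {T : L →L[ℝ] L} (h : IsUnit T) : Function.Bijective T := by
  obtain ⟨u, rfl⟩ := h
  refine ⟨Function.LeftInverse.injective (g := (↑u⁻¹ : L →L[ℝ] L)) fun x ↦ ?_,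
    Function.RightInverse.surjective (g := (↑u⁻¹ : L →L[ℝ] L)) fun x ↦ ?_⟩
  · exact congrArg (fun f : L →L[ℝ] L ↦ f x) u.inv_mul
  · exact congrArg (fun f : L →L[ℝ] L ↦ f x) u.mul_inv

theorem isUnit_of_injective {T : L →L[ℝ] L} (h : Function.Injective T) : IsUnit T := by
  let e := LinearEquiv.ofInjectiveEndo (T : L →ₗ[ℝ] L) h
  refine ⟨⟨T, LinearMap.toContinuousLinearMap (e.symm : L →ₗ[ℝ] L), ?_, ?_⟩, rfl⟩
  · ext x; exact e.apply_symm_apply x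
  · ext x; exact e.symm_apply_apply x

theorem killingForm_of_isUnit {T : L →L[ℝ] L} (h : IsUnit T)
    (hT : ∀ x y, T ⁅x, y⁆ = ⁅T x, T y⁆) (x y : L) :
    killingForm ℝ L (T x) (T y) = killingForm ℝ L x y :=
  killingForm_aut (LinearEquiv.ofInjectiveEndo (T : L →ₗ[ℝ] L) (bijective_of_isUnit h).1) hT x y

theorem IsKAut.inner_map {T : L →L[ℝ] L} (h : IsKAut T) (x y : L) :
    inner ℝ (T x) (T y) = inner ℝ x y := by
  rw [cartan_inner, cartan_inner, ← h.comm, killingForm_of_isUnit h.isUnit h.map_lie]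

theorem IsKAut.one : IsKAut (1 : L →L[ℝ] L) := ⟨isUnit_one, fun _ _ ↦ rfl, fun _ ↦ rfl⟩

theorem IsKAut.mul {S T : L →L[ℝ] L} (hS : IsKAut S) (hT : IsKAut T) : IsKAut (S * T) where
  isUnit := hS.isUnit.mul hT.isUnit
  map_lie x y := by
    change S (T ⁅x, y⁆) = ⁅S (T x), S (T y)⁆
    rw [hT.map_lie, hS.map_lie]
  comm x := by
    change S (T (θ x)) = θ (S (T x))
    rw [hT.comm, hS.comm]

theorem IsKAut.of_mul {S T : L →L[ℝ] L} (hS : IsKAut S) (hST : IsKAut (S * T)) : IsKAut T where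
  isUnit := by
    have := hS.isUnit.unit⁻¹.isUnit.mul hST.isUnit
    rwa [← mul_assoc, IsUnit.val_inv_mul, one_mul] at this
  map_lie x y := by
    apply (bijective_of_isUnit hS.isUnit).1
    rw [hS.map_lie]
    exact hST.map_lie x y
  comm x := by
    apply (bijective_of_isUnit hS.isUnit).1
    rw [hS.comm]
    exact hST.comm x

/-- Fixed vectors of isometries split off. -/
theorem IsKAut.fixed_of_sq {T : L →L[ℝ] L} (h : IsKAut T) (x : L)
    (hx : T (T x - x) = T x - x) : T x = x := by
  have h1 : inner ℝ (T x - x) (T x - x) = 0 := by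
    nth_rewrite 1 [inner_sub_left]
    nth_rewrite 1 [← hx]
    rw [h.inner_map, sub_self]
  exact sub_eq_zero.1 (inner_self_eq_zero.1 h1)

open NormedSpace

theorem isKAut_exp {Y : L} (hY : θ Y = Y) : IsKAut (exp (bracketCLM L Y)) where
  isUnit := ⟨⟨_, _, exp_mul_exp_neg _, exp_neg_mul_exp _⟩, rfl⟩
  map_lie x y := exp_map_of_derivation (bracketCLM L) (D := bracketCLM L Y)
    (fun x y ↦ by simp) x y
  comm x := by
    have hc : Commute (bracketCLM L Y) (thetaCLM L) := by
      ext z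
      change ⁅Y, θ z⁆ = θ ⁅Y, z⁆
      rw [θ_lie, hY]
    have := hc.exp_left
    exact congrArg (fun f : L →L[ℝ] L ↦ f x) this.eq

theorem norm_theta (x : L) : ‖θ x‖ = ‖x‖ := by
  have : ‖θ x‖ ^ 2 = ‖x‖ ^ 2 := by
    rw [← real_inner_self_eq_norm_sq, inner_theta, θ_θ, real_inner_self_eq_norm_sq]
  exact (pow_left_inj₀ (norm_nonneg _) (norm_nonneg _) two_ne_zero).1 this

/-- An automorphism near `1` that commutes with `θ` is `exp (ad Y)` with `Y ∈ 𝔨`. -/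
theorem eventually_exists_exp : ∀ᶠ T in 𝓝 (1 : L →L[ℝ] L), IsKAut T →
    ∃ Y : L, θ Y = Y ∧ T = exp (bracketCLM L Y) := by
  obtain ⟨ε₁, hε₁, hder⟩ := exists_derivation_small (bracketCLM L)
  obtain ⟨ε₂, hε₂, hinj⟩ := exp_injOn_ball (L →L[ℝ] L)
  filter_upwards [exp_image_ball_mem_nhds (A := L →L[ℝ] L) (lt_min hε₁ hε₂)] with T hT hK
  obtain ⟨D, hD, rfl⟩ := hT
  rw [mem_ball_zero_iff, lt_min_iff] at hD
  have hd := hder D hD.1 hK.map_lie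
  -- `θ` is an isometry, so `θ D θ` is as small as `D`. It has the same exponential, and `exp` is
  -- injective on small operators.
  have hDθ (x : L) : θ (D (θ x)) = D x := by
    have hΘ : thetaCLM L * thetaCLM L = 1 := by ext x; exact θ_θ x
    let u : (L →L[ℝ] L)ˣ := ⟨thetaCLM L, thetaCLM L, hΘ, hΘ⟩
    let _ : NormedAlgebra ℚ (L →L[ℝ] L) := NormedAlgebra.restrictScalars ℚ ℝ _
    have h1 := exp_units_conj u D
    have h2 : exp ((u : L →L[ℝ] L) * D * (↑u⁻¹ : L →L[ℝ] L)) = exp D := by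
      rw [h1]
      ext x
      change θ (exp D (θ x)) = exp D x
      rw [hK.comm, θ_θ]
    have h3 : ‖(u : L →L[ℝ] L) * D * (↑u⁻¹ : L →L[ℝ] L)‖ ≤ ‖D‖ := by
      refine ContinuousLinearMap.opNorm_le_bound _ (norm_nonneg _) fun x ↦ ?_
      change ‖θ (D (θ x))‖ ≤ _
      rw [norm_theta]
      refine (D.le_opNorm _).trans (by rw [norm_theta])
    have h4 := hinj (mem_ball_zero_iff.2 (h3.trans_lt hD.2)) (mem_ball_zero_iff.2 hD.2) h2
    exact congrArg (fun f : L →L[ℝ] L ↦ f x) h4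
  have := isKilling_of_cartan L
  let 𝒟 : LieDerivation ℝ L L :=
    { toLinearMap := (D : L →ₗ[ℝ] L)
      leibniz' := fun x y ↦ by
        have := hd x y
        simp only [bracketCLM_apply] at this
        change D ⁅x, y⁆ = ⁅x, D y⁆ - ⁅y, D x⁆
        rw [this, ← lie_skew (D x) y]; abel }
  have hmem : 𝒟 ∈ (LieDerivation.ad ℝ L).range := by
    rw [LieDerivation.IsKilling.range_ad_eq_top]; trivial
  obtain ⟨Y, hY⟩ := hmem
  have hY' (x : L) : ⁅Y, x⁆ = D x := by
    have := congrArg (fun f : LieDerivation ℝ L L ↦ f x) hY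
    simp at this
    exact this
  refine ⟨Y, ?_, ?_⟩
  · have hz : ∀ x : L, ⁅θ Y - Y, x⁆ = 0 := fun x ↦ by
      rw [sub_lie, hY', ← hDθ, ← hY', θ_lie, θ_θ, sub_self]
    have h0 : killingForm ℝ L (θ Y - Y) = 0 := by
      ext z
      rw [killingForm_apply_apply]
      have : LieAlgebra.ad ℝ L (θ Y - Y) = 0 := by ext x; exact hz x
      simp [this]
    by_contra hne
    have := pos (θ Y - Y) (sub_ne_zero.2 hne)
    simp [h0] at this
  · congr 1
    ext x
    exact (hY' x).symm

end Cartan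

/-! ### Polar decomposition of automorphisms and analytic paths to the identity -/

section Polar
open CartanLieAlgebra NormedSpace

variable {L : Type*} [LieRing L] [LieAlgebra ℝ L] [CartanLieAlgebra L] [FiniteDimensional ℝ L]

/-- An automorphism preserves the Killing form, so its adjoint is `θ T⁻¹ θ`; the inverse is avoided
by evaluating at `θ (T x)`. -/
theorem adjoint_theta_apply {T : L →L[ℝ] L} (h : IsUnit T)
    (hT : ∀ x y, T ⁅x, y⁆ = ⁅T x, T y⁆) (x : L) :
    ContinuousLinearMap.adjoint T (θ (T x)) = θ x := by
  refine ext_inner_right ℝ fun y ↦ ?_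
  rw [ContinuousLinearMap.adjoint_inner_left, cartan_inner, cartan_inner, killingForm_theta,
    killingForm_theta, killingForm_of_isUnit h hT]

theorem theta_adjoint_apply {T : L →L[ℝ] L} (h : IsUnit T)
    (hT : ∀ x y, T ⁅x, y⁆ = ⁅T x, T y⁆) (x : L) :
    T (θ (ContinuousLinearMap.adjoint T x)) = θ x := by
  obtain ⟨y, hy⟩ := (bijective_of_isUnit h).2 (θ x)
  have hx : x = θ (T y) := by rw [hy, θ_θ]
  rw [hx, adjoint_theta_apply h hT, θ_θ, θ_θ]

/-- The positive part in the polar decomposition of an automorphism. -/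
structure IsPolar (T R : L →L[ℝ] L) : Prop where
  posDef : IsPosDefOp (R : L →ₗ[ℝ] L)
  sq : ∀ x, R (R x) = ContinuousLinearMap.adjoint T (T x)

theorem exists_isPolar {T : L →L[ℝ] L} (h : IsUnit T) : ∃ R, IsPolar T R := by
  have hS : IsPosDefOp ((ContinuousLinearMap.adjoint T * T : L →L[ℝ] L) : L →ₗ[ℝ] L) := by
    refine ⟨fun x y ↦ ?_, fun x hx ↦ ?_⟩
    · change inner ℝ (ContinuousLinearMap.adjoint T (T x)) y =
        inner ℝ x (ContinuousLinearMap.adjoint T (T y))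
      rw [ContinuousLinearMap.adjoint_inner_left, ContinuousLinearMap.adjoint_inner_right]
    · change 0 < inner ℝ (ContinuousLinearMap.adjoint T (T x)) x
      rw [ContinuousLinearMap.adjoint_inner_left]
      refine real_inner_self_pos.2 fun h0 ↦ hx ?_
      exact (bijective_of_isUnit h).1 (by rw [h0, map_zero])
  obtain ⟨R, hR, hsq⟩ := exists_sqrt hS
  exact ⟨LinearMap.toContinuousLinearMap R, hR, hsq⟩

theorem IsPolar.isUnit {T R : L →L[ℝ] L} (h : IsPolar T R) : IsUnit R :=
  isUnit_of_injective h.posDef.injective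

/-- The adjoint of `T` is again an automorphism, hence so is `T* T`, and its square root inherits
this by `sqrt_map_bilin`. -/
theorem IsPolar.map_lie {T R : L →L[ℝ] L} (h : IsPolar T R) (hu : IsUnit T)
    (hT : ∀ x y, T ⁅x, y⁆ = ⁅T x, T y⁆) (x y : L) : R ⁅x, y⁆ = ⁅R x, R y⁆ := by
  have hadj (u v : L) : ContinuousLinearMap.adjoint T ⁅u, v⁆ =
      ⁅ContinuousLinearMap.adjoint T u, ContinuousLinearMap.adjoint T v⁆ := by
    obtain ⟨a, ha⟩ := (bijective_of_isUnit hu).2 (θ u)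
    obtain ⟨b, hb⟩ := (bijective_of_isUnit hu).2 (θ v)
    have hu' : u = θ (T a) := by rw [ha, θ_θ]
    have hv' : v = θ (T b) := by rw [hb, θ_θ]
    rw [hu', hv', ← θ_lie, ← hT, adjoint_theta_apply hu hT, adjoint_theta_apply hu hT,
      adjoint_theta_apply hu hT, θ_lie]
  exact sqrt_map_bilin (S := ((ContinuousLinearMap.adjoint T * T : L →L[ℝ] L) : L →ₗ[ℝ] L))
    h.posDef h.sq (LieAlgebra.ad ℝ L : L →ₗ[ℝ] Module.End ℝ L) (fun x y ↦ by
      change ContinuousLinearMap.adjoint T (T ⁅x, y⁆) =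
        ⁅ContinuousLinearMap.adjoint T (T x), ContinuousLinearMap.adjoint T (T y)⁆
      rw [hT, hadj]) x y

/-- The positive operators `θ R⁻¹ θ` and `R` have the same square `T* T`, because `T* = θ T⁻¹ θ`.
They coincide by uniqueness of the root. -/
theorem IsPolar.theta {T R : L →L[ℝ] L} (h : IsPolar T R) (hu : IsUnit T)
    (hT : ∀ x y, T ⁅x, y⁆ = ⁅T x, T y⁆) (x : L) : R (θ (R x)) = θ x := by
  let e := LinearEquiv.ofInjectiveEndo (R : L →ₗ[ℝ] L) h.posDef.injective
  have he (x : L) : R (e.symm x) = x := e.apply_symm_apply x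
  have he' (x : L) : e.symm (R x) = x := e.symm_apply_apply x
  let R' : L →ₗ[ℝ] L := θ ∘ₗ (e.symm : L →ₗ[ℝ] L) ∘ₗ θ
  have hR' : IsPosDefOp R' := by
    have hs (x y : L) : inner ℝ (e.symm x) y = inner ℝ x (e.symm y) := by
      have := h.posDef.symm (e.symm x) (e.symm y)
      simp only [ContinuousLinearMap.coe_coe, he] at this
      exact this.symm
    refine ⟨fun x y ↦ ?_, fun x hx ↦ ?_⟩
    · change inner ℝ (θ (e.symm (θ x))) y = inner ℝ x (θ (e.symm (θ y)))
      rw [inner_theta, hs, inner_theta]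
    · change 0 < inner ℝ (θ (e.symm (θ x))) x
      rw [inner_theta]
      have hne : e.symm (θ x) ≠ 0 := fun h0 ↦ hx (by
        have h1 := congrArg R h0
        rw [he, map_zero] at h1
        rw [← θ_θ x, h1, map_zero])
      have := h.posDef.pos _ hne
      simp only [ContinuousLinearMap.coe_coe, he] at this
      rwa [real_inner_comm]
  have hsq (x : L) : R' (R' x) = (R : L →ₗ[ℝ] L) ((R : L →ₗ[ℝ] L) x) := by
    have e1 : R' (R' x) = θ (e.symm (e.symm (θ x))) := by
      simp [R', θ_θ]
    rw [e1, ContinuousLinearMap.coe_coe, h.sq]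
    have e2 : θ x = R (R (θ (ContinuousLinearMap.adjoint T (T x)))) := by
      rw [h.sq, theta_adjoint_apply hu hT, adjoint_theta_apply hu hT]
    rw [e2, he', he', θ_θ]
  have hRR := sqrt_unique h.posDef hR' hsq
  have h1 : θ (e.symm (θ (R x))) = R (R x) := congrArg (fun f : L →ₗ[ℝ] L ↦ f (R x)) hRR
  have h2 : θ (e.symm (θ (θ (R (θ x))))) = R (θ (R (θ x))) :=
    congrArg (fun f : L →ₗ[ℝ] L ↦ f (θ (R (θ x)))) hRR
  rw [θ_θ, he', θ_θ] at h2
  have h3 : θ (e.symm (θ (θ (R x)))) = R (θ (R x)) :=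
    congrArg (fun f : L →ₗ[ℝ] L ↦ f (θ (R x))) hRR
  rwa [θ_θ, he', eq_comm] at h3

/-- The compact part in the polar decomposition of an automorphism. -/
theorem IsPolar.isKAut {T R : L →L[ℝ] L} (h : IsPolar T R) (hu : IsUnit T)
    (hT : ∀ x y, T ⁅x, y⁆ = ⁅T x, T y⁆) : IsKAut (T * Ring.inverse R) := by
  have hinv (x : L) : Ring.inverse R (R x) = x :=
    congrArg (fun f : L →L[ℝ] L ↦ f x) (Ring.inverse_mul_cancel R h.isUnit)
  have hU (x : L) : (T * Ring.inverse R) (R x) = T x := congrArg T (hinv x)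
  have hsurj := (bijective_of_isUnit h.isUnit).2
  refine ⟨hu.mul h.isUnit.ringInverse, fun x y ↦ ?_, fun x ↦ ?_⟩
  · obtain ⟨a, rfl⟩ := hsurj x
    obtain ⟨b, rfl⟩ := hsurj y
    rw [← h.map_lie hu hT, hU, hU, hU, hT]
  · obtain ⟨y, rfl⟩ := hsurj x
    obtain ⟨z, hz⟩ := hsurj (θ (R y))
    rw [← hz, hU, hU]
    obtain ⟨w, hw⟩ := hsurj z
    have h1 : R (R w) = θ (R y) := by rw [hw, hz]
    have h2 : R z = θ (R y) := hz
    have h3 : R (θ (R z)) = θ z := h.theta hu hT z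
    rw [h2, θ_θ, h.sq] at h3
    have h4 : T (θ (ContinuousLinearMap.adjoint T (T y))) = θ (T y) :=
      theta_adjoint_apply hu hT (T y)
    rw [h3, θ_θ] at h4
    exact h4

theorem IsPolar.eq_one {T R : L →L[ℝ] L} (h : IsPolar T R) (hT : IsKAut T) : R = 1 := by
  have h1 : IsPosDefOp ((1 : L →L[ℝ] L) : L →ₗ[ℝ] L) :=
    ⟨fun x y ↦ rfl, fun x hx ↦ real_inner_self_pos.2 hx⟩
  have := sqrt_unique h1 h.posDef fun x ↦ by
    change R (R x) = x
    rw [h.sq]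
    refine ext_inner_right ℝ fun y ↦ ?_
    rw [ContinuousLinearMap.adjoint_inner_left, hT.inner_map]
  exact ContinuousLinearMap.coe_injective this

/-- The square root is Lipschitz at `T(g₀)* T(g₀)`, with constant controlled by the lower bound `c`
of `R g₀`. -/
theorem continuous_polar {X : Type*} [TopologicalSpace X] {T R : X → L →L[ℝ] L}
    (hT : Continuous T) (h : ∀ g, IsPolar (T g) (R g)) : Continuous R := by
  rw [continuous_iff_continuousAt]
  intro g₀
  obtain ⟨c, hc, hb⟩ := (h g₀).posDef.exists_bound
  have hS : Continuous (fun g ↦ ContinuousLinearMap.adjoint (T g) * T g) :=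
    (ContinuousLinearMap.adjoint.continuous.comp hT).mul hT
  have hle (g : X) : ‖R g - R g₀‖ ≤ ‖ContinuousLinearMap.adjoint (T g) * T g -
      ContinuousLinearMap.adjoint (T g₀) * T g₀‖ / c := by
    refine ContinuousLinearMap.opNorm_le_bound _ (by positivity) fun x ↦ ?_
    refine sqrt_lipschitz (h g₀).posDef (h g).posDef hc hb (norm_nonneg _) (fun x ↦ ?_) x
    simp only [ContinuousLinearMap.coe_coe]
    rw [(h g).sq, (h g₀).sq]
    exact (ContinuousLinearMap.adjoint (T g) * T g -
      ContinuousLinearMap.adjoint (T g₀) * T g₀).le_opNorm x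
  rw [ContinuousAt, tendsto_iff_norm_sub_tendsto_zero]
  refine squeeze_zero (fun _ ↦ norm_nonneg _) hle ?_
  have h0 : Tendsto (fun g ↦ ‖ContinuousLinearMap.adjoint (T g) * T g -
      ContinuousLinearMap.adjoint (T g₀) * T g₀‖) (𝓝 g₀) (𝓝 0) :=
    tendsto_iff_norm_sub_tendsto_zero.1 hS.continuousAt
  simpa using h0.div_const c

/-- Automorphisms joined to `1` by an analytic path of automorphisms commuting with `θ`. -/
def IsGood (T : L →L[ℝ] L) : Prop :=
  ∃ P : ℝ → L →L[ℝ] L, AnalyticOnNhd ℝ P univ ∧ P 0 = 1 ∧ P 1 = T ∧ ∀ t, IsKAut (P t)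

theorem IsGood.one : IsGood (1 : L →L[ℝ] L) :=
  ⟨fun _ ↦ 1, analyticOnNhd_const, rfl, rfl, fun _ ↦ IsKAut.one⟩

theorem IsGood.mul {S T : L →L[ℝ] L} (hS : IsGood S) (hT : IsGood T) : IsGood (S * T) := by
  obtain ⟨P, hP, hP0, hP1, hPa⟩ := hS
  obtain ⟨Q, hQ, hQ0, hQ1, hQa⟩ := hT
  exact ⟨fun t ↦ P t * Q t, hP.mul hQ, by simp [hP0, hQ0], by simp [hP1, hQ1],
    fun t ↦ (hPa t).mul (hQa t)⟩

theorem IsGood.exp {Y : L} (hY : θ Y = Y) : IsGood (exp (bracketCLM L Y)) := by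
  refine ⟨fun t ↦ NormedSpace.exp (bracketCLM L (t • Y)), ?_, ?_, ?_, fun t ↦ isKAut_exp ?_⟩
  · have h1 : AnalyticOnNhd ℝ (fun t : ℝ ↦ bracketCLM L (t • Y)) univ :=
      fun t _ ↦ (bracketCLM L).analyticAt _ |>.comp
        ((ContinuousLinearMap.smulRight (1 : ℝ →L[ℝ] ℝ) Y).analyticAt t)
    exact fun t ht ↦ (NormedSpace.exp_analytic (𝕂 := ℝ) _).comp (h1 t ht)
  · simp
  · simp
  · rw [map_smul, hY]

/-- In a connected family of automorphisms, those commuting with `θ` are products of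
exponentials of elements of `𝔨`. -/
theorem isGood_of_connected {X : Type*} [TopologicalSpace X] [PreconnectedSpace X]
    {T : X → L →L[ℝ] L} (hT : Continuous T) (hu : ∀ g, IsUnit (T g))
    (hl : ∀ g x y, T g ⁅x, y⁆ = ⁅T g x, T g y⁆) {g₀ g₁ : X} (h0 : T g₀ = 1)
    (h1 : IsKAut (T g₁)) : IsGood (T g₁) := by
  choose R hR using fun g ↦ exists_isPolar (hu g)
  have hRc := continuous_polar hT hR
  -- The compact part `U` commutes with `θ` at every parameter, including those where `T` does not.
  -- The connectedness argument therefore runs on `U`, not on `T`.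
  let U : X → L →L[ℝ] L := fun g ↦ T g * Ring.inverse (R g)
  have hUK (g : X) : IsKAut (U g) := (hR g).isKAut (hu g) (hl g)
  have hUc : Continuous U := by
    refine hT.mul (continuous_iff_continuousAt.2 fun g ↦ ?_)
    obtain ⟨u, hu⟩ := (hR g).isUnit
    have := NormedRing.inverse_continuousAt u
    rw [hu] at this
    exact ContinuousAt.comp (f := R) (g := Ring.inverse) (x := g) this hRc.continuousAt
  have hloc (g : X) : ∀ᶠ g' in 𝓝 g, ∃ Y : L, θ Y = Y ∧
      U g' = U g * exp (bracketCLM L Y) := by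
    obtain ⟨u, hu⟩ := (hUK g).isUnit
    have hc : ContinuousAt (fun g' ↦ (↑u⁻¹ : L →L[ℝ] L) * U g') g :=
      (continuous_const.mul hUc).continuousAt
    have h1' : (↑u⁻¹ : L →L[ℝ] L) * U g = 1 := by rw [← hu]; simp
    rw [ContinuousAt, h1'] at hc
    filter_upwards [hc.eventually eventually_exists_exp] with g' hg'
    have h2 : U g' = U g * ((↑u⁻¹ : L →L[ℝ] L) * U g') := by rw [← hu]; simp
    obtain ⟨Y, hY, he⟩ := hg' ((hUK g).of_mul (h2 ▸ hUK g'))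
    exact ⟨Y, hY, by rw [h2, he]⟩
  have hclopen : IsClopen {g | IsGood (U g)} := by
    refine ⟨⟨isOpen_iff_mem_nhds.2 fun g hg ↦ ?_⟩, isOpen_iff_mem_nhds.2 fun g hg ↦ ?_⟩
    · filter_upwards [hloc g] with g' ⟨Y, hY, he⟩ hg'
      refine hg ?_
      have h3 : U g = U g' * exp (bracketCLM L (-Y)) := by
        rw [he, mul_assoc, map_neg, exp_mul_exp_neg, mul_one]
      change IsGood (U g)
      rw [h3]
      exact IsGood.mul hg' (IsGood.exp (by rw [map_neg, hY]))
    · filter_upwards [hloc g] with g' ⟨Y, hY, he⟩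
      change IsGood (U g')
      rw [he]
      exact IsGood.mul hg (IsGood.exp hY)
  -- Where `T g` already commutes with `θ` it is an isometry, its positive part is `1`, and `U g = T
  -- g`.
  have hUeq {g : X} (h : IsKAut (T g)) : U g = T g := by
    change T g * Ring.inverse (R g) = T g
    rw [(hR g).eq_one h, Ring.inverse_one, mul_one]
  have hne : g₀ ∈ {g | IsGood (U g)} := by
    change IsGood (U g₀)
    rw [hUeq (by rw [h0]; exact IsKAut.one), h0]
    exact IsGood.one
  have huniv := hclopen.eq_univ ⟨g₀, hne⟩
  have : g₁ ∈ {g | IsGood (U g)} := by rw [huniv]; trivial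
  rw [← hUeq h1]
  exact this

variable (L) in
/-- The projection onto `𝔨`. -/
def kProj : L →L[ℝ] L := (1 / 2 : ℝ) • (1 + thetaCLM L)

theorem kProj_apply (x : L) : kProj L x = (1 / 2 : ℝ) • (x + θ x) := rfl

theorem theta_kProj (x : L) : θ (kProj L x) = kProj L x := by
  rw [kProj_apply, map_smul, map_add, θ_θ, add_comm]

theorem kProj_of_fixed {x : L} (h : θ x = x) : kProj L x = x := by
  rw [kProj_apply, h, ← two_smul ℝ x, smul_smul]; norm_num

/-- The fixed vectors of `T` in `𝔨`. -/
def kFixed (T : L →L[ℝ] L) : Submodule ℝ L :=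
  LinearMap.ker ((T : L →ₗ[ℝ] L) - 1) ⊓ LinearMap.ker ((θ : L →ₗ[ℝ] L) - 1)

theorem mem_kFixed {T : L →L[ℝ] L} {x : L} : x ∈ kFixed T ↔ T x = x ∧ θ x = x := by
  simp [kFixed, sub_eq_zero]

/-- The operator `T - 1` on `𝔨`, extended by the identity on `𝔭`. -/
def kDefect (T : L →L[ℝ] L) : L →L[ℝ] L := (T - 1) * kProj L + (1 - kProj L)

theorem kDefect_apply (T : L →L[ℝ] L) (x : L) :
    kDefect T x = T (kProj L x) - kProj L x + (x - kProj L x) := rfl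

/-- `T` preserves `𝔨`, so the two summands of `kDefect T x` are its components in `𝔨` and in `𝔭`. -/
theorem kDefect_eq {T : L →L[ℝ] L} (h : IsKAut T) {x z : L} (hx : kDefect T x = z) :
    T (kProj L x) - kProj L x = kProj L z ∧ x - kProj L x = z - kProj L z := by
  have h1 : kProj L z = T (kProj L x) - kProj L x := by
    rw [← hx, kDefect_apply, map_add]
    have a1 : kProj L (T (kProj L x) - kProj L x) = T (kProj L x) - kProj L x :=
      kProj_of_fixed (by rw [map_sub, ← h.comm, theta_kProj])
    have a2 : kProj L (x - kProj L x) = 0 := by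
      rw [map_sub, kProj_of_fixed (theta_kProj x), sub_self]
    rw [a1, a2, add_zero]
  refine ⟨h1.symm, ?_⟩
  rw [h1, ← hx, kDefect_apply]; abel

/-- The operator is injective on `𝔭`. The fixed space in `𝔨` thus becomes the kernel of an operator
on the whole Lie algebra, depending affinely on `T`. -/
theorem ker_kDefect {T : L →L[ℝ] L} (h : IsKAut T) :
    LinearMap.ker (kDefect T : L →ₗ[ℝ] L) = kFixed T := by
  ext x
  rw [LinearMap.mem_ker, mem_kFixed, ContinuousLinearMap.coe_coe]
  constructor
  · intro hx
    obtain ⟨h1, h2⟩ := kDefect_eq h hx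
    rw [map_zero, sub_zero] at h2
    rw [map_zero] at h1
    have h3 : kProj L x = x := (sub_eq_zero.1 h2).symm
    rw [h3] at h1
    exact ⟨sub_eq_zero.1 h1, by rw [← h3, theta_kProj]⟩
  · rintro ⟨h1, h2⟩
    rw [kDefect_apply, kProj_of_fixed h2, h1]; simp

/-- An isometry has no Jordan block at the eigenvalue `1`; this supplies the hypothesis of
`finrank_ker_eq_natTrailingDegree`. -/
theorem kDefect_sq {T : L →L[ℝ] L} (h : IsKAut T) (x : L) (hx : kDefect T (kDefect T x) = 0) :
    kDefect T x = 0 := by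
  have hz : kDefect T x ∈ LinearMap.ker (kDefect T : L →ₗ[ℝ] L) := hx
  rw [ker_kDefect h, mem_kFixed] at hz
  obtain ⟨h1, h2⟩ := kDefect_eq h (rfl : kDefect T x = kDefect T x)
  rw [kProj_of_fixed hz.2, sub_self] at h2
  rw [kProj_of_fixed hz.2] at h1
  have h3 := h.fixed_of_sq (kProj L x) (by rw [h1]; exact hz.1)
  rw [← h1, h3, sub_self]

/-- Elements of the identity component have at least as many fixed vectors in `𝔨` as the
rank of `𝔨`. -/
theorem IsGood.le_finrank_kFixed {T : L →L[ℝ] L} (hT : IsGood T) {r : ℕ}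
    (hr : ∀ Y : L, θ Y = Y → r ≤ Module.finrank ℝ
      (LinearMap.ker (LieAlgebra.ad ℝ L Y) ⊓ LinearMap.ker ((θ : L →ₗ[ℝ] L) - 1) :
        Submodule ℝ L)) : r ≤ Module.finrank ℝ (kFixed T) := by
  obtain ⟨P, hP, hP0, hP1, hPa⟩ := hT
  have heq (t : ℝ) : Module.finrank ℝ (kFixed (P t)) =
      (LinearMap.charpoly (kDefect (P t) : L →ₗ[ℝ] L)).natTrailingDegree := by
    rw [← ker_kDefect (hPa t)]
    exact finrank_ker_eq_natTrailingDegree _ (kDefect_sq (hPa t))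
  have hd : AnalyticOnNhd ℝ (fun t ↦ kDefect (P t)) univ :=
    ((hP.sub analyticOnNhd_const).mul analyticOnNhd_const).add analyticOnNhd_const
  have key := le_natTrailingDegree_of_analytic (ContinuousLinearMap.coeLM ℝ : (L →L[ℝ] L) →ₗ[ℝ] _)
    (fun t ↦ kDefect (P t)) (fun f t ht ↦
      ((LinearMap.toContinuousLinearMap f).analyticAt _).comp (hd t ht)) r (by
      have hc : Tendsto P (𝓝 0) (𝓝 1) := by
        rw [← hP0]; exact (hP 0 trivial).continuousAt
      -- Near `t = 0` the path consists of `exp (ad Y)` with `Y ∈ 𝔨`, which fixes the centralizer of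
      -- `Y` in `𝔨`.
      filter_upwards [hc.eventually eventually_exists_exp] with t ht
      obtain ⟨Y, hY, he⟩ := ht (hPa t)
      refine (hr Y hY).trans ?_
      refine le_trans (Submodule.finrank_mono ?_) (heq t).le
      rintro x ⟨h1, h2⟩
      rw [mem_kFixed]
      refine ⟨?_, by simpa [sub_eq_zero] using h2⟩
      rw [he]
      exact exp_apply_eq_self h1) 1
  rw [← hP1, heq]
  exact key

end Polar

/-! ### Toral subspaces have dimension at most the rank -/

theorem exists_eq_add_ker {V : Type*} [AddCommGroup V] [Module ℝ V] [FiniteDimensional ℝ V]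
    (A : Module.End ℝ V) (h : ∀ x, A (A x) = 0 → A x = 0) (y : V) :
    ∃ u w, A w = 0 ∧ y = A u + w := by
  let f : LinearMap.range A →ₗ[ℝ] LinearMap.range A := A.restrict fun x _ ↦ ⟨x, rfl⟩
  have hf : Function.Injective f := by
    rw [← LinearMap.ker_eq_bot, LinearMap.ker_eq_bot']
    rintro ⟨_, x, rfl⟩ hx
    exact Subtype.ext (h x (congrArg Subtype.val hx))
  obtain ⟨⟨_, u, rfl⟩, hu⟩ := LinearMap.injective_iff_surjective.1 hf ⟨A y, y, rfl⟩
  have hu' : A (A u) = A y := congrArg Subtype.val hu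
  exact ⟨u, y - A u, by rw [map_sub, hu', sub_self], by abel⟩

section Toral
open CartanLieAlgebra NormedSpace

variable {L : Type*} [LieRing L] [LieAlgebra ℝ L] [CartanLieAlgebra L] [FiniteDimensional ℝ L]

/-- Elements near `Z` are conjugate into `Z + 𝔷(Z)` if `ad Z` has no nilpotent part at `0`. -/
theorem eventually_exists_conj {Z : L} (hZ : ∀ x : L, ⁅Z, ⁅Z, x⁆⁆ = 0 → ⁅Z, x⁆ = 0) :
    ∀ᶠ X in 𝓝 Z, ∃ U W : L, ⁅Z, W⁆ = 0 ∧ X = exp (bracketCLM L U) (Z + W) := by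
  let A : L →ₗ[ℝ] L := LieAlgebra.ad ℝ L Z
  let N : Submodule ℝ L := LinearMap.ker A
  have hN : FiniteDimensional ℝ N := inferInstance
  have hNc : CompleteSpace N := FiniteDimensional.complete ℝ N
  have h1 : HasStrictFDerivAt (fun p : L × N ↦ exp (bracketCLM L p.1))
      ((ContinuousLinearMap.id ℝ (L →L[ℝ] L)).comp
        ((bracketCLM L).comp (ContinuousLinearMap.fst ℝ L N))) 0 := by
    have e0 : HasStrictFDerivAt (exp : (L →L[ℝ] L) → (L →L[ℝ] L))
        (ContinuousLinearMap.id ℝ (L →L[ℝ] L)) (((bracketCLM L).comp (ContinuousLinearMap.fst ℝ L N)) 0) := by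
      rw [map_zero]; exact hasStrictFDerivAt_exp_zero (𝕂 := ℝ)
    exact e0.comp (0 : L × N)
      ((bracketCLM L).comp (ContinuousLinearMap.fst ℝ L N)).hasStrictFDerivAt
  have h2 : HasStrictFDerivAt (fun p : L × N ↦ Z + (p.2 : L))
      (N.subtypeL.comp (ContinuousLinearMap.snd ℝ L N)) 0 :=
    (N.subtypeL.comp (ContinuousLinearMap.snd ℝ L N)).hasStrictFDerivAt.const_add Z
  have h3 := h1.clm_apply h2
  -- The differential of `(U, W) ↦ exp (ad U) (Z + W)` at the origin is `(u, w) ↦ ⁅u, Z⁆ + w`, which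
  -- is onto because the Lie algebra is the sum of the range and the kernel of `ad Z`.
  have h4 := h3.map_nhds_eq_of_surj (by
    rw [LinearMap.range_eq_top]
    intro y
    obtain ⟨u, w, hw, hy⟩ := exists_eq_add_ker A hZ y
    refine ⟨(-u, ⟨w, hw⟩), ?_⟩
    have e1 : ⁅-u, Z⁆ = A u := by
      rw [neg_lie, lie_skew]; rfl
    have hexp : exp (0 : L →L[ℝ] L) = 1 := exp_zero
    simp [hexp, hy]
    rw [add_comm]; rfl)
  have hexp : exp (0 : L →L[ℝ] L) = 1 := exp_zero
  have e5 : exp (bracketCLM L (0 : L × N).1) (Z + ((0 : L × N).2 : L)) = Z := by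
    simp [hexp]
  rw [e5] at h4
  rw [← h4, eventually_map]
  exact Eventually.of_forall fun p ↦ ⟨p.1, p.2, p.2.2, rfl⟩

/-- A toral subspace, all of whose elements commute with the centralizer of a semisimple `Z`,
has dimension at most the rank. -/
theorem finrank_le_rank_of_toral {Z : L} (hZ : ∀ x : L, ⁅Z, ⁅Z, x⁆⁆ = 0 → ⁅Z, x⁆ = 0)
    (𝔥 : Submodule ℝ L) (h𝔥 : ∀ x : L, ⁅Z, x⁆ = 0 → ∀ W ∈ 𝔥, ⁅W, x⁆ = 0) :
    Module.finrank ℝ 𝔥 ≤ LieAlgebra.rank ℝ L := by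
  obtain ⟨x₀, hx₀⟩ := LieAlgebra.exists_isRegular ℝ L
  rw [LieAlgebra.isRegular_iff_natTrailingDegree_charpoly_eq_rank] at hx₀
  have key := le_natTrailingDegree_of_analytic (LieAlgebra.ad ℝ L : L →ₗ[ℝ] Module.End ℝ L)
    (fun t ↦ Z + t • (x₀ - Z)) (fun f t _ ↦ by
      simp only [map_add, map_smul, smul_eq_mul]
      exact analyticAt_const.add (analyticAt_id.mul analyticAt_const))
    (Module.finrank ℝ 𝔥) (by
      have hc : Tendsto (fun t : ℝ ↦ Z + t • (x₀ - Z)) (𝓝 0) (𝓝 Z) := by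
        have : Continuous (fun t : ℝ ↦ Z + t • (x₀ - Z)) := by fun_prop
        simpa using this.tendsto 0
      -- A point of the segment near `Z` is conjugate to `Z + W` with `W` centralizing `Z`. It
      -- commutes with the corresponding conjugate of `𝔥`, so its generalized `0`-eigenspace is at
      -- least as large as `𝔥`.
      filter_upwards [hc.eventually (eventually_exists_conj hZ)] with t ⟨U, W, hW, he⟩
      let e : L →ₗ[ℝ] L := (exp (bracketCLM L U) : L →L[ℝ] L)
      have hinj : Function.Injective e := fun a b hab ↦ by
        rw [← exp_neg_apply_exp (bracketCLM L U) a, ← exp_neg_apply_exp (bracketCLM L U) b]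
        exact congrArg _ hab
      have hmap (x y : L) : e ⁅x, y⁆ = ⁅e x, e y⁆ :=
        exp_map_of_derivation (bracketCLM L) (D := bracketCLM L U) (fun x y ↦ by simp) x y
      rw [← LinearMap.finrank_maxGenEigenspace_zero_eq,
        (Submodule.equivMapOfInjective e hinj 𝔥).finrank_eq]
      refine Submodule.finrank_mono ?_
      rintro _ ⟨V, hV, rfl⟩
      rw [Module.End.mem_maxGenEigenspace]
      refine ⟨1, ?_⟩
      rw [he]
      have h1 : ⁅Z, V⁆ = 0 := by rw [← lie_skew, h𝔥 Z (lie_self Z) V hV, neg_zero]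
      have h2 : ⁅W, V⁆ = 0 := by rw [← lie_skew, h𝔥 W hW V hV, neg_zero]
      have h3 : ⁅e (Z + W), e V⁆ = 0 := by rw [← hmap, add_lie, h1, h2, add_zero, map_zero]
      rw [zero_smul, sub_zero, pow_one]
      exact h3) 1
  -- At `t = 1` the segment reaches the regular element `x₀`, where the multiplicity of `0` is
  -- exactly the rank.
  simp only [one_smul, add_sub_cancel] at key
  exact key.trans hx₀.le

end Toral

/-! ### Equal rank yields a fixed vector in a positive eigenspace -/

section FixedVector
open CartanLieAlgebra NormedSpace

variable {L : Type*} [LieRing L] [LieAlgebra ℝ L] [CartanLieAlgebra L] [FiniteDimensional ℝ L]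

theorem lie_eq_zero_of_lie_lie_k {Y : L} (hY : θ Y = Y) (x : L) (h : ⁅Y, ⁅Y, x⁆⁆ = 0) :
    ⁅Y, x⁆ = 0 := by
  have : inner ℝ ⁅Y, x⁆ ⁅Y, x⁆ = 0 := by
    nth_rewrite 1 [inner_lie]
    rw [hY, h, inner_zero_right, neg_zero]
  exact inner_self_eq_zero.1 this

/-- An abelian subspace of `𝔨` contains an element whose centralizer is that of the subspace. -/
theorem exists_generic (𝔰 : Submodule ℝ L) (hθ : ∀ x ∈ 𝔰, θ x = x)
    (hab : ∀ x ∈ 𝔰, ∀ y ∈ 𝔰, ⁅x, y⁆ = 0) :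
    ∃ Y ∈ 𝔰, ∀ Z ∈ 𝔰, ∀ x : L, ⁅Y, x⁆ = 0 → ⁅Z, x⁆ = 0 := by
  let f : L → ℕ := fun Y ↦ Module.finrank ℝ (LinearMap.ker (LieAlgebra.ad ℝ L Y : L →ₗ[ℝ] L))
  -- `Y` has a centralizer of minimal dimension. For small `s ≠ 0` the centralizer of `Y + s Z` lies
  -- in that of `Y`, so by minimality the two agree, and dividing by `s` shows that `Z` centralizes
  -- it too.
  obtain ⟨Y, hY, hmin⟩ := (measure f).wf.has_min (𝔰 : Set L) ⟨0, 𝔰.zero_mem⟩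
  refine ⟨Y, hY, fun Z hZ x hx ↦ ?_⟩
  have hev : ∀ᶠ s in 𝓝[≠] (0 : ℝ), ∀ x, bracketCLM L (Y + s • Z) x = 0 →
      bracketCLM L Y x = 0 := by
    refine eventually_ker_le (fun x hx ↦ lie_eq_zero_of_lie_lie_k (hθ Y hY) x hx) ?_ ?_
    · have : Continuous (fun s : ℝ ↦ bracketCLM L (Y + s • Z)) := by fun_prop
      have h := this.tendsto 0
      simp only [zero_smul, add_zero] at h
      exact h.mono_left nhdsWithin_le_nhds
    · intro s x
      simp only [bracketCLM_apply]
      rw [leibniz_lie, add_lie, smul_lie, lie_self, hab Z hZ Y hY, smul_zero, add_zero, zero_lie,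
        zero_add]
  obtain ⟨s, hs, hs0⟩ := (hev.and self_mem_nhdsWithin).exists
  have hle : LinearMap.ker (LieAlgebra.ad ℝ L (Y + s • Z) : L →ₗ[ℝ] L) ≤
      LinearMap.ker (LieAlgebra.ad ℝ L Y : L →ₗ[ℝ] L) := fun x hx ↦ hs x hx
  have heq := Submodule.eq_of_le_of_finrank_le hle
    (not_lt.1 (hmin (Y + s • Z) (𝔰.add_mem hY (𝔰.smul_mem s hZ))))
  have hx' : x ∈ LinearMap.ker (LieAlgebra.ad ℝ L (Y + s • Z) : L →ₗ[ℝ] L) := by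
    rw [heq]; exact hx
  have h1 : ⁅Y + s • Z, x⁆ = 0 := hx'
  rw [add_lie, hx, zero_add, smul_lie] at h1
  exact (smul_eq_zero.1 h1).resolve_left hs0

theorem exists_maximal_abelian (F : Submodule ℝ L) : ∃ 𝔰 ≤ F,
    (∀ x ∈ 𝔰, ∀ y ∈ 𝔰, ⁅x, y⁆ = 0) ∧ ∀ x ∈ F, (∀ y ∈ 𝔰, ⁅y, x⁆ = 0) → x ∈ 𝔰 := by
  obtain ⟨𝔰, ⟨hF, hab⟩, hmax⟩ := (wellFounded_gt (α := Submodule ℝ L)).has_min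
    {𝔰 | 𝔰 ≤ F ∧ ∀ x ∈ 𝔰, ∀ y ∈ 𝔰, ⁅x, y⁆ = 0}
    ⟨⊥, bot_le, fun x hx y _ ↦ by rw [(Submodule.mem_bot ℝ).1 hx, zero_lie]⟩
  refine ⟨𝔰, hF, hab, fun x hx hc ↦ ?_⟩
  by_contra hxs
  refine hmax (𝔰 ⊔ ℝ ∙ x) ⟨sup_le hF ((Submodule.span_singleton_le_iff_mem x F).2 hx), ?_⟩
    (lt_of_le_of_ne le_sup_left fun h ↦ hxs ?_)
  · intro u hu v hv
    obtain ⟨a, ha, _, hb, rfl⟩ := Submodule.mem_sup.1 hu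
    obtain ⟨c, rfl⟩ := Submodule.mem_span_singleton.1 hb
    obtain ⟨a', ha', _, hb', rfl⟩ := Submodule.mem_sup.1 hv
    obtain ⟨c', rfl⟩ := Submodule.mem_span_singleton.1 hb'
    have h1 : ⁅x, a'⁆ = 0 := by rw [← lie_skew, hc a' ha', neg_zero]
    simp [hab a ha a' ha', hc a ha, h1]
  · rw [h]
    exact Submodule.mem_sup_right (Submodule.mem_span_singleton_self x)

/-- `ad H` is symmetric and preserves the fixed space of `T`. Positive eigenvalues there are
excluded by hypothesis, and negative ones because `θ` exchanges the `c`- and `-c`-eigenspaces. -/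
theorem fixed_commute {T : L →L[ℝ] L} (hT : IsKAut T) {H : L} (hH : θ H = -H) (hTH : T H = H)
    (h : ∀ c > 0, ∀ x : L, ⁅H, x⁆ = (c : ℝ) • x → T x = x → x = 0) {x : L} (hx : T x = x) :
    ⁅H, x⁆ = 0 := by
  let F : Submodule ℝ L := LinearMap.ker ((T : L →ₗ[ℝ] L) - 1)
  have hF {x : L} : x ∈ F ↔ T x = x := by simp [F, sub_eq_zero]
  let A : L →ₗ[ℝ] L := LieAlgebra.ad ℝ L H
  have hinv : ∀ x ∈ F, A x ∈ F := fun x hx ↦ by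
    rw [hF] at hx ⊢
    change T ⁅H, x⁆ = ⁅H, x⁆
    rw [hT.map_lie, hTH, hx]
  have hsym : A.IsSymmetric := fun x y ↦ by
    change inner ℝ ⁅H, x⁆ y = inner ℝ x ⁅H, y⁆
    rw [inner_lie, hH, neg_lie, inner_neg_right, neg_neg]
  have key := norm_apply_le_of_eigenvalues (hsym.restrict_invariant hinv) le_rfl
    (fun μ v hv1 hv ↦ by
      have hv' : ⁅H, (v : L)⁆ = μ • (v : L) := congrArg Subtype.val hv
      have hne : (v : L) ≠ 0 := fun h0 ↦ by
        have : v = 0 := Subtype.ext h0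
        simp [this] at hv1
      have hfix : T (v : L) = v := hF.1 v.2
      rcases lt_trichotomy μ 0 with hμ | hμ | hμ
      · refine absurd (h (-μ) (neg_pos.2 hμ) (θ (v : L)) ?_ (by rw [hT.comm, hfix])) fun h0 ↦ ?_
        · have := congrArg θ hv'
          rw [θ_lie, hH, map_smul, neg_lie] at this
          rw [neg_smul, ← this, neg_neg]
        · rw [← θ_θ (v : L), h0, map_zero] at hne
          exact hne rfl
      · simp [hμ]
      · exact absurd (h μ hμ v hv' hfix) hne) ⟨x, hF.2 hx⟩
  rw [zero_mul] at key
  have := norm_le_zero_iff.1 key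
  exact congrArg Subtype.val this

/-- If `𝔤` and `𝔨` have equal rank, an element of the identity component of the automorphisms
commuting with `θ` that fixes `H ∈ 𝔭` has a fixed vector in a root space of `H`. -/
theorem exists_fixed_vector {T : L →L[ℝ] L} (hT : IsKAut T) (hgood : IsGood T) {H : L}
    (hH : θ H = -H) (hH0 : H ≠ 0) (hTH : T H = H)
    (hr : ∀ Y : L, θ Y = Y → LieAlgebra.rank ℝ L ≤ Module.finrank ℝ
      (LinearMap.ker (LieAlgebra.ad ℝ L Y) ⊓ LinearMap.ker ((θ : L →ₗ[ℝ] L) - 1) :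
        Submodule ℝ L)) :
    ∃ c > 0, ∃ x : L, ⁅H, x⁆ = (c : ℝ) • x ∧ T x = x ∧ x ≠ 0 := by
  by_contra hcon
  have hcon' : ∀ c > 0, ∀ x : L, ⁅H, x⁆ = (c : ℝ) • x → T x = x → x = 0 :=
    fun c hc x h1 h2 ↦ by
      by_contra h3
      exact hcon ⟨c, hc, x, h1, h2, h3⟩
  obtain ⟨𝔰, h𝔰F, hab, hmax⟩ := exists_maximal_abelian (kFixed T)
  have h𝔰 {x : L} (hx : x ∈ 𝔰) : T x = x ∧ θ x = x := mem_kFixed.1 (h𝔰F hx)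
  obtain ⟨Y, hY, hgen⟩ := exists_generic 𝔰 (fun x hx ↦ (h𝔰 hx).2) hab
  have hTY := (h𝔰 hY).1
  have hθY := (h𝔰 hY).2
  have hcent (x : L) (h1 : T x = x) (h2 : θ x = x) (h3 : ⁅Y, x⁆ = 0) : x ∈ 𝔰 :=
    hmax x (mem_kFixed.2 ⟨h1, h2⟩) fun y hy ↦ hgen y hy x h3
  -- The dimension bound is applied to `T exp (s ad Y)` instead of `T`. For small `s ≠ 0` its fixed
  -- vectors are fixed by `T`, hence by `exp (s ad Y)`, hence killed by `ad Y`; those in `𝔨` lie in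
  -- `𝔰` by genericity and maximality.
  have hr𝔰 : LieAlgebra.rank ℝ L ≤ Module.finrank ℝ 𝔰 := by
    obtain ⟨ε, hε, hexp⟩ := exists_exp_fixed_small L
    have hcontY : Continuous (fun s : ℝ ↦ bracketCLM L (s • Y)) := by fun_prop
    have hev1 : ∀ᶠ s in 𝓝[≠] (0 : ℝ), ‖bracketCLM L (s • Y)‖ < ε := by
      have := (hcontY.norm.tendsto 0).eventually_lt_const (u := ε) (by simpa using hε)
      exact this.filter_mono nhdsWithin_le_nhds
    have hTe (s : ℝ) (x : L) : T (exp (bracketCLM L (s • Y)) x) =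
        exp (bracketCLM L (s • Y)) (T x) := by
      have hc : Commute T (bracketCLM L (s • Y)) := by
        ext z
        change T ⁅s • Y, z⁆ = ⁅s • Y, T z⁆
        rw [hT.map_lie, map_smul, hTY]
      exact congrArg (fun f : L →L[ℝ] L ↦ f x) hc.exp_right.eq
    have hev2 : ∀ᶠ s in 𝓝[≠] (0 : ℝ), ∀ x, (T * exp (bracketCLM L (s • Y)) - 1) x = 0 →
        (T - 1) x = 0 := by
      refine eventually_ker_le (A := T - 1) (fun x hx ↦ ?_) ?_ fun s x ↦ ?_
      · change T x - x = 0
        exact sub_eq_zero.2 (hT.fixed_of_sq x (sub_eq_zero.1 hx))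
      · have he : Continuous (exp : (L →L[ℝ] L) → (L →L[ℝ] L)) := by
          let _ : NormedAlgebra ℚ (L →L[ℝ] L) := NormedAlgebra.restrictScalars ℚ ℝ _
          exact exp_continuous
        have : Continuous (fun s : ℝ ↦ T * exp (bracketCLM L (s • Y)) - 1) :=
          (continuous_const.mul (he.comp hcontY)).sub continuous_const
        have h := this.tendsto 0
        have e0 : exp (0 : L →L[ℝ] L) = 1 := exp_zero
        simp only [zero_smul, map_zero, e0, mul_one] at h
        exact h.mono_left nhdsWithin_le_nhds
      · change T (exp (bracketCLM L (s • Y)) (T x - x)) - (T x - x) =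
          T (T (exp (bracketCLM L (s • Y)) x) - x) - (T (exp (bracketCLM L (s • Y)) x) - x)
        simp only [map_sub, hTe]
        abel
    obtain ⟨s, ⟨hs1, hs2⟩, hs0⟩ := ((hev1.and hev2).and self_mem_nhdsWithin).exists
    have hg : IsGood (T * exp (bracketCLM L (s • Y))) :=
      hgood.mul (IsGood.exp (by rw [map_smul, hθY]))
    refine (hg.le_finrank_kFixed hr).trans (Submodule.finrank_mono fun x hx ↦ ?_)
    obtain ⟨hx1, hx2⟩ := mem_kFixed.1 hx
    have hTx : T x = x := sub_eq_zero.1 (hs2 x (sub_eq_zero.2 hx1))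
    have hex : exp (bracketCLM L (s • Y)) x = x :=
      (bijective_of_isUnit hT.isUnit).1 (hx1.trans hTx.symm)
    have h0 := hexp _ hs1 x hex
    rw [bracketCLM_apply, smul_lie] at h0
    exact hcent x hTx hx2 ((smul_eq_zero.1 h0).resolve_left hs0)
  have hHY : ⁅H, Y⁆ = 0 := fixed_commute hT hH hTH hcon' hTY
  have hHY' : ⁅Y, H⁆ = 0 := by rw [← lie_skew, hHY, neg_zero]
  have hiY (x y : L) : inner ℝ ⁅Y, x⁆ y = -inner ℝ x ⁅Y, y⁆ := by rw [inner_lie, hθY]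
  have hiH (x y : L) : inner ℝ ⁅H, x⁆ y = inner ℝ x ⁅H, y⁆ := by
    rw [inner_lie, hH, neg_lie, inner_neg_right, neg_neg]
  -- `ad Y` is skew, `ad H` is symmetric and they commute, so `⁅Y, x⁆` and `⁅H, x⁆` are orthogonal.
  -- Their sum vanishes only if both do.
  have hker (x : L) (hx : ⁅Y + H, x⁆ = 0) : ⁅Y, x⁆ = 0 ∧ ⁅H, x⁆ = 0 := by
    rw [add_lie] at hx
    have h1 : inner ℝ ⁅Y, x⁆ ⁅H, x⁆ = 0 := by
      have e1 := hiY x ⁅H, x⁆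
      have e2 := hiH x ⁅Y, x⁆
      rw [leibniz_lie, hHY, zero_lie, zero_add, real_inner_comm] at e2
      linarith
    have h2 : ⁅Y, x⁆ = -⁅H, x⁆ := eq_neg_of_add_eq_zero_left hx
    have h3 : ⁅H, x⁆ = 0 := by
      rw [h2, inner_neg_left, neg_eq_zero] at h1
      exact inner_self_eq_zero.1 h1
    exact ⟨by rw [h2, h3, neg_zero], h3⟩
  have hle := finrank_le_rank_of_toral (Z := Y + H) (fun x hx ↦ by
    obtain ⟨h1, h2⟩ := hker _ hx
    refine inner_self_eq_zero (𝕜 := ℝ).1 ?_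
    nth_rewrite 1 [add_lie]
    rw [inner_add_left, hiY, hiH, h1, h2]
    simp) (𝔰 ⊔ ℝ ∙ H) (fun x hx W hW ↦ by
    obtain ⟨h1, h2⟩ := hker x hx
    obtain ⟨a, ha, _, hb, rfl⟩ := Submodule.mem_sup.1 hW
    obtain ⟨c, rfl⟩ := Submodule.mem_span_singleton.1 hb
    rw [add_lie, hgen a ha x h1, smul_lie, h2, smul_zero, add_zero])
  -- `𝔰` lies in `𝔨` and `0 ≠ H ∈ 𝔭`. The enlarged toral subspace therefore has dimension above the
  -- rank, a contradiction.
  have hlt : 𝔰 < 𝔰 ⊔ ℝ ∙ H := by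
    refine lt_of_le_of_ne le_sup_left fun h ↦ hH0 ?_
    have hmem : H ∈ 𝔰 := by
      rw [h]; exact Submodule.mem_sup_right (Submodule.mem_span_singleton_self H)
    have := (h𝔰 hmem).2
    rw [hH] at this
    have h2 : (2 : ℝ) • H = 0 := by
      rw [two_smul]; nth_rewrite 1 [← this]; exact neg_add_cancel H
    exact (smul_eq_zero.1 h2).resolve_left two_ne_zero
  have := Submodule.finrank_lt_finrank_of_lt hlt
  omega

end FixedVector

/-! ### Block triangular operators with graded diagonal -/

section Triangular
open Module.End

variable {V : Type*} [NormedAddCommGroup V] [InnerProductSpace ℝ V] [FiniteDimensional ℝ V]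

/-- The orthogonal complement of an invariant subspace is invariant, since an isometry maps the
subspace onto itself. -/
theorem isSemisimple_of_isometry {T : Module.End ℝ V} (hT : ∀ x y, inner ℝ (T x) (T y) = inner ℝ x y) :
    T.IsSemisimple := by
  rw [isSemisimple_iff]
  intro p hp
  have hinj : Function.Injective T := by
    rw [← LinearMap.ker_eq_bot, LinearMap.ker_eq_bot']
    intro x hx
    have := hT x x
    rw [hx, inner_zero_left] at this
    exact inner_self_eq_zero.1 this.symm
  have hp' (x : V) (hx : x ∈ p) : ∃ y ∈ p, T y = x := by
    have hr : Function.Injective (T.restrict hp) := fun a b hab ↦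
      Subtype.ext (hinj (congrArg Subtype.val hab))
    obtain ⟨y, hy⟩ := LinearMap.injective_iff_surjective.1 hr ⟨x, hx⟩
    exact ⟨y, y.2, congrArg Subtype.val hy⟩
  refine ⟨pᗮ, fun y hy ↦ ?_, Submodule.isCompl_orthogonal p⟩
  rw [Submodule.mem_comap, Submodule.mem_orthogonal]
  intro x hx
  obtain ⟨z, hz, rfl⟩ := hp' x hx
  rw [hT]
  exact (Submodule.mem_orthogonal p y).1 hy z hz

theorem commute_aeval {R : Type*} [Ring R] [Algebra ℝ R] {a b : R} (h : Commute a b)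
    (q : Polynomial ℝ) : Commute a (Polynomial.aeval b q) := by
  induction q using Polynomial.induction_on' with
  | add p q hp hq => rw [map_add]; exact hp.add_right hq
  | monomial n r =>
    rw [Polynomial.aeval_monomial]
    exact (Algebra.commute_algebraMap_right r a).mul_right (h.pow_right n)

/-- The sum of the eigenspaces of `A` with eigenvalues larger than `c`. -/
def upper (A : Module.End ℝ V) (c : ℝ) : Submodule ℝ V :=
  ⨆ d, ⨆ _ : c < d, eigenspace A d

theorem eigenspace_le_upper (A : Module.End ℝ V) {c d : ℝ} (h : c < d) :
    eigenspace A d ≤ upper A c := le_iSup₂_of_le d h le_rfl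

theorem upper_anti (A : Module.End ℝ V) {c d : ℝ} (h : c ≤ d) : upper A d ≤ upper A c :=
  iSup₂_le fun _ he ↦ eigenspace_le_upper A (h.trans_lt he)

theorem upper_le {A : Module.End ℝ V} {c : ℝ} {p : Submodule ℝ V}
    (h : ∀ d, c < d → ∀ x, A x = d • x → x ∈ p) : upper A c ≤ p :=
  iSup₂_le fun d hd x hx ↦ h d hd x (mem_eigenspace_iff.1 hx)

theorem iSup_eigenspace_of_symmetric {A : Module.End ℝ V} (hA : A.IsSymmetric) :
    ⨆ c, eigenspace A c = ⊤ := by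
  rw [← Submodule.orthogonal_eq_bot_iff, hA.orthogonalComplement_iSup_eigenspaces_eq_bot]

theorem linearMap_eq_zero {A : Module.End ℝ V} (hA : A.IsSymmetric) {W : Type*} [AddCommGroup W]
    [Module ℝ W] {f : V →ₗ[ℝ] W} (h : ∀ (c : ℝ) x, A x = c • x → f x = 0) : f = 0 := by
  rw [← LinearMap.ker_eq_top, eq_top_iff, ← iSup_eigenspace_of_symmetric hA]
  exact iSup_le fun c x hx ↦ h c x (mem_eigenspace_iff.1 hx)

/-- The orthogonal projection onto an eigenspace. -/
def eigenProj (A : Module.End ℝ V) (c : ℝ) : V →L[ℝ] V := (eigenspace A c).starProjection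

theorem eigenProj_mem (A : Module.End ℝ V) (c : ℝ) (x : V) :
    A (eigenProj A c x) = c • eigenProj A c x :=
  mem_eigenspace_iff.1 ((eigenspace A c).starProjection_apply_mem x)

theorem eigenProj_same {A : Module.End ℝ V} {c : ℝ} {x : V} (hx : A x = c • x) :
    eigenProj A c x = x :=
  Submodule.starProjection_eq_self_iff.2 (mem_eigenspace_iff.2 hx)

theorem eigenProj_ne {A : Module.End ℝ V} (hA : A.IsSymmetric) {c d : ℝ} (hcd : c ≠ d) {x : V}
    (hx : A x = d • x) : eigenProj A c x = 0 := by
  refine (Submodule.starProjection_apply_eq_zero_iff _).2 ?_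
  rw [Submodule.mem_orthogonal]
  intro y hy
  exact hA.orthogonalFamily_eigenspaces hcd ⟨y, hy⟩ ⟨x, mem_eigenspace_iff.2 hx⟩

theorem eigenProj_upper {A : Module.End ℝ V} (hA : A.IsSymmetric) {c d : ℝ} (hcd : c ≤ d) {x : V}
    (hx : x ∈ upper A d) : eigenProj A c x = 0 := by
  have : upper A d ≤ LinearMap.ker (eigenProj A c : V →ₗ[ℝ] V) :=
    upper_le fun e he y hy ↦ eigenProj_ne hA (hcd.trans_lt he).ne hy
  exact this hx

theorem eq_zero_of_mem_upper {A : Module.End ℝ V} (hA : A.IsSymmetric) {c : ℝ} {x : V}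
    (hx : A x = c • x) (hu : x ∈ upper A c) : x = 0 := by
  rw [← eigenProj_same hx, eigenProj_upper hA le_rfl hu]

theorem sum_eigenProj {A : Module.End ℝ V} (hA : A.IsSymmetric) (x : V) :
    x = ∑ c ∈ A.finite_hasEigenvalue.toFinset, eigenProj A c x := by
  have : (LinearMap.id : V →ₗ[ℝ] V) -
      ∑ c ∈ A.finite_hasEigenvalue.toFinset, (eigenProj A c : V →ₗ[ℝ] V) = 0 := by
    refine linearMap_eq_zero hA fun c x hx ↦ ?_
    rw [LinearMap.sub_apply, LinearMap.sum_apply, sub_eq_zero, LinearMap.id_apply]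
    by_cases hx0 : x = 0
    · simp [hx0]
    rw [Finset.sum_eq_single c]
    · exact (eigenProj_same hx).symm
    · exact fun d _ hd ↦ eigenProj_ne hA hd hx
    · intro hc
      refine absurd ?_ hc
      rw [Set.Finite.mem_toFinset]
      exact hasEigenvalue_of_hasEigenvector ⟨mem_eigenspace_iff.2 hx, hx0⟩
  have h := congrArg (fun f : V →ₗ[ℝ] V ↦ f x) this
  simp only [LinearMap.sub_apply, LinearMap.sum_apply, LinearMap.id_apply, LinearMap.zero_apply,
    sub_eq_zero] at h
  exact h

theorem eq_zero_of_pow_mul_le {r a K : ℝ} (hr : 1 < r) (ha : 0 ≤ a) (h : ∀ n : ℕ, r ^ n * a ≤ K) :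
    a = 0 := by
  by_contra hne
  have ha' : 0 < a := lt_of_le_of_ne ha (Ne.symm hne)
  obtain ⟨n, hn⟩ := pow_unbounded_of_one_lt (K / a) hr
  rw [div_lt_iff₀ ha'] at hn
  exact (h n).not_gt hn

/-- `S` commutes with `A` and scales the `c`-eigenspace of `A` by `exp (s c)`. -/
structure IsGraded (A S : Module.End ℝ V) (s : ℝ) : Prop where
  comm : ∀ x, S (A x) = A (S x)
  norm : ∀ c x, A x = c • x → ‖S x‖ = Real.exp (s * c) * ‖x‖

namespace IsGraded
variable {A S : Module.End ℝ V} {s : ℝ} (h : IsGraded A S s)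
include h

theorem mem {c : ℝ} {x : V} (hx : A x = c • x) : A (S x) = c • S x := by
  rw [← h.comm, hx, map_smul]

theorem mem_upper {c : ℝ} {x : V} (hx : x ∈ upper A c) : S x ∈ upper A c := by
  have : upper A c ≤ (upper A c).comap S :=
    upper_le fun d hd x hx ↦ eigenspace_le_upper A hd (mem_eigenspace_iff.2 (h.mem hx))
  exact this hx

theorem pow_mem {c : ℝ} {x : V} (hx : A x = c • x) (n : ℕ) : A ((S ^ n) x) = c • (S ^ n) x := by
  induction n with
  | zero => simpa using hx
  | succ n ih => rw [pow_succ', Module.End.mul_apply]; exact h.mem ih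

theorem norm_pow {c : ℝ} {x : V} (hx : A x = c • x) (n : ℕ) :
    ‖(S ^ n) x‖ = Real.exp (s * c) ^ n * ‖x‖ := by
  induction n with
  | zero => simp
  | succ n ih =>
    rw [pow_succ' S, Module.End.mul_apply, h.norm c _ (h.pow_mem hx n), ih]; ring

theorem exists_pow_eq {c : ℝ} {x : V} (hx : A x = c • x) (n : ℕ) :
    ∃ y, A y = c • y ∧ (S ^ n) y = x := by
  let p := eigenspace A c
  have hp : ∀ x ∈ p, (S ^ n) x ∈ p := fun x hx ↦
    mem_eigenspace_iff.2 (h.pow_mem (mem_eigenspace_iff.1 hx) n)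
  have hinj : Function.Injective ((S ^ n).restrict hp) := by
    rw [← LinearMap.ker_eq_bot, LinearMap.ker_eq_bot']
    intro y hy
    have h1 : (S ^ n) (y : V) = 0 := congrArg Subtype.val hy
    have h2 := h.norm_pow (mem_eigenspace_iff.1 y.2) n
    rw [h1, norm_zero, zero_eq_mul] at h2
    exact Subtype.ext (norm_eq_zero.1 (h2.resolve_left (by positivity)))
  obtain ⟨y, hy⟩ := LinearMap.injective_iff_surjective.1 hinj ⟨x, mem_eigenspace_iff.2 hx⟩
  exact ⟨y, mem_eigenspace_iff.1 y.2, congrArg Subtype.val hy⟩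

/-- Intertwiners between different eigenspaces vanish. -/
theorem intertwiner_eq_zero (hs : s ≠ 0) {c d : ℝ} (hcd : c ≠ d) {ψ : V →L[ℝ] V}
    (hψ : ∀ x, A x = c • x → A (ψ x) = d • ψ x) (hS : ∀ x, A x = c • x → ψ (S x) = S (ψ x))
    {x : V} (hx : A x = c • x) : ψ x = 0 := by
  have hpow (n : ℕ) (x : V) (hx : A x = c • x) : ψ ((S ^ n) x) = (S ^ n) (ψ x) := by
    induction n with
    | zero => simp
    | succ n ih =>
      rw [pow_succ', Module.End.mul_apply, Module.End.mul_apply, hS _ (h.pow_mem hx n), ih]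
  have hne : s * (d - c) ≠ 0 := mul_ne_zero hs (sub_ne_zero.2 hcd.symm)
  refine norm_eq_zero.1 ?_
  -- Along iterates of `S`, `ψ x` scales by `exp (s d)` and `x` by `exp (s c)`. If the first rate is
  -- larger, forward iteration contradicts boundedness of `ψ`; otherwise the iteration runs
  -- backwards, through preimages under `S ^ n`.
  rcases lt_or_gt_of_ne hne with hlt | hgt
  · refine eq_zero_of_pow_mul_le (r := Real.exp (s * (c - d))) (K := ‖ψ‖ * ‖x‖)
      (Real.one_lt_exp_iff.2 (by linarith)) (norm_nonneg _) fun n ↦ ?_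
    obtain ⟨y, hy, hyx⟩ := h.exists_pow_eq hx n
    have h1 : ‖ψ x‖ = Real.exp (s * d) ^ n * ‖ψ y‖ := by
      rw [← hyx, hpow n y hy, h.norm_pow (hψ y hy)]
    have h2 : ‖x‖ = Real.exp (s * c) ^ n * ‖y‖ := by rw [← h.norm_pow hy, hyx]
    have h3 : Real.exp (s * (c - d)) ^ n * Real.exp (s * d) ^ n = Real.exp (s * c) ^ n := by
      rw [← mul_pow, ← Real.exp_add]; congr 2; ring
    rw [h1, h2, ← mul_assoc, h3]
    have := mul_le_mul_of_nonneg_left (ψ.le_opNorm y) (by positivity : 0 ≤ Real.exp (s * c) ^ n)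
    linarith
  · refine eq_zero_of_pow_mul_le (r := Real.exp (s * (d - c))) (K := ‖ψ‖ * ‖x‖)
      (Real.one_lt_exp_iff.2 hgt) (norm_nonneg _) fun n ↦ ?_
    have h1 : Real.exp (s * d) ^ n * ‖ψ x‖ ≤ ‖ψ‖ * (Real.exp (s * c) ^ n * ‖x‖) := by
      rw [← h.norm_pow (hψ x hx), ← hpow n x hx, ← h.norm_pow hx]
      exact ψ.le_opNorm _
    have h3 : Real.exp (s * (d - c)) ^ n * Real.exp (s * c) ^ n = Real.exp (s * d) ^ n := by
      rw [← mul_pow, ← Real.exp_add]; congr 2; ring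
    have h4 : (0 : ℝ) < Real.exp (s * c) ^ n := by positivity
    refine le_of_mul_le_mul_left ?_ h4
    calc Real.exp (s * c) ^ n * (Real.exp (s * (d - c)) ^ n * ‖ψ x‖)
        = Real.exp (s * d) ^ n * ‖ψ x‖ := by rw [← h3]; ring
      _ ≤ _ := h1
      _ = _ := by ring

end IsGraded

/-- `τ` is block triangular with diagonal part `S`. -/
def IsTriangular (A S τ : Module.End ℝ V) : Prop :=
  ∀ c x, A x = c • x → τ x - S x ∈ upper A c

section
variable {A S τ : Module.End ℝ V} {s : ℝ} (hA : A.IsSymmetric) (h : IsGraded A S s)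
  (hτ : IsTriangular A S τ)
include h hτ

theorem IsTriangular.mem_upper {c : ℝ} {x : V} (hx : x ∈ upper A c) : τ x ∈ upper A c := by
  have : upper A c ≤ (upper A c).comap τ := upper_le fun d hd x hx ↦ by
    rw [Submodule.mem_comap, ← sub_add_cancel (τ x) (S x)]
    exact add_mem (upper_anti A hd.le (hτ d x hx))
      (eigenspace_le_upper A hd (mem_eigenspace_iff.2 (h.mem hx)))
  exact this hx

/-- Applied to the polynomial that produces the nilpotent part of `τ`, this identifies the diagonal
of that part as the same polynomial in `S`. -/
theorem IsTriangular.aeval_sub_mem (q : Polynomial ℝ) {c : ℝ} {x : V} (hx : A x = c • x) :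
    Polynomial.aeval τ q x - Polynomial.aeval S q x ∈ upper A c := by
  induction q using Polynomial.induction_on' with
  | add p q hp hq =>
    simp only [map_add, LinearMap.add_apply]
    rw [add_sub_add_comm]
    exact add_mem hp hq
  | monomial n a =>
    simp only [Polynomial.aeval_monomial, Module.End.mul_apply, Module.algebraMap_end_apply]
    rw [← smul_sub]
    refine Submodule.smul_mem _ _ ?_
    induction n with
    | zero => simp
    | succ n ih =>
      have e : (τ ^ (n + 1)) x - (S ^ (n + 1)) x = τ ((τ ^ n) x - (S ^ n) x) +
          (τ ((S ^ n) x) - S ((S ^ n) x)) := by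
        rw [pow_succ', pow_succ', Module.End.mul_apply, Module.End.mul_apply, map_sub]; abel
      rw [e]
      exact add_mem (hτ.mem_upper h ih) (hτ c _ (h.pow_mem hx n))

include hA

/-- Among the nonzero blocks of `N`, from the `c`- to the `d`-eigenspace, take one with `d - c`
minimal. All corrections to commutation with `τ` involve blocks of smaller shift, so this block
intertwines `S` with itself. Strictness gives `c < d`, and then `intertwiner_eq_zero` kills it. -/
theorem IsTriangular.eq_zero_of_commute (hs : s ≠ 0) {N : Module.End ℝ V}
    (hN : ∀ c x, A x = c • x → N x ∈ upper A c) (hc : ∀ x, N (τ x) = τ (N x)) : N = 0 := by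
  by_contra hne
  let E := A.finite_hasEigenvalue.toFinset
  have hE {c : ℝ} {x : V} (hx : A x = c • x) (hx0 : x ≠ 0) : c ∈ E := by
    rw [Set.Finite.mem_toFinset]
    exact hasEigenvalue_of_hasEigenvector ⟨mem_eigenspace_iff.2 hx, hx0⟩
  let P : Set (ℝ × ℝ) := {p | p.1 ∈ E ∧ p.2 ∈ E ∧ ∃ x, A x = p.1 • x ∧ eigenProj A p.2 (N x) ≠ 0}
  have hmem {c d : ℝ} {x : V} (hx : A x = c • x) (h1 : eigenProj A d (N x) ≠ 0) : (c, d) ∈ P := by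
    refine ⟨hE hx fun h0 ↦ h1 (by simp [h0]), hE (eigenProj_mem A d (N x)) h1, x, hx, h1⟩
  have hPfin : P.Finite := (E ×ˢ E).finite_toSet.subset fun p hp ↦
    Finset.mem_coe.2 (Finset.mem_product.2 ⟨hp.1, hp.2.1⟩)
  have hPne : P.Nonempty := by
    by_contra hP
    refine hne (linearMap_eq_zero hA fun c x hx ↦ ?_)
    rw [sum_eigenProj hA (N x)]
    refine Finset.sum_eq_zero fun d _ ↦ ?_
    by_contra h1
    exact hP ⟨_, hmem hx h1⟩
  obtain ⟨⟨c, d⟩, ⟨-, -, x, hx, hxne⟩, hmin⟩ := hPfin.exists_minimalFor (fun p ↦ p.2 - p.1) P hPne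
  simp only at hx hxne
  have hzero {c' d' : ℝ} (hlt : d' - c' < d - c) {x : V} (hx : A x = c' • x) :
      eigenProj A d' (N x) = 0 := by
    by_contra h1
    have := hmin (hmem hx h1) hlt.le
    simp only at this
    linarith
  have hcd : c < d := by
    by_contra hle
    exact hxne (eigenProj_upper hA (not_lt.1 hle) (hN c x hx))
  let ψ : V →L[ℝ] V := (eigenProj A d).comp (LinearMap.toContinuousLinearMap N)
  refine hxne (h.intertwiner_eq_zero hs hcd.ne (ψ := ψ) (fun x _ ↦ eigenProj_mem A d _)
    (fun x hx ↦ ?_) hx)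
  change eigenProj A d (N (S x)) = S (eigenProj A d (N x))
  have h1 : eigenProj A d (N (τ x - S x)) = 0 := by
    have : upper A c ≤ LinearMap.ker ((eigenProj A d : V →ₗ[ℝ] V) ∘ₗ N) :=
      upper_le fun e he y hy ↦ hzero (by linarith) hy
    exact this (hτ c x hx)
  have h2 : eigenProj A d (N (S x)) = eigenProj A d (τ (N x)) := by
    rw [map_sub, map_sub, sub_eq_zero, hc] at h1
    exact h1.symm
  -- The components of `N x` below `d` vanish by minimality; those above `d` stay above `d` under
  -- `τ`.
  have h3 (e : ℝ) (he : e ≠ d) : eigenProj A d (τ (eigenProj A e (N x))) = 0 := by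
    rcases lt_or_gt_of_ne he with hlt | hgt
    · rw [hzero (by linarith) hx]; simp
    · refine eigenProj_upper hA le_rfl (hτ.mem_upper h ?_)
      exact eigenspace_le_upper A hgt (mem_eigenspace_iff.2 (eigenProj_mem A e _))
  rw [h2]
  nth_rewrite 1 [sum_eigenProj hA (N x)]
  rw [map_sum, map_sum, Finset.sum_eq_single d (fun e _ he ↦ h3 e he) fun hd ↦ ?_]
  · have h4 := eigenProj_upper hA le_rfl (hτ d _ (eigenProj_mem A d (N x)))
    rw [map_sub, sub_eq_zero] at h4
    rw [h4, eigenProj_same (h.mem (eigenProj_mem A d (N x)))]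
  · have h0 : eigenProj A d (N x) = 0 := by
      by_contra h0
      exact hd (hE (eigenProj_mem A d (N x)) h0)
    rw [h0, map_zero, map_zero]

/-- The nilpotent Jordan part is `q(τ)` for a polynomial `q`. Its diagonal `q(S)` is both nilpotent
and semisimple, hence zero. So `q(τ)` is strictly triangular and commutes with `τ`, and vanishes. -/
theorem IsTriangular.isSemisimple (hs : s ≠ 0) (hS : S.IsSemisimple) : τ.IsSemisimple := by
  obtain ⟨n, hn, t, -, hnil, ht, hnt⟩ := τ.exists_isNilpotent_isSemisimple
  rw [Algebra.adjoin_singleton_eq_range_aeval] at hn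
  obtain ⟨q, rfl⟩ := hn
  obtain ⟨k, hk⟩ := hnil
  have hcomm (q : Polynomial ℝ) {c : ℝ} {x : V} (hx : A x = c • x) :
      A (Polynomial.aeval S q x) = c • Polynomial.aeval S q x := by
    have hc : Commute A S := by ext x; exact (h.comm x).symm
    have h1 : A (Polynomial.aeval S q x) = Polynomial.aeval S q (A x) :=
      congrArg (fun f : Module.End ℝ V ↦ f x) (commute_aeval hc q).eq
    rw [h1, hx, map_smul]
  have hSk : Polynomial.aeval S q ^ k = 0 := by
    rw [← map_pow]
    refine linearMap_eq_zero hA fun c x hx ↦ ?_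
    have h1 := hτ.aeval_sub_mem h (q ^ k) hx
    rw [map_pow (Polynomial.aeval τ), show Polynomial.aeval τ q ^ k = 0 from hk,
      LinearMap.zero_apply, zero_sub, neg_mem_iff] at h1
    exact eq_zero_of_mem_upper hA (hcomm _ hx) h1
  have hSq : Polynomial.aeval S q = 0 :=
    eq_zero_of_isNilpotent_isSemisimple ⟨k, hSk⟩ (hS.aeval q)
  have hn0 : Polynomial.aeval τ q = 0 := by
    refine hτ.eq_zero_of_commute hA h hs (fun c x hx ↦ ?_) fun x ↦ ?_
    · have h1 := hτ.aeval_sub_mem h q hx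
      rwa [hSq, LinearMap.zero_apply, sub_zero] at h1
    · exact congrArg (fun f : Module.End ℝ V ↦ f x) (commute_aeval (Commute.refl τ) q).eq.symm
  have : τ = t := by
    rw [hnt]
    exact (congrArg (· + t) hn0).trans (zero_add t)
  rw [this]
  exact ht

/-- Either `τ - 1` has a kernel on `upper A c`, or it is bijective there and the error `τ x - x` can
be removed by subtracting an element of `upper A c` from `x`. -/
theorem IsTriangular.exists_fixed {c : ℝ} {x : V} (hx : A x = c • x) (hSx : S x = x)
    (hx0 : x ≠ 0) : ∃ y ∈ eigenspace A c ⊔ upper A c, τ y = y ∧ y ≠ 0 := by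
  let U := upper A c
  let f : U →ₗ[ℝ] U := (τ - 1).restrict fun y hy ↦
    sub_mem (hτ.mem_upper h hy) hy
  by_cases hf : Function.Injective f
  · have hmem : τ x - x ∈ U := by
      have := hτ c x hx
      rwa [hSx] at this
    obtain ⟨z, hz⟩ := LinearMap.injective_iff_surjective.1 hf ⟨τ x - x, hmem⟩
    have hz' : τ (z : V) - z = τ x - x := congrArg Subtype.val hz
    refine ⟨x - z, sub_mem (Submodule.mem_sup_left (mem_eigenspace_iff.2 hx))
      (Submodule.mem_sup_right z.2), ?_, fun h0 ↦ hx0 ?_⟩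
    · rw [map_sub, sub_eq_sub_iff_sub_eq_sub, hz']
    · refine eq_zero_of_mem_upper hA hx ?_
      rw [sub_eq_zero.1 h0]
      exact z.2
  · rw [← LinearMap.ker_eq_bot, LinearMap.ker_eq_bot'] at hf
    push Not at hf
    obtain ⟨y, hy, hy0⟩ := hf
    refine ⟨y, Submodule.mem_sup_right y.2, sub_eq_zero.1 (congrArg Subtype.val hy),
      fun h0 ↦ hy0 (Subtype.ext h0)⟩

/-- A block triangular operator with `s ≠ 0` is not conjugate to an isometry. -/
theorem IsTriangular.not_conj_isometry (hs : s ≠ 0) {c : ℝ} (hc : 0 < c) {x : V}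
    (hx : A x = c • x) (hx0 : x ≠ 0) {P k : V →ₗ[ℝ] V} (hP : Function.Injective P)
    (hk : ∀ y, ‖k y‖ = ‖y‖) (hPk : ∀ y, P (τ y) = k (P y)) : False := by
  obtain ⟨d, hd, hmax⟩ := A.finite_hasEigenvalue.exists_maximalFor id _
    ⟨c, hasEigenvalue_of_hasEigenvector ⟨mem_eigenspace_iff.2 hx, hx0⟩⟩
  have hcd : c ≤ d := by
    by_contra hlt
    exact hlt (hmax (hasEigenvalue_of_hasEigenvector ⟨mem_eigenspace_iff.2 hx, hx0⟩)
      (not_le.1 hlt).le)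
  have hd0 : s * d ≠ 0 := mul_ne_zero hs (hc.trans_le hcd).ne'
  obtain ⟨v, hv⟩ := HasEigenvalue.exists_hasEigenvector hd
  have hv1 := mem_eigenspace_iff.1 hv.1
  -- `d` is the largest eigenvalue, so nothing lies above it and `τ` agrees with `S` on this
  -- eigenspace.
  have htop : upper A d ≤ ⊥ := upper_le fun e he y hy ↦ by
    by_contra hy0
    exact he.not_ge (hmax (hasEigenvalue_of_hasEigenvector ⟨mem_eigenspace_iff.2 hy, hy0⟩) he.le)
  have hnorm (n : ℕ) : ‖P ((S ^ n) v)‖ = ‖P v‖ := by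
    induction n with
    | zero => simp
    | succ n ih =>
      have h1 := htop (hτ d _ (h.pow_mem hv1 n))
      rw [Submodule.mem_bot, sub_eq_zero] at h1
      rw [pow_succ', Module.End.mul_apply, ← h1, hPk, hk, ih]
  obtain ⟨K, hK, hanti⟩ := P.exists_antilipschitzWith (LinearMap.ker_eq_bot.2 hP)
  have hlow (y : V) : ‖y‖ ≤ K * ‖P y‖ := by simpa using hanti.le_mul_dist y 0
  -- `‖P (S ^ n v)‖` is constant while `‖S ^ n v‖` decays or grows exponentially. Decay contradicts
  -- boundedness of `P`, growth contradicts its lower bound.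
  rcases lt_or_gt_of_ne hd0 with hlt | hgt
  · refine hv.2 (hP ?_)
    rw [map_zero, ← norm_eq_zero]
    refine eq_zero_of_pow_mul_le (r := Real.exp (-(s * d)))
      (K := ‖LinearMap.toContinuousLinearMap P‖ * ‖v‖)
      (Real.one_lt_exp_iff.2 (by linarith)) (norm_nonneg _) fun n ↦ ?_
    have h1 := (LinearMap.toContinuousLinearMap P).le_opNorm ((S ^ n) v)
    rw [LinearMap.coe_toContinuousLinearMap', hnorm, h.norm_pow hv1] at h1
    have h3 : Real.exp (-(s * d)) ^ n * Real.exp (s * d) ^ n = 1 := by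
      rw [← mul_pow, ← Real.exp_add]; simp
    calc _ ≤ Real.exp (-(s * d)) ^ n * (‖LinearMap.toContinuousLinearMap P‖ *
          (Real.exp (s * d) ^ n * ‖v‖)) := by gcongr
      _ = (Real.exp (-(s * d)) ^ n * Real.exp (s * d) ^ n) *
          (‖LinearMap.toContinuousLinearMap P‖ * ‖v‖) := by ring
      _ = _ := by rw [h3, one_mul]
  · refine hv.2 (norm_eq_zero.1 ?_)
    refine eq_zero_of_pow_mul_le (r := Real.exp (s * d)) (K := K * ‖P v‖)
      (Real.one_lt_exp_iff.2 hgt) (norm_nonneg _) fun n ↦ ?_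
    rw [← h.norm_pow hv1, ← hnorm n]
    exact hlow _

end
end Triangular

/-- Every term of the exponential series after the first lies in `U`; the orthogonal projection onto
`Uᗮ` passes this to the sum. -/
theorem exp_sub_mem {V : Type*} [NormedAddCommGroup V] [InnerProductSpace ℝ V]
    [FiniteDimensional ℝ V] {U : Submodule ℝ V} {D : V →L[ℝ] V} (hD : ∀ y ∈ U, D y ∈ U) {x : V}
    (hx : D x ∈ U) : NormedSpace.exp D x - x ∈ U := by
  have : CompleteSpace V := FiniteDimensional.complete ℝ V
  have hpow (n : ℕ) : (D ^ (n + 1)) x ∈ U := by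
    induction n with
    | zero => simpa using hx
    | succ n ih => rw [pow_succ', mul_apply_eq_comp]; exact hD _ ih
  have h1 := NormedSpace.exp_series_hasSum_exp' (𝕂 := ℝ) D
  let Q : V →L[ℝ] V := Uᗮ.starProjection
  have hQ {y : V} : Q y = 0 ↔ y ∈ U := by
    rw [Submodule.starProjection_apply_eq_zero_iff, Submodule.orthogonal_orthogonal]
  have h2 := (Q.comp (ContinuousLinearMap.apply ℝ V x)).hasSum h1
  have h3 : HasSum (fun n : ℕ ↦ (Q.comp (ContinuousLinearMap.apply ℝ V x))
      ((n.factorial : ℝ)⁻¹ • D ^ n)) (Q x) := by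
    have := hasSum_single (f := fun n : ℕ ↦ (Q.comp (ContinuousLinearMap.apply ℝ V x))
      ((n.factorial : ℝ)⁻¹ • D ^ n)) 0 (fun n hn ↦ by
        obtain ⟨m, rfl⟩ := Nat.exists_eq_succ_of_ne_zero hn
        change Q ((((m + 1).factorial : ℝ)⁻¹ • D ^ (m + 1)) x) = 0
        exact hQ.2 (U.smul_mem _ (hpow m)))
    simpa using this
  have h4 : Q (NormedSpace.exp D x) = Q x := h2.unique h3
  rw [← hQ, map_sub, h4, sub_self]

/-! ### Eigenvalues of `ad H`, centralizers in `𝔨`, and unipotent exponentials -/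

section Cartan
open CartanLieAlgebra NormedSpace Module.End

variable {L : Type*} [LieRing L] [LieAlgebra ℝ L] [CartanLieAlgebra L] [FiniteDimensional ℝ L]

/-- `ad x` as an endomorphism. -/
abbrev adEnd (x : L) : Module.End ℝ L := LieAlgebra.ad ℝ L x

theorem adEnd_symmetric {H : L} (hH : θ H = -H) : (adEnd H).IsSymmetric := fun x y ↦ by
  change inner ℝ ⁅H, x⁆ y = inner ℝ x ⁅H, y⁆
  rw [inner_lie, hH, neg_lie, inner_neg_right, neg_neg]

/-- Otherwise `fixed_commute` with `T = 1` gives `ad H = 0`, against definiteness of the Killing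
form on `𝔭`. -/
theorem exists_pos_eigenvector {H : L} (hH : θ H = -H) (hH0 : H ≠ 0) :
    ∃ c > 0, ∃ x : L, ⁅H, x⁆ = (c : ℝ) • x ∧ x ≠ 0 := by
  by_contra hcon
  have h0 (x : L) : ⁅H, x⁆ = 0 := fixed_commute IsKAut.one hH rfl (fun c hc x hx _ ↦ by
    by_contra hx0
    exact hcon ⟨c, hc, x, hx, hx0⟩) rfl
  have had : LieAlgebra.ad ℝ L H = 0 := by ext x; exact h0 x
  have := pos H hH0
  rw [killingForm_apply_apply, had] at this
  simp at this

/-- `ad Y` is skew, so the centralizer of `Y` in `𝔨` is its full generalized `0`-eigenspace there,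
and the rank of `𝔨` is the least dimension of such a space. -/
theorem rank_le_finrank_centralizer (𝔨 : LieSubalgebra ℝ L) (h𝔨 : ∀ x, x ∈ 𝔨 ↔ θ x = x) {Y : L}
    (hY : θ Y = Y) : LieAlgebra.rank ℝ 𝔨 ≤ Module.finrank ℝ
      (LinearMap.ker (LieAlgebra.ad ℝ L Y) ⊓ LinearMap.ker ((θ : L →ₗ[ℝ] L) - 1) :
        Submodule ℝ L) := by
  let Y' : 𝔨 := ⟨Y, (h𝔨 Y).2 hY⟩
  refine (LieAlgebra.rank_le_natTrailingDegree_charpoly_ad ℝ Y').trans ?_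
  rw [← finrank_ker_eq_natTrailingDegree (LieAlgebra.ad ℝ 𝔨 Y') fun x hx ↦ Subtype.ext
    (lie_eq_zero_of_lie_lie_k hY (x : L) (congrArg Subtype.val hx))]
  refine le_trans (Submodule.equivMapOfInjective (𝔨.toSubmodule.subtype) Subtype.val_injective
    (LinearMap.ker (LieAlgebra.ad ℝ 𝔨 Y'))).finrank_eq.le (Submodule.finrank_mono ?_)
  rintro _ ⟨x, hx, rfl⟩
  refine ⟨congrArg Subtype.val (show ⁅Y', x⁆ = 0 from hx), ?_⟩
  rw [SetLike.mem_coe, LinearMap.mem_ker, LinearMap.sub_apply, sub_eq_zero]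
  exact (h𝔨 x).1 x.2

theorem lie_mem_upper {H X : L} (hX : X ∈ upper (adEnd H) 0) {c : ℝ} {x : L}
    (hx : ⁅H, x⁆ = c • x) : ⁅X, x⁆ ∈ upper (adEnd H) c := by
  have : upper (adEnd H) 0 ≤ (upper (adEnd H) c).comap
      (LinearMap.applyₗ x ∘ₗ (LieAlgebra.ad ℝ L : L →ₗ[ℝ] Module.End ℝ L)) := by
    refine upper_le fun d hd z hz ↦ eigenspace_le_upper _ (lt_add_of_pos_left c hd) ?_
    have hz' : ⁅H, z⁆ = d • z := hz
    rw [mem_eigenspace_iff]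
    change ⁅H, ⁅z, x⁆⁆ = (d + c) • ⁅z, x⁆
    rw [leibniz_lie, hz', hx, smul_lie, lie_smul, add_smul]
  exact this hX

theorem isTriangular_exp {H X : L} (hX : X ∈ upper (adEnd H) 0) :
    IsTriangular (adEnd H) 1 (exp (bracketCLM L X) : L →L[ℝ] L) := fun c x hx ↦ by
  refine exp_sub_mem (U := upper (adEnd H) c) (fun y hy ↦ ?_) (lie_mem_upper hX hx)
  have : upper (adEnd H) c ≤ (upper (adEnd H) c).comap (adEnd X) :=
    upper_le fun d hd z hz ↦ upper_anti _ hd.le (lie_mem_upper hX hz)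
  exact this hy

end Cartan

section Triangular
open Module.End
variable {V : Type*} [NormedAddCommGroup V] [InnerProductSpace ℝ V] [FiniteDimensional ℝ V]

theorem IsGraded.one (A : Module.End ℝ V) : IsGraded A 1 0 := ⟨fun _ ↦ rfl, fun _ _ _ ↦ by simp⟩

/-- Operators `1 + (strictly upper triangular)` form a semigroup. -/
theorem IsTriangular.mul {A σ τ : Module.End ℝ V} (hσ : IsTriangular A 1 σ)
    (hτ : IsTriangular A 1 τ) : IsTriangular A 1 (σ * τ) := fun c x hx ↦ by
  have e : (σ * τ) x - (1 : Module.End ℝ V) x =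
      σ (τ x - (1 : Module.End ℝ V) x) + (σ x - (1 : Module.End ℝ V) x) := by
    simp
  rw [e]
  exact add_mem (hσ.mem_upper (IsGraded.one A) (hτ c x hx)) (hσ c x hx)

theorem IsTriangular.graded_mul {A S ν : Module.End ℝ V} {s : ℝ} (hS : IsGraded A S s)
    (hν : IsTriangular A 1 ν) : IsTriangular A S (S * ν) := fun c x hx ↦ by
  have := hS.mem_upper (hν c x hx)
  rwa [map_sub] at this

theorem isSymmetric_of_scalar {A R : Module.End ℝ V} (hA : A.IsSymmetric) {f : ℝ → ℝ}
    (hR : ∀ (c : ℝ) x, A x = c • x → R x = f c • x) : R.IsSymmetric := by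
  have h (y : V) : R y = ∑ c ∈ A.finite_hasEigenvalue.toFinset, f c • eigenProj A c y := by
    nth_rewrite 1 [sum_eigenProj hA y]
    rw [map_sum]
    exact Finset.sum_congr rfl fun c _ ↦ hR c _ (eigenProj_mem A c y)
  intro x y
  rw [h x, h y, sum_inner, inner_sum]
  refine Finset.sum_congr rfl fun c _ ↦ ?_
  rw [inner_smul_left, inner_smul_right, eigenProj,
    Submodule.inner_starProjection_left_eq_right]
  simp

/-- The product of an isometry and a commuting operator acting by `exp (s c)` on the
`c`-eigenspace of `A`. -/
theorem isGraded_mul {A T R : Module.End ℝ V} {s : ℝ} (hT : ∀ x y, inner ℝ (T x) (T y) = inner ℝ x y)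
    (hTA : ∀ x, T (A x) = A (T x)) (hA : A.IsSymmetric)
    (hR : ∀ (c : ℝ) x, A x = c • x → R x = Real.exp (s * c) • x) :
    IsGraded A (T * R) s ∧ (T * R).IsSemisimple := by
  have hRA : A * R - R * A = 0 := linearMap_eq_zero hA fun c x hx ↦ by
    change A (R x) - R (A x) = 0
    rw [hx, hR c x hx, map_smul, map_smul, hR c x hx, hx, smul_comm, sub_self]
  have hRT : T * R - R * T = 0 := linearMap_eq_zero hA fun c x hx ↦ by
    change T (R x) - R (T x) = 0
    rw [hR c x hx, map_smul, hR c (T x) (by rw [← hTA, hx, map_smul]), sub_self]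
  refine ⟨⟨fun x ↦ ?_, fun c x hx ↦ ?_⟩, ?_⟩
  · have h1 : A (R x) = R (A x) :=
      congrArg (fun f : Module.End ℝ V ↦ f x) (sub_eq_zero.1 hRA)
    change T (R (A x)) = A (T (R x))
    rw [← h1, hTA]
  · have h2 (y : V) : ‖T y‖ = ‖y‖ := by
      rw [← sq_eq_sq₀ (norm_nonneg _) (norm_nonneg _), ← real_inner_self_eq_norm_sq, hT,
        real_inner_self_eq_norm_sq]
    change ‖T (R x)‖ = _
    rw [h2, hR c x hx, norm_smul, Real.norm_of_nonneg (Real.exp_pos _).le]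
  · exact IsSemisimple.mul_of_commute (sub_eq_zero.1 hRT) (isSemisimple_of_isometry hT)
      (isFinitelySemisimple_iff_isSemisimple.1 (isSymmetric_of_scalar hA hR).isFinitelySemisimple)

end Triangular

/-! ### The adjoint representation on the Lie algebra normed by the Cartan involution -/

section Adjoint
variable {E : Type*} [NormedAddCommGroup E] [NormedSpace ℝ E] [CompleteSpace E]
  {G : Type*} [TopologicalSpace G] [ChartedSpace E G] [Group G] [LieGroup 𝓘(ℝ, E) ∞ G]

theorem differential_comp_adCLM (D : IwasawaData E G) (g : G) (X : E) :
    differential E D.θ (adCLM E g X) = adCLM E (D.θ g) (differential E D.θ X : E) := by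
  have hs (x : G) : MDifferentiableAt 𝓘(ℝ, E) 𝓘(ℝ, E) (fun x : G ↦ D.θ x) x :=
    D.isCartan.smooth.mdifferentiable (by simp) x
  have hc (g x : G) : MDifferentiableAt 𝓘(ℝ, E) 𝓘(ℝ, E) (fun x : G ↦ g * x * g⁻¹) x :=
    (mdiff_right g⁻¹ (g * x)).comp x (mdiff_left g x)
  have h1 := mfderiv_comp_model (x := (1 : G)) (hs 1) (hc g 1) (by simp)
  have h2 := mfderiv_comp_model (x := (1 : G)) (hc (D.θ g) 1) (hs 1) (by simp)
  have e : (fun x : G ↦ D.θ x) ∘ (fun x : G ↦ g * x * g⁻¹) =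
      (fun x : G ↦ D.θ g * x * (D.θ g)⁻¹) ∘ (fun x : G ↦ D.θ x) := by ext x; simp
  rw [e] at h1
  exact congrArg (fun f : E →L[ℝ] E ↦ f X) (h1.symm.trans h2)

theorem differential_differential (D : IwasawaData E G) (X : E) :
    differential E D.θ (differential E D.θ X) = X := by
  have hs (x : G) : MDifferentiableAt 𝓘(ℝ, E) 𝓘(ℝ, E) (fun x : G ↦ D.θ x) x :=
    D.isCartan.smooth.mdifferentiable (by simp) x
  have h1 := mfderiv_comp_model (x := (1 : G)) (hs 1) (hs 1) (by simp)
  have e : (fun x : G ↦ D.θ x) ∘ (fun x : G ↦ D.θ x) = id := funext D.isCartan.involutive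
  rw [e, mfderiv_id] at h1
  exact congrArg (fun f : E →L[ℝ] E ↦ f X) h1.symm

namespace IwasawaData

/-- The Lie algebra of `G`, to be normed by `-B(X, θ X)`. -/
def Alg (_D : IwasawaData E G) : Type _ := LieAlg E G

variable (D : IwasawaData E G)

instance : LieRing D.Alg := inferInstanceAs (LieRing (LieAlg E G))
instance : LieAlgebra ℝ D.Alg := inferInstanceAs (LieAlgebra ℝ (LieAlg E G))
instance [FiniteDimensional ℝ E] : FiniteDimensional ℝ D.Alg :=
  inferInstanceAs (FiniteDimensional ℝ E)

instance : CartanLieAlgebra D.Alg where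
  θ := differential E D.θ
  θ_θ := differential_differential D
  θ_lie := differential_lie E D.isCartan
  pos := D.isCartan.posDef

variable [FiniteDimensional ℝ E]

/-- The identification of the two normed structures on the Lie algebra. -/
def toAlg : E ≃L[ℝ] D.Alg :=
  LinearEquiv.toContinuousLinearEquiv (LinearEquiv.refl ℝ E : E ≃ₗ[ℝ] D.Alg)

/-- `Ad g` on the Lie algebra normed by the Cartan involution. -/
def AdK (g : G) : D.Alg →L[ℝ] D.Alg :=
  (D.toAlg : E →L[ℝ] D.Alg).comp ((adCLM E g).comp (D.toAlg.symm : D.Alg →L[ℝ] E))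

theorem continuous_AdK : Continuous D.AdK :=
  continuous_const.clm_comp (continuous_adCLM.clm_comp continuous_const)

theorem AdK_mul (g h : G) : D.AdK (g * h) = D.AdK g * D.AdK h := by
  ext X
  change adCLM E (g * h) X = adCLM E g (adCLM E h X)
  rw [adCLM_mul]; rfl

theorem AdK_one : D.AdK (1 : G) = 1 := by
  ext X
  change adCLM E (1 : G) X = X
  rw [adCLM_one]; rfl

theorem isUnit_AdK (g : G) : IsUnit (D.AdK g) :=
  ⟨⟨D.AdK g, D.AdK g⁻¹, by rw [← AdK_mul, mul_inv_cancel, AdK_one],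
    by rw [← AdK_mul, inv_mul_cancel, AdK_one]⟩, rfl⟩

theorem AdK_lie (g : G) (X Y : D.Alg) : D.AdK g ⁅X, Y⁆ = ⁅D.AdK g X, D.AdK g Y⁆ :=
  adCLM_modelBracket (E := E) g X Y

theorem isKAut_AdK {k : G} (hk : k ∈ D.K) : IsKAut (D.AdK k) where
  isUnit := D.isUnit_AdK k
  map_lie := D.AdK_lie k
  comm X := by
    have := differential_comp_adCLM D k X
    rw [show D.θ k = k from hk] at this
    exact this.symm

theorem hasDerivAt_AdK {X : D.Alg} {γ : ℝ → G} (hγ : IsOneParam E X γ) (Y : D.Alg) (t : ℝ) :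
    HasDerivAt (fun t ↦ D.AdK (γ t) Y) (D.AdK (γ t) ⁅X, Y⁆) t :=
  (D.toAlg : E →L[ℝ] D.Alg).hasFDerivAt.comp_hasDerivAt t (hasDerivAt_adCLM hγ Y t)

/-- The curve `exp (-t ad X) Ad (γ t) Y` has zero derivative, because `Ad (γ t)` fixes `X` and so
commutes with `ad X`. -/
theorem AdK_oneParam {X : D.Alg} {γ : ℝ → G} (hγ : IsOneParam E X γ) (t : ℝ) :
    D.AdK (γ t) = NormedSpace.exp (t • bracketCLM D.Alg X) := by
  have hX (t : ℝ) : D.AdK (γ t) X = X := by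
    have hd (t : ℝ) : HasDerivAt (fun t ↦ D.AdK (γ t) X) 0 t := by
      have := D.hasDerivAt_AdK hγ X t
      rwa [lie_self, map_zero] at this
    have := is_const_of_deriv_eq_zero (fun t ↦ (hd t).differentiableAt) (fun t ↦ (hd t).deriv) t 0
    rw [this, hγ.map_zero, AdK_one]; rfl
  ext Y
  have hd (t : ℝ) : HasDerivAt (fun t : ℝ ↦ NormedSpace.exp (t • (-bracketCLM D.Alg X))
      (D.AdK (γ t) Y)) 0 t := by
    have h1 := (hasDerivAt_exp_smul_const (𝕂 := ℝ) (-bracketCLM D.Alg X) t).clm_apply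
      (D.hasDerivAt_AdK hγ Y t)
    rw [AdK_lie, hX] at h1
    convert! h1 using 1
    simp
  have h2 := is_const_of_deriv_eq_zero (fun t ↦ (hd t).differentiableAt) (fun t ↦ (hd t).deriv) t 0
  simp only [zero_smul, hγ.map_zero, AdK_one, NormedSpace.exp_zero] at h2
  rw [smul_neg] at h2
  rw [← exp_apply_exp_neg (t • bracketCLM D.Alg X) (D.AdK (γ t) Y), h2]
  rfl

/-- Uniqueness of one-parameter subgroups turns a fixed vector of `Ad g` into group elements that
commute with `g`. -/
theorem conj_oneParam {X : D.Alg} {γ : ℝ → G} (hγ : IsOneParam E X γ) {g : G}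
    (hg : D.AdK g X = X) (t : ℝ) : g * γ t * g⁻¹ = γ t := by
  have h1 := hγ.conj g
  have hg' : adCLM E g X = X := hg
  rw [hg'] at h1
  exact congrFun (h1.unique hγ) t

theorem oneParam_mem {V : Submodule ℝ (LieAlg E G)} {X : D.Alg} (hX : X ∈ V) {γ : ℝ → G}
    (hγ : IsOneParam E X γ) (t : ℝ) : γ t ∈ analyticSubgroup E V :=
  Subgroup.subset_closure ⟨t • X, V.smul_mem t hX, _, hγ.smul t, by rw [mul_one]⟩

theorem rank_le (hequal : D.EqualRank) {Y : D.Alg} (hY : CartanLieAlgebra.θ Y = Y) :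
    LieAlgebra.rank ℝ D.Alg ≤ Module.finrank ℝ
      (LinearMap.ker (LieAlgebra.ad ℝ D.Alg Y) ⊓
        LinearMap.ker ((CartanLieAlgebra.θ : D.Alg →ₗ[ℝ] D.Alg) - 1) : Submodule ℝ D.Alg) := by
  let 𝔨 : LieSubalgebra ℝ D.Alg := D.𝔨
  have h : LieAlgebra.rank ℝ D.Alg = LieAlgebra.rank ℝ 𝔨 := hequal
  rw [h]
  exact rank_le_finrank_centralizer 𝔨 (fun _ ↦ Iff.rfl) hY

end IwasawaData
end Adjoint

/-! ### `M`, `A` and `N` in real rank one -/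

namespace IwasawaData
open Module.End

variable {E : Type*} [NormedAddCommGroup E] [NormedSpace ℝ E] [FiniteDimensional ℝ E]
  [CompleteSpace E] {G : Type*} [TopologicalSpace G] [ChartedSpace E G] [Group G]
  [LieGroup 𝓘(ℝ, E) ∞ G] (D : IwasawaData E G)

/-- An element of `𝔞` in the Lie algebra normed by the Cartan involution. -/
def vec (W : D.𝔞) : D.Alg := (W : LieAlg E G)

/-- The regular element `H₀` in the Lie algebra normed by the Cartan involution. -/
def H : D.Alg := D.vec D.H₀

theorem theta_of_mem {W : D.Alg} (hW : W ∈ D.𝔞) : CartanLieAlgebra.θ W = -W := by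
  have h : CartanLieAlgebra.θ W = (-1 : ℝ) • W := mem_eigenspace_iff.1 (D.maximal.prop.1 hW)
  rw [h, neg_one_smul]

theorem theta_H : CartanLieAlgebra.θ D.H = -D.H := D.theta_of_mem D.H₀.2

theorem mem_rootSpace {lam : Module.Dual ℝ D.𝔞} {x : D.Alg} :
    x ∈ rootSpace E D.𝔞 lam ↔ ∀ W : D.𝔞, ⁅D.vec W, x⁆ = lam W • x := by
  have h (x : LieAlg E G) : x ∈ rootSpace E D.𝔞 lam ↔
      ∀ W : D.𝔞, ⁅(W : LieAlg E G), x⁆ = lam W • x := by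
    rw [rootSpace, Submodule.mem_iInf]
    exact forall_congr' fun W ↦ mem_eigenspace_iff
  exact h x

theorem exists_dual_eq {v : D.𝔞} (hv : v ≠ 0) (c : ℝ) : ∃ lam : Module.Dual ℝ D.𝔞, lam v = c := by
  obtain ⟨f, hf⟩ := Module.Projective.exists_dual_ne_zero ℝ hv
  exact ⟨(c / f v) • f, by rw [LinearMap.smul_apply, smul_eq_mul, div_mul_cancel₀ _ hf]⟩

/-- The subspace `𝔫` in the Lie algebra normed by the Cartan involution. -/
def 𝔫K : Submodule ℝ D.Alg := D.𝔫

variable (hrank : D.realRank = 1)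
include hrank

/-- A positive eigenvalue of a generator of `𝔞` defines a nonzero restricted root, and regularity
forbids that root to vanish at `H₀`. -/
theorem H₀_ne_zero : D.H₀ ≠ 0 := by
  obtain ⟨v, hv, hspan⟩ := finrank_eq_one_iff'.1 hrank
  let W : D.Alg := D.vec v
  have hW0 : W ≠ 0 := fun h ↦ hv (Subtype.ext h)
  obtain ⟨c, hc, x, hx, hx0⟩ := exists_pos_eigenvector (D.theta_of_mem v.2 : CartanLieAlgebra.θ W = -W) hW0
  obtain ⟨lam, hlam⟩ := D.exists_dual_eq hv c
  have hmem : x ∈ rootSpace E D.𝔞 lam := by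
    rw [mem_rootSpace]
    intro U
    obtain ⟨t, rfl⟩ := hspan U
    have : ⁅t • W, x⁆ = (t * c) • x := by rw [smul_lie, hx, smul_smul]
    rw [map_smul, hlam]
    exact this
  have := D.regular lam (fun h ↦ hc.ne' (by rw [← hlam, h]; rfl))
    (fun h ↦ hx0 (by rw [h] at hmem; exact hmem))
  exact fun h ↦ this (by rw [h, map_zero])

theorem H_ne_zero : D.H ≠ 0 := fun h ↦ D.H₀_ne_zero hrank (Subtype.ext h)

theorem exists_smul_H {W : D.Alg} (hW : W ∈ D.𝔞) : ∃ t : ℝ, W = t • D.H := by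
  obtain ⟨t, ht⟩ := (finrank_eq_one_iff_of_nonzero' D.H₀ (D.H₀_ne_zero hrank)).1 hrank ⟨W, hW⟩
  exact ⟨t, (congrArg Subtype.val ht).symm⟩

/-- In rank one a linear form on `𝔞` is determined by its value at `H₀`, so restricted root spaces
are the eigenspaces of `ad H`. -/
theorem 𝔫_eq : D.𝔫K = upper (adEnd D.H) 0 := by
  refine le_antisymm ?_ ?_
  · refine iSup₂_le fun lam hlam x hx ↦ eigenspace_le_upper _ hlam ?_
    rw [mem_eigenspace_iff]
    exact D.mem_rootSpace.1 hx D.H₀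
  · refine upper_le fun c hc x hx ↦ ?_
    obtain ⟨lam, hlam⟩ := D.exists_dual_eq (D.H₀_ne_zero hrank) c
    have hmem : x ∈ rootSpace E D.𝔞 lam := by
      rw [mem_rootSpace]
      rintro ⟨U, hU⟩
      obtain ⟨t, ht⟩ := (finrank_eq_one_iff_of_nonzero' D.H₀ (D.H₀_ne_zero hrank)).1 hrank ⟨U, hU⟩
      rw [← ht, map_smul, hlam]
      have : ⁅t • D.H, x⁆ = (t * c) • x := by
        rw [smul_lie, show ⁅D.H, x⁆ = c • x from hx, smul_smul]
      exact this
    exact (le_iSup₂_of_le (f := fun (lam : Module.Dual ℝ D.𝔞) (_ : 0 < lam D.H₀) ↦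
      rootSpace E D.𝔞 lam) lam (by rw [hlam]; exact hc) le_rfl) hmem

theorem mem_𝔫 {X : D.Alg} : X ∈ D.𝔫 ↔ X ∈ upper (adEnd D.H) 0 := by
  rw [← D.𝔫_eq hrank]; rfl

/-- For a generator `exp (s H)` of `A` this is `Ad (exp X) = exp (ad X)`; the parameters add under
products. -/
theorem AdK_of_mem_A {a : G} (ha : a ∈ D.A) : ∃ s : ℝ, ∀ (c : ℝ) (x : D.Alg),
    adEnd D.H x = c • x → D.AdK a x = Real.exp (s * c) • x := by
  induction ha using Subgroup.closure_induction with
  | mem a ha =>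
    obtain ⟨X, hX, γ, hγ, rfl⟩ := ha
    obtain ⟨t, ht⟩ := D.exists_smul_H hrank hX
    refine ⟨t, fun c x hx ↦ ?_⟩
    rw [D.AdK_oneParam hγ]
    refine exp_apply_eq_smul ?_
    rw [one_smul, ht, bracketCLM_apply, smul_lie, show ⁅D.H, x⁆ = c • x from hx, smul_smul]
  | one => exact ⟨0, fun c x _ ↦ by rw [AdK_one]; simp⟩
  | mul a b _ _ iha ihb =>
    obtain ⟨s, hs⟩ := iha
    obtain ⟨t, ht⟩ := ihb
    refine ⟨s + t, fun c x hx ↦ ?_⟩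
    rw [AdK_mul, mul_apply_eq_comp, ht c x hx, map_smul, hs c x hx, smul_smul, ← Real.exp_add]
    congr 2; ring
  | inv a _ iha =>
    obtain ⟨s, hs⟩ := iha
    refine ⟨-s, fun c x hx ↦ ?_⟩
    apply (bijective_of_isUnit (D.isUnit_AdK a)).1
    rw [map_smul, hs c x hx, smul_smul, ← Real.exp_add, ← mul_apply_eq_comp, ← AdK_mul,
      mul_inv_cancel, AdK_one]
    simp

theorem isTriangular_of_mem_N {n : G} (hn : n ∈ D.N) :
    IsTriangular (adEnd D.H) 1 (D.AdK n : D.Alg →ₗ[ℝ] D.Alg) := by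
  -- Triangularity with diagonal `1` is only known to be stable under products, so the inverse is
  -- carried through the induction.
  suffices h : IsTriangular (adEnd D.H) 1 (D.AdK n : D.Alg →ₗ[ℝ] D.Alg) ∧
    IsTriangular (adEnd D.H) 1 (D.AdK n⁻¹ : D.Alg →ₗ[ℝ] D.Alg) from h.1
  induction hn using Subgroup.closure_induction with
  | mem n hn =>
    obtain ⟨X, hX, γ, hγ, rfl⟩ := hn
    let X' : D.Alg := X
    have key (t : ℝ) : IsTriangular (adEnd D.H) 1 (D.AdK (γ t) : D.Alg →ₗ[ℝ] D.Alg) := by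
      rw [D.AdK_oneParam (X := X') hγ, ← map_smul]
      exact isTriangular_exp (Submodule.smul_mem _ t ((D.mem_𝔫 hrank).1 hX))
    have hinv : (γ 1)⁻¹ = γ (-1) := by
      rw [inv_eq_iff_mul_eq_one, ← hγ.map_add, add_neg_cancel, hγ.map_zero]
    exact ⟨key 1, by rw [hinv]; exact key (-1)⟩
  | one =>
    have : IsTriangular (adEnd D.H) 1 (D.AdK (1 : G) : D.Alg →ₗ[ℝ] D.Alg) := fun c x _ ↦ by
      rw [AdK_one]; simp
    exact ⟨this, by rwa [inv_one]⟩
  | mul a b _ _ iha ihb =>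
    refine ⟨?_, ?_⟩
    · rw [AdK_mul]; exact iha.1.mul ihb.1
    · rw [mul_inv_rev, AdK_mul]; exact ihb.2.mul iha.2
  | inv a _ iha => exact ⟨iha.2, by rw [inv_inv]; exact iha.1⟩

omit hrank in
-- `m` centralizes the one-parameter group of `H`, which lies in `A`; comparing velocities gives the
-- claim.
theorem AdK_H {m : G} (hm : m ∈ D.M) : D.AdK m D.H = D.H := by
  obtain ⟨γ, hγ⟩ := exists_isOneParam (E := E) G D.H
  have h1 := hγ.conj m
  have e : (fun t ↦ m * γ t * m⁻¹) = γ := by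
    ext t
    have := Subgroup.mem_centralizer_iff.1 hm.2 (γ t) (D.oneParam_mem D.H₀.2 hγ t)
    rw [← this, mul_inv_cancel_right]
  rw [e] at h1
  exact h1.velocity.symm.trans hγ.velocity

end IwasawaData

/-! ### Trivial centralizer implies hyperbolic -/

namespace IwasawaData
open Module.End

variable {E : Type*} [NormedAddCommGroup E] [NormedSpace ℝ E] [FiniteDimensional ℝ E]
  [CompleteSpace E] {G : Type*} [TopologicalSpace G] [ChartedSpace E G] [Group G]
  [LieGroup 𝓘(ℝ, E) ∞ G] (D : IwasawaData E G)

/-- `Ad (m a n)` is block triangular, with a semisimple diagonal part. -/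
theorem exists_graded (hrank : D.realRank = 1) {m a n : G} (hm : m ∈ D.M) (ha : a ∈ D.A)
    (hn : n ∈ D.N) : ∃ (s : ℝ) (S : Module.End ℝ D.Alg), IsGraded (adEnd D.H) S s ∧
      S.IsSemisimple ∧ IsTriangular (adEnd D.H) S (D.AdK (m * a * n) : D.Alg →ₗ[ℝ] D.Alg) ∧
      (s = 0 → S = (D.AdK m : D.Alg →ₗ[ℝ] D.Alg)) := by
  obtain ⟨s, hs⟩ := D.AdK_of_mem_A hrank ha
  have hmK := D.isKAut_AdK hm.1
  have hsym := adEnd_symmetric D.theta_H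
  obtain ⟨h1, h2⟩ := isGraded_mul (A := adEnd D.H) (T := (D.AdK m : D.Alg →ₗ[ℝ] D.Alg))
    (R := (D.AdK a : D.Alg →ₗ[ℝ] D.Alg)) hmK.inner_map (fun x ↦ by
      have := hmK.map_lie D.H x
      rwa [D.AdK_H hm] at this) hsym hs
  refine ⟨s, _, h1, h2, ?_, fun h0 ↦ ?_⟩
  · rw [AdK_mul, AdK_mul]
    exact (D.isTriangular_of_mem_N hrank hn).graded_mul h1
  · have : (D.AdK a : D.Alg →ₗ[ℝ] D.Alg) - 1 = 0 := linearMap_eq_zero hsym fun c x hx ↦ by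
      rw [LinearMap.sub_apply, ContinuousLinearMap.coe_coe, hs c x hx, h0]
      simp
    rw [sub_eq_zero.1 this, mul_one]

/-- If `G` and `K` have equal rank, an element of `M N` commutes with a nontrivial element of `N`. -/
theorem exists_commuting_oneParam [ConnectedSpace G] (hrank : D.realRank = 1)
    (hequal : D.EqualRank) {η m : G} (hm : m ∈ D.M)
    (hg : IsGraded (adEnd D.H) (D.AdK m : D.Alg →ₗ[ℝ] D.Alg) 0)
    (hη : IsTriangular (adEnd D.H) (D.AdK m : D.Alg →ₗ[ℝ] D.Alg)
      (D.AdK η : D.Alg →ₗ[ℝ] D.Alg)) :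
    ∃ n ∈ D.N, η * n = n * η ∧ n ≠ 1 := by
  have hmK := D.isKAut_AdK hm.1
  obtain ⟨c, hc, x, hx, hTx, hx0⟩ := exists_fixed_vector hmK
    (isGood_of_connected D.continuous_AdK D.isUnit_AdK D.AdK_lie D.AdK_one hmK) D.theta_H
    (D.H_ne_zero hrank) (D.AdK_H hm) fun _ ↦ D.rank_le hequal
  obtain ⟨y, hy, hfix, hy0⟩ := hη.exists_fixed (adEnd_symmetric D.theta_H) hg hx hTx hx0
  have hyn : y ∈ D.𝔫 := by
    rw [D.mem_𝔫 hrank]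
    have hle : eigenspace (adEnd D.H) c ⊔ upper (adEnd D.H) c ≤ upper (adEnd D.H) 0 :=
      sup_le (eigenspace_le_upper _ hc) (upper_anti _ hc.le)
    exact hle hy
  obtain ⟨γ, hγ⟩ := exists_isOneParam (E := E) G y
  -- A one-parameter group with nonzero velocity is not constant, though particular values may be
  -- `1`.
  have hne : ∃ t, γ t ≠ 1 := by
    by_contra! h
    have hγ1 : γ = fun _ ↦ 1 := funext h
    have hv := hγ.velocity
    rw [hγ1, mfderiv_const] at hv
    exact hy0 hv.symm
  obtain ⟨t, ht⟩ := hne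
  refine ⟨γ t, D.oneParam_mem hyn hγ t, ?_, ht⟩
  have := D.conj_oneParam (X := y) hγ (g := η) hfix t
  rwa [mul_inv_eq_iff_eq_mul] at this

/-- Everything is read off the scaling parameter `s` of the `A`-component: `s = 0` would give a
nontrivial element of `U` commuting with `ξ`, and `s ≠ 0` makes `ξ` hyperbolic. -/
theorem isHyperbolic_of_trivial_centralizer [ConnectedSpace G] (hrank : D.realRank = 1)
    (hequal : D.EqualRank) {P U : Subgroup G} (hPU : D.IsParabolic P U) {ξ : G} (hξ : ξ ∈ P)
    (hU : U ⊓ Subgroup.centralizer {ξ} = ⊥) : D.IsHyperbolic ξ := by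
  obtain ⟨g, hP, hN⟩ := hPU
  obtain ⟨m, hm, a, ha, n, hn, rfl⟩ := (hP ξ).1 hξ
  set η := m * a * n with hηdef
  obtain ⟨s, S, hgr, hss, htri, h0⟩ := D.exists_graded hrank hm ha hn
  rw [← hηdef] at htri
  have hsym := adEnd_symmetric D.theta_H
  have hs : s ≠ 0 := by
    rintro rfl
    rw [h0 rfl] at hgr htri
    obtain ⟨ν, hν, hcomm, hne⟩ := D.exists_commuting_oneParam hrank hequal hm hgr htri
    have hmem : g * ν * g⁻¹ ∈ U ⊓ Subgroup.centralizer {g * η * g⁻¹} := by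
      refine ⟨(hN _).2 ⟨ν, hν, rfl⟩, Subgroup.mem_centralizer_singleton_iff.2 ?_⟩
      calc g * ν * g⁻¹ * (g * η * g⁻¹) = g * (ν * η) * g⁻¹ := by group
        _ = g * (η * ν) * g⁻¹ := by rw [hcomm]
        _ = g * η * g⁻¹ * (g * ν * g⁻¹) := by group
    rw [hU, Subgroup.mem_bot, conj_eq_one_iff] at hmem
    exact hne hmem
  -- One statement excludes both cases: for central `ξ` and for elliptic `ξ`, `η` is conjugate to an
  -- element acting by isometries.
  have hnot (p k : G) (hk : IsKAut (D.AdK k)) (hpk : p * η = k * p) : False := by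
    obtain ⟨c, hc, x, hx, hx0⟩ := exists_pos_eigenvector D.theta_H (D.H_ne_zero hrank)
    refine htri.not_conj_isometry hsym hgr hs hc hx hx0
      (P := (D.AdK p : D.Alg →ₗ[ℝ] D.Alg)) (k := (D.AdK k : D.Alg →ₗ[ℝ] D.Alg))
      (bijective_of_isUnit (D.isUnit_AdK p)).1 (fun y ↦ ?_) fun y ↦ ?_
    · rw [← sq_eq_sq₀ (norm_nonneg _) (norm_nonneg _), ← real_inner_self_eq_norm_sq,
        ← real_inner_self_eq_norm_sq]
      exact hk.inner_map y y
    · have := congrArg (fun f : D.Alg →L[ℝ] D.Alg ↦ f y) (congrArg D.AdK hpk)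
      simpa [AdK_mul] using this
  refine ⟨?_, fun hc ↦ ?_, fun hell ↦ ?_⟩
  · let e : D.Alg ≃ₗ[ℝ] D.Alg := LinearEquiv.ofBijective (D.AdK g : D.Alg →ₗ[ℝ] D.Alg)
      (bijective_of_isUnit (D.isUnit_AdK g))
    refine (LinearEquiv.isSemisimple_iff (D.AdK η : D.Alg →ₗ[ℝ] D.Alg)
      (D.AdK (g * η * g⁻¹) : D.Alg →ₗ[ℝ] D.Alg) e ?_).1 (htri.isSemisimple hsym hgr hs hss)
    ext y
    change (D.AdK g * D.AdK η) y = (D.AdK (g * η * g⁻¹) * D.AdK g) y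
    rw [← AdK_mul, ← AdK_mul, inv_mul_cancel_right]
  · refine hnot g (g * η * g⁻¹) ?_ (by group)
    have h1 : D.AdK (g * η * g⁻¹) = 1 := by
      ext y
      change adCLM E (g * η * g⁻¹) y = y
      have e : (fun x : G ↦ g * η * g⁻¹ * x * (g * η * g⁻¹)⁻¹) = id := by
        ext x
        rw [← Subgroup.mem_center_iff.1 hc x, mul_inv_cancel_right, id]
      rw [adCLM, e, mfderiv_id]
      rfl
    rw [h1]
    exact IsKAut.one
  · obtain ⟨-, h, hK⟩ := hell
    exact hnot (h * g) _ (D.isKAut_AdK hK) (by group)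

end IwasawaData

end RankOne

end

theorem mainTheorem7
    {E : Type*} [NormedAddCommGroup E] [NormedSpace ℝ E] [FiniteDimensional ℝ E] [CompleteSpace E]
    {G : Type*} [TopologicalSpace G] [ChartedSpace E G] [Group G] [LieGroup 𝓘(ℝ, E) ∞ G]
    [ConnectedSpace G] [NoncompactSpace G] [MeasurableSpace G] [BorelSpace G]
    (hsimple : LieAlgebra.IsSimple ℝ (RankOne.LieAlg E G))
    (hcenter : Finite (Subgroup.center G))
    (D : RankOne.IwasawaData E G)
    (hrank : D.realRank = 1)
    (hequal : D.EqualRank)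
    (Γ : Subgroup G) (hΓ : RankOne.IsLattice Γ)
    (α : G) (hα : α ∈ Subgroup.Commensurable.commensurator Γ) :
    D.XiPr Γ α ⊆ D.XiH Γ α ∧
      D.XiH Γ α = D.XiPr Γ α ∪ D.XiHs Γ α ∧ Disjoint (D.XiPr Γ α) (D.XiHs Γ α) := by
  have hsub : D.XiPr Γ α ⊆ D.XiH Γ α := by
    rintro ξ ⟨hξ, P, U, hPU, hP, hU⟩
    exact ⟨hξ.1, D.isHyperbolic_of_trivial_centralizer hrank hequal hPU.1 hP hU⟩
  exact ⟨hsub, (Set.union_sdiff_cancel hsub).symm, Set.disjoint_sdiff_right⟩
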